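/- Let $d,p\ge 1$ be integers, with $p\le 2$ if $d=1$. Let $s\ge 0$ be an integer, $0<\gamma\le 1$, $\alpha=s+\gamma$, and let $L>0$, $B_0,\dots,B_s>0$, $\overline C>1$, $C>0$ be constants. Let $\Lambda^{s,\gamma}(L)$ be the set of all $s$ times differentiable functions $\lambda:\mathbb{R}\to\mathbb{R}$ with $|\lambda^{(s)}(z_1)-\lambda^{(s)}(z_2)|\le L|z_1-z_2|^{\gamma}$ for all $z_1,z_2\in\mathbb{R}$ and $\sup_{z}|\lambda^{(k)}(z)|\le B_k$ for $0\le k\le s$. Let $\mathcal{U}$ be the class of functions $$\mu(x)=\sum_{i=1}^p\lambda_i(\beta_{(i)}^Tx),\qquad x\in[0,1]^d,$$ where $\beta_{(1)},\dots,\beta_{(p)}\in\mathbb{R}^d$ are distinct with $\|\beta_{(i)}\|_2=1$, and $\lambda_1,\dots,\lambda_p\in\Lambda^{s,\gamma}(L)$ are non-constant. Let $\Sigma=\{\exp(\sum_{i=1}^dc_ix_i):\max_i|c_i|\le C\}$, and let $\mathcal{H}$ be the class of probability densities $h$ on $[0,1]^d$ with $1/\overline C\le h\le\overline C$. One observes i.i.d.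 pairs $(X_i,Y_i)$, $1\le i\le n$, with $$Y_i=\mu(X_i)+\sigma(X_i)\epsilon_i,$$ where $X_i$ has density $h\in\mathcal{H}$, $\mu\in\mathcal{U}$, $\sigma\in\Sigma$, and $\epsilon_i$ is independent of $X_i$ with known Lebesgue density $\frac1{\sigma_0}f_0(\frac{y-\eta_0}{\sigma_0})$; here $\eta_0\in\mathbb{R}$ and $\sigma_0>0$ are fixed (in particular $\eta_0=0$, $\sigma_0=1$ is allowed) and $f_0$ is one of the following densities, where $\rho_\tau(y)=y(\tau-I(y<0))$ and $\Gamma(t,k)=\int_k^\infty x^{t-1}e^{-x}dx$: 1. asymmetric Laplace: $\tau(1-\tau)e^{-\rho_\tau(y)}$, $0<\tau<1$; 2. asymmetric connected double truncated gamma: $\frac{\tau(1-\tau)}{\Gamma(a+1,a)}[a+\rho_\tau(y)]^ae^{-[a+\rho_\tau(y)]}$, $a\ge 0$, $0<\tau<1$; 3. connected normal-Laplace: $\frac{2\tau}{\sqrt{2\pi}}e^{-y^2/2}I(y\le 0)+\frac{1-\tau}{b}e^{-y/b}I(y>0)$, $0<\tau<1$, $b>0$, $\frac{1-\tau}{b}=\frac{2\tau}{\sqrt{2\pi}}$;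 4. Cauchy: $\frac1{\pi(1+y^2)}$; 5. asymmetric normal: $\frac{2}{\sqrt\pi}\frac{\sqrt{\phi(1-\phi)}}{\sqrt\phi+\sqrt{1-\phi}}\exp[-\phi y^2I(y\ge 0)-(1-\phi)y^2I(y<0)]$, $0<\phi<1$. Then the minimax risk under the squared $L_2(h)$ loss is of order $n^{-2\alpha/(2\alpha+1)}$: there are constants $c_1,c_2>0$, not depending on $n$, such that for all $n\ge 1$ $$c_1\,n^{-\frac{2\alpha}{2\alpha+1}}\le\inf_{\hat\mu}\ \sup_{\mu\in\mathcal{U},\,\sigma\in\Sigma,\,h\in\mathcal{H}}\mathbb{E}\int_{[0,1]^d}(\mu(x)-\hat\mu(x))^2h(x)\,dx\le c_2\,n^{-\frac{2\alpha}{2\alpha+1}},$$ where the infimum is over all estimators $\hat\mu$ that are measurable functions of the data and of $x$. -/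

import Mathlib

open MeasureTheory Set
open scoped ENNReal

noncomputable section

namespace LocationScale

/-! ### Error densities -/

/-- The check loss `ρ_τ(y) = y (τ - 1{y < 0})`. -/
def checkLoss (τ y : ℝ) : ℝ := y * (τ - if y < 0 then 1 else 0)

/-- The standard asymmetric Laplace density. -/
def aldDensity (τ y : ℝ) : ℝ := τ * (1 - τ) * Real.exp (-checkLoss τ y)

/-- The upper incomplete gamma function `Γ(t, k) = ∫_k^∞ x^(t-1) e^(-x) dx`. -/
def upperGamma (t k : ℝ) : ℝ := ∫ x in Ioi k, x ^ (t - 1) * Real.exp (-x)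

/-- The standard asymmetric connected double truncated gamma density with shape `a`. -/
def acdtgDensity (a τ y : ℝ) : ℝ :=
  τ * (1 - τ) / upperGamma (a + 1) a * (a + checkLoss τ y) ^ a *
    Real.exp (-(a + checkLoss τ y))

/-- The standard connected normal-Laplace density: half-normal on the left of `0`,
exponential with scale `b` on the right. -/
def cnlDensity (τ b y : ℝ) : ℝ :=
  if y ≤ 0 then 2 * τ / √(2 * Real.pi) * Real.exp (-(y ^ 2 / 2))
  else (1 - τ) / b * Real.exp (-(y / b))

/-- The standard asymmetric normal density. -/
def asymNormalDensity (φ y : ℝ) : ℝ :=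
  2 / √Real.pi * (√(φ * (1 - φ)) / (√φ + √(1 - φ))) *
    Real.exp (-((if 0 ≤ y then φ else 1 - φ) * y ^ 2))

/-- The list of admissible error densities, with location `0` and scale `1`. -/
inductive IsStandardErrorDensity : (ℝ → ℝ) → Prop
  | asymmetricLaplace (τ : ℝ) (h0 : 0 < τ) (h1 : τ < 1) :
      IsStandardErrorDensity (aldDensity τ)
  | connectedGamma (a τ : ℝ) (ha : 0 ≤ a) (h0 : 0 < τ) (h1 : τ < 1) :
      IsStandardErrorDensity (acdtgDensity a τ)
  | connectedNormalLaplace (τ b : ℝ) (h0 : 0 < τ) (h1 : τ < 1) (hb : 0 < b)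
      (hcont : (1 - τ) / b = 2 * τ / √(2 * Real.pi)) :
      IsStandardErrorDensity (cnlDensity τ b)
  | cauchy : IsStandardErrorDensity (ProbabilityTheory.cauchyPDFReal 0 1)
  | asymmetricNormal (φ : ℝ) (h0 : 0 < φ) (h1 : φ < 1) :
      IsStandardErrorDensity (asymNormalDensity φ)

/-- The member `(1/σ) f((y - η)/σ)` of the location-scale family generated by `f`. -/
def locScale (f : ℝ → ℝ) (η σ y : ℝ) : ℝ := 1 / σ * f ((y - η) / σ)

/-! ### The regression model and its minimax risk -/

/-- The cube `[0,1]^d`. -/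
def cube (d : ℕ) : Set (Fin d → ℝ) := Icc 0 1

/-- The law of the covariate: density `h` on the cube. -/
def covariateLaw {d : ℕ} (h : (Fin d → ℝ) → ℝ) : Measure (Fin d → ℝ) :=
  (volume.restrict (cube d)).withDensity fun x => ENNReal.ofReal (h x)

/-- The law of the error: Lebesgue density `f`. -/
def errorLaw (f : ℝ → ℝ) : Measure ℝ := volume.withDensity fun y => ENNReal.ofReal (f y)

/-- The law of `(X, Y)`, where `Y = μ(X) + σ(X) ε` with `X` and `ε` independent. -/
def observationLaw {d : ℕ} (f : ℝ → ℝ) (μ σ h : (Fin d → ℝ) → ℝ) :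
    Measure ((Fin d → ℝ) × ℝ) :=
  ((covariateLaw h).prod (errorLaw f)).map fun z => (z.1, μ z.1 + σ z.1 * z.2)

/-- The law of `n` independent observations. -/
def sampleLaw {d : ℕ} (n : ℕ) (f : ℝ → ℝ) (μ σ h : (Fin d → ℝ) → ℝ) :
    Measure (Fin n → (Fin d → ℝ) × ℝ) :=
  Measure.pi fun _ => observationLaw f μ σ h

/-- The risk `𝔼 ‖μ - μ̂‖²_{2,h}` of an estimator `μ̂`, a function of the sample and of the
point `x`. -/
def risk {d n : ℕ} (f : ℝ → ℝ) (μ σ h : (Fin d → ℝ) → ℝ)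
    (est : (Fin n → (Fin d → ℝ) × ℝ) → (Fin d → ℝ) → ℝ) : ℝ≥0∞ :=
  ∫⁻ D, ∫⁻ x, ENNReal.ofReal ((μ x - est D x) ^ 2) ∂(covariateLaw h) ∂(sampleLaw n f μ σ h)

/-- The minimax risk: infimum over all (jointly measurable) estimators of the worst-case risk
over regression functions in `U`, scale functions in `S` and covariate densities in `H`. -/
def minimaxRisk {d : ℕ} (n : ℕ) (f : ℝ → ℝ) (U S H : Set ((Fin d → ℝ) → ℝ)) : ℝ≥0∞ :=
  ⨅ (est : (Fin n → (Fin d → ℝ) × ℝ) → (Fin d → ℝ) → ℝ)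
    (_ : Measurable (Function.uncurry est)),
    ⨆ (μ ∈ U) (σ ∈ S) (h ∈ H), risk f μ σ h est

/-! ### The function classes -/

/-- Probability densities on the cube with values in `[1/K, K]`. -/
def densityClass (d : ℕ) (K : ℝ) : Set ((Fin d → ℝ) → ℝ) :=
  {h | Measurable h ∧ (∀ x ∈ cube d, 1 / K ≤ h x ∧ h x ≤ K) ∧ ∫ x in cube d, h x = 1}

/-- The log-linear scale functions `exp(∑ c_i x_i)` with `max |c_i| ≤ C`. -/
def scaleClass (d : ℕ) (C : ℝ) : Set ((Fin d → ℝ) → ℝ) :=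
  {σ | ∃ c : Fin d → ℝ, (∀ i, |c i| ≤ C) ∧ σ = fun x => Real.exp (∑ i, c i * x i)}

/-- The Hölder class: `s` times continuously differentiable functions on `ℝ` whose `s`-th
derivative is `γ`-Hölder with constant `L` and whose `k`-th derivative is bounded in absolute
value by `B k`, for all `k ≤ s`. -/
def holderClass (s : ℕ) (γ L : ℝ) (B : ℕ → ℝ) : Set (ℝ → ℝ) :=
  {g | ContDiff ℝ s g ∧
    (∀ z₁ z₂, |iteratedDeriv s g z₁ - iteratedDeriv s g z₂| ≤ L * |z₁ - z₂| ^ γ) ∧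
    ∀ k ≤ s, ∀ z, |iteratedDeriv k g z| ≤ B k}

/-- The multiple index class: sums of `p` ridge functions `g_i(β_i^T x)` with distinct unit
directions `β_i` and non-constant profiles `g_i` in the Hölder class. -/
def multipleIndexClass (d p s : ℕ) (γ L : ℝ) (B : ℕ → ℝ) : Set ((Fin d → ℝ) → ℝ) :=
  {μ | ∃ (g : Fin p → ℝ → ℝ) (β : Fin p → EuclideanSpace ℝ (Fin d)),
    (∀ i, g i ∈ holderClass s γ L B ∧ ∃ z₁ z₂, g i z₁ ≠ g i z₂) ∧
    (∀ i, ‖β i‖ = 1) ∧ Function.Injective β ∧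
    μ = fun x => ∑ i, g i (∑ j, β i j * x j)}

end LocationScale

end

/-! Only two properties of the error density matter, and both hold for all five families
(`IsStandardErrorDensity.regularDensity`). On bounded parameter ranges the Hellinger distance
between two location-scale members is at most a constant times the distance of the parameters. A
lower bound on the density over compact sets also makes it at least a constant times the difference
of the locations, whatever the two scales are (`RegularDensity.sq_sub_le_hellingerSq`). No moments
are used, so Cauchy errors are treated like the others.

Upper bound. Up to sup-norm error of order `δ ^ α`, the pairs (mean, scale) are described by `exp (A
/ δ)` labels (`ModelParam.expCodable_valid`). The profiles are functions of one variable and cost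
`exp (A / δ)` by the Kolmogorov-Tikhomirov argument (`expCodable_holderClass`), while directions and
scale coefficients are finite-dimensional and cost only a power of `1 / δ`. This is why the
dimension `d` is absent from the rate. The estimator picks a net element by pairwise tests with a
bounded substitute for the likelihood ratio (`testRatio`), which stays reliable when the truth is
only close to the net (`exists_estimator_risk_le`). The tests use conditional densities of `Y` given
`X` alone, so the unknown design density is never estimated. The loss sees only the mean, so
separation in location suffices and identifiability of the indices is irrelevant. With `δ = n ^ (-1
/ (2α + 1))` the log-cardinality `1 / δ` and the information `n δ ^ (2α)` balance.

Lower bound. With unit scale and uniform design, the first profile acts on the first coordinate and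
is perturbed by about `n ^ (1 / (2α + 1))` disjoint bumps of height of order `m ^ (-α)`, each
switched on or off; the other profiles are fixed. Switching one bump moves the law of one
observation by at most order `1 / n` in squared Hellinger distance, so the samples keep affinity at
least `1 / 2`, and Assouad's lemma (`assouad`) adds up the undetectable errors over the bumps. -/

noncomputable section

namespace LocationScale

/-! ### Product measures -/

section Product

variable {X : Type*} [MeasurableSpace X] {κ : Measure X} [SigmaFinite κ]

/-- Tonelli for a product of functions of separate coordinates. -/
theorem lintegral_pi_prod {n : ℕ} (F : Fin n → X → ℝ≥0∞) (hF : ∀ i, Measurable (F i)) :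
    ∫⁻ D, ∏ i, F i (D i) ∂(Measure.pi fun _ : Fin n => κ) = ∏ i, ∫⁻ x, F i x ∂κ := by
  induction n with
  | zero => simp
  | succ n ih =>
    rw [← (measurePreserving_piFinSuccAbove (fun _ => κ) 0).symm.lintegral_comp]
    · simp only [MeasurableEquiv.piFinSuccAbove_symm_apply, Fin.insertNthEquiv,
        Fin.prod_univ_succ, Fin.insertNth_zero, Equiv.coe_fn_mk, Fin.cons_zero, Fin.cons_succ, Fin.zero_succAbove, cast_eq]
      rw [lintegral_prod_mul (f := fun x => F 0 x)
        (g := fun z : Fin n → X => ∏ i, F i.succ (z i)) (hF 0).aemeasurable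
        (Finset.measurable_prod _ fun i _ => (hF _).comp (measurable_pi_apply i)).aemeasurable,
        ih _ fun i => hF _]
    · exact Finset.measurable_prod _ fun i _ => (hF _).comp (measurable_pi_apply i)

/-- It suffices to compare on boxes, where the indicator factorises over the coordinates. -/
theorem pi_withDensity {n : ℕ} {p : X → ℝ≥0∞} (hp : Measurable p)
    [SigmaFinite (κ.withDensity p)] :
    Measure.pi (fun _ : Fin n => κ.withDensity p) =
      (Measure.pi fun _ : Fin n => κ).withDensity fun D => ∏ i, p (D i) := by
  refine Measure.pi_eq fun s hs => ?_
  rw [withDensity_apply _ (MeasurableSet.univ_pi hs), ← lintegral_indicator (MeasurableSet.univ_pi hs)]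
  have : ∀ D : Fin n → X, (univ.pi s).indicator (fun D => ∏ i, p (D i)) D =
      ∏ i, (s i).indicator p (D i) := by
    intro D
    by_cases h : D ∈ univ.pi s
    · rw [indicator_of_mem h]
      exact Finset.prod_congr rfl fun i _ => (indicator_of_mem (h i (mem_univ i)) _).symm
    · rw [indicator_of_notMem h]
      simp only [mem_univ_pi, not_forall] at h
      obtain ⟨i, hi⟩ := h
      exact (Finset.prod_eq_zero (Finset.mem_univ i) (indicator_of_notMem hi _)).symm
  simp_rw [this]
  rw [lintegral_pi_prod _ fun i => hp.indicator (hs i)]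
  exact Finset.prod_congr rfl fun i _ => by
    rw [lintegral_indicator (hs i), withDensity_apply _ (hs i)]

end Product

/-! ### The two-point inequality -/

section TwoPoint

variable {X : Type*} [MeasurableSpace X] {κ : Measure X}

theorem lintegral_sqrt_mul_sq_le {u v : X → ℝ≥0∞} (hu : Measurable u) (hv : Measurable v) :
    (∫⁻ x, (u x * v x) ^ (1 / 2 : ℝ) ∂κ) ^ 2 ≤ (∫⁻ x, u x ∂κ) * ∫⁻ x, v x ∂κ := by
  have h := ENNReal.lintegral_mul_le_Lp_mul_Lq κ (p := 2) (q := 2)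
    (by rw [Real.holderConjugate_iff]; norm_num)
    (f := fun x => u x ^ (1 / 2 : ℝ)) (g := fun x => v x ^ (1 / 2 : ℝ))
    (hu.pow_const _).aemeasurable (hv.pow_const _).aemeasurable
  simp only [Pi.mul_apply, ← ENNReal.rpow_mul] at h
  norm_num at h
  have e : ∀ x, (u x * v x) ^ (1 / 2 : ℝ) = u x ^ (1 / 2 : ℝ) * v x ^ (1 / 2 : ℝ) := fun x =>
    ENNReal.mul_rpow_of_nonneg _ _ (by norm_num)
  simp_rw [e]
  calc _ ≤ ((∫⁻ x, u x ∂κ) ^ (1 / 2 : ℝ) * (∫⁻ x, v x ∂κ) ^ (1 / 2 : ℝ)) ^ 2 := by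
        gcongr
    _ = _ := by
        rw [mul_pow, ← ENNReal.rpow_natCast, ← ENNReal.rpow_natCast, ← ENNReal.rpow_mul,
          ← ENNReal.rpow_mul]
        norm_num

/-- If two losses add up to at least `Δ`, their expectations under two laws cannot both be small
unless the Hellinger affinity of the laws is small. -/
theorem affinity_sq_le {p q a a' : X → ℝ≥0∞} (hp : Measurable p) (hq : Measurable q)
    (ha : Measurable a) (ha' : Measurable a') (hp1 : ∫⁻ x, p x ∂κ = 1) (hq1 : ∫⁻ x, q x ∂κ = 1)
    {Δ : ℝ≥0∞} (h : ∀ x, Δ ≤ a x + a' x) :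
    Δ * (∫⁻ x, (p x * q x) ^ (1 / 2 : ℝ) ∂κ) ^ 2 ≤
      2 * (∫⁻ x, a x * p x ∂κ + ∫⁻ x, a' x * q x ∂κ) := by
  have two : ∀ x y : ℝ≥0∞, (x + y) ^ 2 ≤ 2 * (x ^ 2 + y ^ 2) := by
    intro x y
    rcases eq_or_ne x ⊤ with rfl | hx
    · simp
    rcases eq_or_ne y ⊤ with rfl | hy
    · simp
    lift x to NNReal using hx
    lift y to NNReal using hy
    norm_cast
    rw [← NNReal.coe_le_coe]
    push_cast
    nlinarith [sq_nonneg ((x : ℝ) - y)]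
  -- Subadditivity of the square root splits `√Δ ≤ √a + √a'`. Each loss is attached to its own
  -- density, so Cauchy-Schwarz leaves the other density with total mass one.
  have key : Δ ^ (1 / 2 : ℝ) * ∫⁻ x, (p x * q x) ^ (1 / 2 : ℝ) ∂κ ≤
      ∫⁻ x, ((a x * p x) * q x) ^ (1 / 2 : ℝ) ∂κ + ∫⁻ x, ((a' x * q x) * p x) ^ (1 / 2 : ℝ) ∂κ := by
    rw [← lintegral_const_mul _ (by fun_prop), ← lintegral_add_left (by fun_prop)]
    refine lintegral_mono fun x => ?_
    calc _ ≤ (a x + a' x) ^ (1 / 2 : ℝ) * (p x * q x) ^ (1 / 2 : ℝ) := by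
          gcongr
          exact h x
      _ ≤ (a x ^ (1 / 2 : ℝ) + a' x ^ (1 / 2 : ℝ)) * (p x * q x) ^ (1 / 2 : ℝ) := by
          gcongr
          exact ENNReal.rpow_add_le_add_rpow _ _ (by norm_num) (by norm_num)
      _ = _ := by
          rw [add_mul, ← ENNReal.mul_rpow_of_nonneg _ _ (by norm_num),
            ← ENNReal.mul_rpow_of_nonneg _ _ (by norm_num)]
          ring_nf
  have e : Δ * (∫⁻ x, (p x * q x) ^ (1 / 2 : ℝ) ∂κ) ^ 2 =
      (Δ ^ (1 / 2 : ℝ) * ∫⁻ x, (p x * q x) ^ (1 / 2 : ℝ) ∂κ) ^ 2 := by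
    rw [mul_pow]
    congr 1
    rw [← ENNReal.rpow_natCast, ← ENNReal.rpow_mul]
    norm_num
  rw [e]
  refine (pow_le_pow_left' key 2).trans ((two _ _).trans ?_)
  gcongr
  · exact (lintegral_sqrt_mul_sq_le (by fun_prop) hq).trans (by rw [hq1, mul_one])
  · exact (lintegral_sqrt_mul_sq_le (by fun_prop) hp).trans (by rw [hp1, mul_one])

end TwoPoint

/-! ### The law of an observation -/

theorem locScale_locScale {f : ℝ → ℝ} {η₀ σ₀ η σ : ℝ} (h₀ : 0 < σ₀) (h : 0 < σ) :
    locScale (locScale f η₀ σ₀) η σ = locScale f (η + σ * η₀) (σ * σ₀) := by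
  ext y
  simp only [locScale]
  rw [← mul_assoc]
  congr 1
  · field_simp
  · congr 1
    field_simp
    ring

theorem lintegral_locScale (f : ℝ → ℝ) (F : ℝ → ℝ≥0∞) (m : ℝ) {σ : ℝ} (hσ : 0 < σ) :
    ∫⁻ y, F y * ENNReal.ofReal (locScale f m σ y) =
      ∫⁻ z, F (m + σ * z) * ENNReal.ofReal (f z) := by
  have himg : (fun z => m + σ * z) '' univ = univ := by
    refine image_univ_of_surjective fun y => ⟨(y - m) / σ, ?_⟩
    field_simp
    ring
  have h := lintegral_image_eq_lintegral_abs_deriv_mul (s := univ) (f := fun z => m + σ * z)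
    (f' := fun _ => σ) MeasurableSet.univ
    (fun x _ => (((hasDerivAt_id x).const_mul σ).const_add m).hasDerivWithinAt.congr_deriv
      (mul_one σ))
    (fun x _ y _ hxy => by simpa [hσ.ne'] using hxy)
    (fun y => F y * ENNReal.ofReal (locScale f m σ y))
  rw [himg, setLIntegral_univ, setLIntegral_univ] at h
  rw [h]
  refine lintegral_congr fun z => ?_
  have : (m + σ * z - m) / σ = z := by
    field_simp
    ring
  rw [abs_of_pos hσ, locScale, this, mul_left_comm, ← ENNReal.ofReal_mul hσ.le, ← mul_assoc,
    mul_one_div_cancel hσ.ne', one_mul]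

theorem measurable_locScale_comp {X : Type*} [MeasurableSpace X] {f : ℝ → ℝ} (hf : Measurable f)
    {μ σ : X → ℝ} (hμ : Measurable μ) (hσ : Measurable σ) :
    Measurable fun z : X × ℝ => locScale f (μ z.1) (σ z.1) z.2 := by
  unfold locScale
  fun_prop

/-- The design density stays inside the dominating measure, so likelihood ratios of two models with
the same `h` involve only the conditional densities of the response. -/
theorem observationLaw_eq_withDensity {d : ℕ} {f : ℝ → ℝ} (hf : Measurable f)
    {μ σ h : (Fin d → ℝ) → ℝ} (hμ : Measurable μ) (hσ : Measurable σ) (hσ0 : ∀ x, 0 < σ x) :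
    observationLaw f μ σ h = ((covariateLaw h).prod volume).withDensity fun z =>
      ENNReal.ofReal (locScale f (μ z.1) (σ z.1) z.2) := by
  have hmeas : Measurable fun z : (Fin d → ℝ) × ℝ => (z.1, μ z.1 + σ z.1 * z.2) := by fun_prop
  have hden := (measurable_locScale_comp hf hμ hσ).ennreal_ofReal
  have : SFinite (covariateLaw h) := by unfold covariateLaw; infer_instance
  have : SFinite (errorLaw f) := by unfold errorLaw; infer_instance
  ext S hS
  have h1 : Measurable (S.indicator (1 : (Fin d → ℝ) × ℝ → ℝ≥0∞)) :=
    measurable_one.indicator hS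
  rw [observationLaw, ← lintegral_indicator_one hS, lintegral_map h1 hmeas,
    lintegral_prod (fun a : (Fin d → ℝ) × ℝ => S.indicator 1 (a.1, μ a.1 + σ a.1 * a.2))
      (h1.comp hmeas).aemeasurable, withDensity_apply _ hS,
    ← lintegral_indicator hS, lintegral_prod _ (hden.indicator hS).aemeasurable]
  refine lintegral_congr fun x => ?_
  rw [errorLaw, lintegral_withDensity_eq_lintegral_mul _ hf.ennreal_ofReal (by fun_prop)]
  have h2 := lintegral_locScale f (fun y => S.indicator (1 : (Fin d → ℝ) × ℝ → ℝ≥0∞) (x, y))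
    (μ x) (hσ0 x)
  simp only [Pi.mul_apply]
  rw [lintegral_congr fun z => mul_comm (ENNReal.ofReal (f z)) _, ← h2]
  refine lintegral_congr fun y => ?_
  by_cases hy : (x, y) ∈ S <;> simp [hy]

theorem measurableSet_cube (d : ℕ) : MeasurableSet (cube d) := measurableSet_Icc

theorem volume_cube (d : ℕ) : volume (cube d) = 1 := by
  simp [cube, Real.volume_Icc_pi]

theorem isProbabilityMeasure_covariateLaw {d : ℕ} {K : ℝ} (hK : 1 < K) {h : (Fin d → ℝ) → ℝ}
    (hh : h ∈ densityClass d K) : IsProbabilityMeasure (covariateLaw h) := by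
  obtain ⟨hm, hb, h1⟩ := hh
  refine ⟨?_⟩
  rw [covariateLaw, withDensity_apply _ MeasurableSet.univ, setLIntegral_univ,
    ← ofReal_integral_eq_lintegral_ofReal, h1, ENNReal.ofReal_one]
  -- A non-integrable function has Bochner integral `0`, so normalisation to `1` forces
  -- integrability.
  · by_contra hc
    rw [integral_undef hc] at h1
    exact zero_ne_one h1
  · refine (ae_restrict_iff' (measurableSet_cube d)).2 (ae_of_all _ fun x hx => ?_)
    exact le_trans (by positivity) (hb x hx).1

end LocationScale

namespace LocationScale

/-! ### Hellinger distance of densities on the line -/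

/-- The squared Hellinger distance `∫ (√p - √q)²` of two densities. -/
def hellingerSq (p q : ℝ → ℝ) : ℝ := ∫ y, (√(p y) - √(q y)) ^ 2

theorem sqrt_sub_sqrt_sq_le {a b : ℝ} (ha : 0 ≤ a) (hb : 0 ≤ b) : (√a - √b) ^ 2 ≤ a + b := by
  nlinarith [Real.sq_sqrt ha, Real.sq_sqrt hb, Real.sqrt_nonneg a, Real.sqrt_nonneg b,
    mul_nonneg (Real.sqrt_nonneg a) (Real.sqrt_nonneg b)]

theorem integrable_sqrt_sub_sq {p q : ℝ → ℝ} (hp : Integrable p) (hq : Integrable q)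
    (hp0 : 0 ≤ p) (hq0 : 0 ≤ q) : Integrable fun y => (√(p y) - √(q y)) ^ 2 := by
  refine (hp.add hq).mono' ?_ (ae_of_all _ fun y => ?_)
  · exact ((hp.aestronglyMeasurable.aemeasurable.sqrt.sub
      hq.aestronglyMeasurable.aemeasurable.sqrt).pow_const 2).aestronglyMeasurable
  · rw [Real.norm_of_nonneg (sq_nonneg _)]
    exact sqrt_sub_sqrt_sq_le (hp0 y) (hq0 y)

theorem hellingerSq_nonneg (p q : ℝ → ℝ) : 0 ≤ hellingerSq p q :=
  integral_nonneg fun _ => sq_nonneg _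

theorem affinity_eq {p q : ℝ → ℝ} (hp : Integrable p) (hq : Integrable q)
    (hp0 : 0 ≤ p) (hq0 : 0 ≤ q) (hp1 : ∫ y, p y = 1) (hq1 : ∫ y, q y = 1) :
    ∫⁻ y, (ENNReal.ofReal (p y) * ENNReal.ofReal (q y)) ^ (1 / 2 : ℝ) =
      ENNReal.ofReal (1 - hellingerSq p q / 2) := by
  have e : ∀ y, √(p y) * √(q y) = (p y + q y - (√(p y) - √(q y)) ^ 2) / 2 := fun y => by
    nlinarith [Real.sq_sqrt (hp0 y), Real.sq_sqrt (hq0 y)]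
  have hi := integrable_sqrt_sub_sq hp hq hp0 hq0
  have hI : Integrable fun y => √(p y) * √(q y) := by
    simp_rw [e]
    exact ((hp.add hq).sub hi).div_const 2
  have : 1 - hellingerSq p q / 2 = ∫ y, √(p y) * √(q y) := by
    have hpq : Integrable fun y => p y + q y := hp.add hq
    simp_rw [e]
    rw [integral_div, integral_sub hpq hi, integral_add hp hq, hp1, hq1, hellingerSq]
    ring
  rw [this, ofReal_integral_eq_lintegral_ofReal hI (ae_of_all _ fun y => by positivity)]
  refine lintegral_congr fun y => ?_
  rw [← ENNReal.ofReal_mul (hp0 y), ENNReal.ofReal_rpow_of_nonneg (mul_nonneg (hp0 y) (hq0 y))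
    (by norm_num), ← Real.sqrt_eq_rpow, Real.sqrt_mul (hp0 y)]

/-- Cauchy-Schwarz for `|p - q| = |√p - √q| (√p + √q)`, carried out as a pointwise weighted AM-GM
inequality whose weight depends on the value `T` of the integral itself. -/
theorem sq_integral_abs_sub_le {p q : ℝ → ℝ} (hp : Integrable p) (hq : Integrable q)
    (hp0 : 0 ≤ p) (hq0 : 0 ≤ q) (hp1 : ∫ y, p y = 1) (hq1 : ∫ y, q y = 1) :
    (∫ y, |p y - q y|) ^ 2 ≤ 4 * hellingerSq p q := by
  set T := ∫ y, |p y - q y|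
  have hT : 0 ≤ T := integral_nonneg fun _ => abs_nonneg _
  rcases hT.eq_or_lt with h0 | hT
  · rw [← h0]
    have := hellingerSq_nonneg p q
    nlinarith
  have hi := integrable_sqrt_sub_sq hp hq hp0 hq0
  have hpq : Integrable fun y => p y + q y := hp.add hq
  have key : T ≤ 2 / T * hellingerSq p q + T / 4 * 2 := by
    have : T ≤ ∫ y, (2 / T * (√(p y) - √(q y)) ^ 2 + T / 4 * (p y + q y)) := by
      refine integral_mono (hp.sub hq).abs ((hi.const_mul _).add (hpq.const_mul _))
        fun y => ?_
      have h1 := Real.sq_sqrt (hp0 y)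
      have h2 := Real.sq_sqrt (hq0 y)
      set a := √(p y)
      set b := √(q y)
      have ha : 0 ≤ a := Real.sqrt_nonneg _
      have hb : 0 ≤ b := Real.sqrt_nonneg _
      simp only [← h1, ← h2]
      have e : |a ^ 2 - b ^ 2| = |a - b| * (a + b) := by
        rw [sq_sub_sq, abs_mul, abs_of_nonneg (add_nonneg ha hb), mul_comm]
      rw [e]
      have h3 : |a - b| * (a + b) ≤ 2 / T * |a - b| ^ 2 + T / 8 * (a + b) ^ 2 := by
        have : 2 / T * |a - b| ^ 2 + T / 8 * (a + b) ^ 2 - |a - b| * (a + b) =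
            2 / T * (|a - b| - T / 4 * (a + b)) ^ 2 := by
          field_simp
          ring
        have h4 : 0 ≤ 2 / T * (|a - b| - T / 4 * (a + b)) ^ 2 := by positivity
        linarith
      rw [sq_abs] at h3
      nlinarith [sq_nonneg (a - b)]
    rw [integral_add (hi.const_mul _) (hpq.const_mul _), integral_const_mul,
      integral_const_mul, integral_add hp hq, hp1, hq1] at this
    simpa [hellingerSq, one_add_one_eq_two] using this
  have h5 : T / 2 * T ≤ 2 / T * hellingerSq p q * T := by nlinarith
  have h6 : 2 / T * hellingerSq p q * T = 2 * hellingerSq p q := by field_simp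
  nlinarith

/-! ### The robust test statistic -/

/-- A bounded surrogate of the likelihood ratio `√(q / p)`. -/
def testRatio (p q : ℝ) : ℝ := (√p + 3 * √q) / (3 * √p + √q)

theorem testRatio_nonneg (p q : ℝ) : 0 ≤ testRatio p q := by
  unfold testRatio
  positivity

/-- This reciprocity survives products over the sample and implies that two models cannot both win
the test against each other. -/
theorem testRatio_mul_testRatio {p q : ℝ} (hp : 0 < p) (hq : 0 < q) :
    testRatio p q * testRatio q p = 1 := by
  have := Real.sqrt_pos.2 hp
  have := Real.sqrt_pos.2 hq
  unfold testRatio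
  field_simp
  ring

theorem testRatio_le {p q : ℝ} (hp : 0 < p) : testRatio p q ≤ 3 := by
  have := Real.sqrt_pos.2 hp
  have := Real.sqrt_nonneg q
  rw [testRatio, div_le_iff₀ (by positivity)]
  linarith

/-- With `a = √p`, `b = √q`, `c = √r` the ratio is `1 + w`, where `w = 2(b - a)/(3a + b) ≤ 2`.
Expand `c² w = a² w + 2(c - a) a w + (c - a)² w`. The first term gives `(q - p)/4 - (a - b)²/4`; the
cross term costs half of this gain and a multiple of `(c - a)²`; the last is controlled because `w`
is bounded above. That upper bound is the source of robustness. -/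
theorem mul_testRatio_le {p q r : ℝ} (hp : 0 < p) (hq : 0 < q) (hr : 0 ≤ r) :
    testRatio p q * r ≤ r - (√p - √q) ^ 2 / 8 + (q - p) / 4 + 6 * (√r - √p) ^ 2 := by
  have ha := Real.sqrt_pos.2 hp
  have hb := Real.sqrt_pos.2 hq
  have hc := Real.sqrt_nonneg r
  have h1 := Real.sq_sqrt hp.le
  have h2 := Real.sq_sqrt hq.le
  have h3 := Real.sq_sqrt hr
  unfold testRatio
  set a := √p
  set b := √q
  set c := √r
  rw [← h1, ← h2, ← h3]
  have ht : 0 < 3 * a + b := by positivity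
  set w := 2 * (b - a) / (3 * a + b) with hw
  have hwt : w * (3 * a + b) = 2 * (b - a) := by rw [hw]; field_simp
  have e : (a + 3 * b) / (3 * a + b) = 1 + w := by rw [hw]; field_simp; ring
  have w2 : w ≤ 2 := by rw [hw, div_le_iff₀ ht]; linarith
  have h4 : a ^ 2 * w ≤ a * (b - a) / 2 := by
    have : a ^ 2 * w = a * (b - a) / 2 - a * (b - a) ^ 2 / (2 * (3 * a + b)) := by
      rw [hw]; field_simp; ring
    have h' : 0 ≤ a * (b - a) ^ 2 / (2 * (3 * a + b)) := by positivity
    linarith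
  have h5 : (a * w) ^ 2 ≤ 4 / 9 * (b - a) ^ 2 := by
    have : 4 / 9 * (b - a) ^ 2 = w ^ 2 * (3 * a + b) ^ 2 / 9 := by rw [← mul_pow, hwt]; ring
    rw [this, mul_pow]
    have : a ^ 2 ≤ (3 * a + b) ^ 2 / 9 := by nlinarith [mul_pos ha hb]
    nlinarith [sq_nonneg w]
  have h6 : (c - a) ^ 2 * w ≤ 2 * (c - a) ^ 2 := by nlinarith [sq_nonneg (c - a)]
  -- The weight `32/9` makes the cost exactly `(b - a)²/8` in view of `h5`; together with the `2`
  -- from `h6` it stays below `6`.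
  have h7 : 2 * (c - a) * (a * w) ≤ 32 / 9 * (c - a) ^ 2 + (b - a) ^ 2 / 8 := by
    nlinarith [sq_nonneg (32 / 9 * (c - a) - a * w)]
  rw [e]
  nlinarith [sq_nonneg (c - a)]

/-- Integration of `mul_testRatio_le`: the linear term `(q - p)/4` disappears because both densities
have mass one. -/
theorem lintegral_testRatio_le {p q r : ℝ → ℝ} (hp : Integrable p) (hq : Integrable q)
    (hr : Integrable r) (hp0 : ∀ y, 0 < p y) (hq0 : ∀ y, 0 < q y) (hr0 : ∀ y, 0 ≤ r y)
    (hp1 : ∫ y, p y = 1) (hq1 : ∫ y, q y = 1) (hr1 : ∫ y, r y = 1) :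
    ∫⁻ y, ENNReal.ofReal (testRatio (p y) (q y)) * ENNReal.ofReal (r y) ≤
      ENNReal.ofReal (1 - hellingerSq p q / 8 + 6 * hellingerSq r p) := by
  have i1 := integrable_sqrt_sub_sq hp hq (fun y => (hp0 y).le) fun y => (hq0 y).le
  have i2 := integrable_sqrt_sub_sq hr hp hr0 fun y => (hp0 y).le
  have hmeas : AEStronglyMeasurable (fun y => testRatio (p y) (q y)) := by
    have h1 := hp.aestronglyMeasurable.aemeasurable.sqrt
    have h2 := hq.aestronglyMeasurable.aemeasurable.sqrt
    unfold testRatio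
    exact ((h1.add (h2.const_mul 3)).div ((h1.const_mul 3).add h2)).aestronglyMeasurable
  have hI : Integrable fun y => testRatio (p y) (q y) * r y := by
    refine hr.bdd_mul (c := 3) hmeas (ae_of_all _ fun y => ?_)
    rw [Real.norm_of_nonneg (testRatio_nonneg _ _)]
    exact testRatio_le (hp0 y)
  simp_rw [← ENNReal.ofReal_mul (testRatio_nonneg _ _)]
  rw [← ofReal_integral_eq_lintegral_ofReal hI
    (ae_of_all _ fun y => mul_nonneg (testRatio_nonneg _ _) (hr0 y))]
  refine ENNReal.ofReal_le_ofReal ?_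
  calc _ ≤ ∫ y, (r y - (√(p y) - √(q y)) ^ 2 / 8 + (q y - p y) / 4 +
          6 * (√(r y) - √(p y)) ^ 2) :=
        integral_mono hI (((hr.sub (i1.div_const 8)).add ((hq.sub hp).div_const 4)).add
          (i2.const_mul 6)) fun y => mul_testRatio_le (hp0 y) (hq0 y) (hr0 y)
    _ = _ := by
        have i3 : Integrable fun y => (q y - p y) / 4 := (hq.sub hp).div_const 4
        have i4 : Integrable fun y => r y - (√(p y) - √(q y)) ^ 2 / 8 := hr.sub (i1.div_const 8)
        have i5 : Integrable fun y => r y - (√(p y) - √(q y)) ^ 2 / 8 + (q y - p y) / 4 :=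
          i4.add i3
        rw [integral_add i5 (i2.const_mul 6), integral_add i4 i3,
          integral_sub hr (i1.div_const 8), integral_div, integral_div, integral_sub hq hp,
          integral_const_mul, hp1, hq1, hr1]
        simp [hellingerSq]

/-! ### Regular densities -/

/-- Densities that are bounded below on compact sets and whose location-scale family is
Lipschitz in the Hellinger distance. -/
structure RegularDensity (f : ℝ → ℝ) : Prop where
  measurable : Measurable f
  pos : ∀ y, 0 < f y
  integral_eq_one : ∫ y, f y = 1
  lower : ∀ M : ℝ, ∃ l > 0, ∀ y, |y| ≤ M → l ≤ f y
  hellinger : ∀ M a b : ℝ, 0 < a → ∃ A > 0, ∀ m m' σ σ', |m| ≤ M → |m'| ≤ M →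
    σ ∈ Icc a b → σ' ∈ Icc a b →
    hellingerSq (locScale f m σ) (locScale f m' σ') ≤ A * ((m - m') ^ 2 + (σ - σ') ^ 2)

theorem integral_mul_locScale (f F : ℝ → ℝ) (m : ℝ) {σ : ℝ} (hσ : 0 < σ) :
    ∫ y, F y * locScale f m σ y = ∫ z, F (m + σ * z) * f z := by
  have h1 := Measure.integral_comp_mul_left
    (fun y => F (m + y) * (σ * locScale f m σ (m + y))) σ
  have h2 := integral_add_left_eq_self (μ := (volume : Measure ℝ))
    (fun y => F y * (σ * locScale f m σ y)) m
  rw [h2] at h1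
  have e : ∀ z, σ * locScale f m σ (m + σ * z) = f z := fun z => by
    have : (m + σ * z - m) / σ = z := by
      field_simp
      ring
    rw [locScale, this]
    field_simp
  simp_rw [e] at h1
  rw [h1, abs_of_pos (inv_pos.2 hσ), smul_eq_mul, ← integral_const_mul]
  refine integral_congr_ae (ae_of_all _ fun y => ?_)
  simp only
  field_simp

theorem setIntegral_Iic_locScale (f : ℝ → ℝ) (m t : ℝ) {σ : ℝ} (hσ : 0 < σ) :
    ∫ y in Iic t, locScale f m σ y = ∫ z in Iic ((t - m) / σ), f z := by
  have := integral_mul_locScale f ((Iic t).indicator 1) m hσ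
  rw [← integral_indicator measurableSet_Iic, ← integral_indicator measurableSet_Iic]
  convert this using 1
  · congr 1
    ext y
    by_cases h : y ∈ Iic t <;> simp [h]
  · congr 1
    ext z
    have : z ∈ Iic ((t - m) / σ) ↔ m + σ * z ∈ Iic t := by
      rw [mem_Iic, mem_Iic, le_div_iff₀ hσ]
      constructor <;> intro h <;> linarith
    by_cases h : z ∈ Iic ((t - m) / σ)
    · simp [h, this.1 h]
    · rw [indicator_of_notMem h, indicator_of_notMem (fun h' => h (this.2 h')), zero_mul]

namespace RegularDensity

variable {f : ℝ → ℝ}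

theorem integrable (hf : RegularDensity f) : Integrable f := by
  by_contra h
  exact zero_ne_one ((integral_undef h).symm.trans hf.integral_eq_one)

theorem integral_locScale (hf : RegularDensity f) (m : ℝ) {σ : ℝ} (hσ : 0 < σ) :
    ∫ y, locScale f m σ y = 1 := by
  have := integral_mul_locScale f (fun _ => 1) m hσ
  simpa [hf.integral_eq_one] using this

theorem integrable_locScale (hf : RegularDensity f) (m : ℝ) {σ : ℝ} (hσ : 0 < σ) :
    Integrable (locScale f m σ) := by
  by_contra h
  exact zero_ne_one ((integral_undef h).symm.trans (hf.integral_locScale m hσ))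

theorem locScale_pos (hf : RegularDensity f) (m : ℝ) {σ : ℝ} (hσ : 0 < σ) (y : ℝ) :
    0 < locScale f m σ y :=
  mul_pos (one_div_pos.2 hσ) (hf.pos _)

theorem lintegral_locScale_eq_one (hf : RegularDensity f) (m : ℝ) {σ : ℝ} (hσ : 0 < σ) :
    ∫⁻ y, ENNReal.ofReal (locScale f m σ y) = 1 := by
  rw [← ofReal_integral_eq_lintegral_ofReal (hf.integrable_locScale m hσ)
    (ae_of_all _ fun y => (hf.locScale_pos m hσ y).le), hf.integral_locScale m hσ,
    ENNReal.ofReal_one]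

theorem integral_abs_interval_ge (hf : RegularDensity f) {l z : ℝ}
    (hl : ∀ y, |y| ≤ |z| → l ≤ f y) :
    l * |z| ≤ |∫ y in (0 : ℝ)..z, f y| := by
  have hi : ∀ a b, IntervalIntegrable f volume a b := fun a b => hf.integrable.intervalIntegrable
  rcases le_total 0 z with hz | hz
  · rw [abs_of_nonneg hz]
    refine le_trans ?_ (le_abs_self _)
    have := intervalIntegral.integral_mono_on hz (f := fun _ => l) (by simp) (hi 0 z)
      fun y hy => hl y (by rw [abs_of_nonneg hy.1, abs_of_nonneg hz]; exact hy.2)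
    simpa [mul_comm] using this
  · rw [abs_of_nonpos hz, intervalIntegral.integral_symm, abs_neg]
    refine le_trans ?_ (le_abs_self _)
    have := intervalIntegral.integral_mono_on hz (f := fun _ => l) (by simp) (hi z 0)
      fun y hy => hl y (by rw [abs_of_nonpos hy.2, abs_of_nonpos hz]; linarith [hy.1])
    simpa [mul_comm] using this

/-- Separation: the Hellinger distance controls the difference of the locations. -/
theorem sq_sub_le_hellingerSq (hf : RegularDensity f) (M a b : ℝ) (ha : 0 < a) (hb : 0 < b) :
    ∃ c > 0, ∀ m m' σ σ', |m| ≤ M → |m'| ≤ M → σ ∈ Icc a b → σ' ∈ Icc a b →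
      c * (m - m') ^ 2 ≤ hellingerSq (locScale f m σ) (locScale f m' σ') := by
  -- The radius bounds `|m - m'| / σ'`. In the constant, `1/4` comes from comparing the `L¹` and
  -- Hellinger distances and `1/b` from the largest scale.
  obtain ⟨l, hl, hlf⟩ := hf.lower (2 * M / a)
  refine ⟨l ^ 2 / (4 * b ^ 2), by positivity, fun m m' σ σ' hm hm' hσ hσ' => ?_⟩
  have s0 : 0 < σ := ha.trans_le hσ.1
  have s0' : 0 < σ' := ha.trans_le hσ'.1
  have ip := hf.integrable_locScale m s0
  have iq := hf.integrable_locScale m' s0'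
  have hT := sq_integral_abs_sub_le ip iq (fun y => (hf.locScale_pos m s0 y).le)
    (fun y => (hf.locScale_pos m' s0' y).le) (hf.integral_locScale m s0)
    (hf.integral_locScale m' s0')
  set z := (m - m') / σ' with hz
  have hM : 0 ≤ M := (abs_nonneg _).trans hm
  have hmm : |m - m'| ≤ 2 * M := (abs_sub _ _).trans (by linarith)
  have hzb : |z| ≤ 2 * M / a := by
    rw [hz, abs_div, abs_of_pos s0']
    exact div_le_div₀ (by linarith) hmm ha hσ'.1
  -- The distribution functions are compared at the point `m`: the first takes the value `F(0)`
  -- regardless of its scale, the second takes the value `F(z)`. The difference is therefore driven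
  -- by the locations even when the scales differ.
  have h1 : l * |z| ≤ ∫ y, |locScale f m σ y - locScale f m' σ' y| := by
    refine (hf.integral_abs_interval_ge fun y hy => hlf y (hy.trans hzb)).trans ?_
    rw [← intervalIntegral.integral_Iic_sub_Iic hf.integrable.integrableOn
      hf.integrable.integrableOn]
    have e1 := setIntegral_Iic_locScale f m m s0
    have e2 := setIntegral_Iic_locScale f m' m s0'
    rw [sub_self, zero_div] at e1
    rw [hz, ← e1, ← e2, abs_sub_comm, ← integral_sub ip.integrableOn iq.integrableOn]
    exact (abs_integral_le_integral_abs).trans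
      (setIntegral_le_integral (ip.sub iq).abs (ae_of_all _ fun y => abs_nonneg _))
  have h2 : |m - m'| / b ≤ |z| := by
    rw [hz, abs_div, abs_of_pos s0']
    exact div_le_div_of_nonneg_left (abs_nonneg _) s0' hσ'.2
  have h3 : l * (|m - m'| / b) ≤ ∫ y, |locScale f m σ y - locScale f m' σ' y| :=
    (mul_le_mul_of_nonneg_left h2 hl.le).trans h1
  have h4 := pow_le_pow_left₀ (by positivity) h3 2
  have h5 : l ^ 2 / (4 * b ^ 2) * (m - m') ^ 2 = (l * (|m - m'| / b)) ^ 2 / 4 := by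
    rw [mul_pow, div_pow, sq_abs]
    field_simp
  rw [h5]
  linarith

/-- Regularity is preserved by a change of location and scale. -/
protected theorem locScale (hf : RegularDensity f) (η₀ : ℝ) {σ₀ : ℝ} (hσ₀ : 0 < σ₀) :
    RegularDensity (locScale f η₀ σ₀) where
  measurable := by
    have := hf.measurable
    unfold LocationScale.locScale
    fun_prop
  pos := hf.locScale_pos η₀ hσ₀
  integral_eq_one := hf.integral_locScale η₀ hσ₀
  lower M := by
    obtain ⟨l, hl, h⟩ := hf.lower ((M + |η₀|) / σ₀)
    refine ⟨1 / σ₀ * l, by positivity, fun y hy => ?_⟩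
    refine mul_le_mul_of_nonneg_left (h _ ?_) (by positivity)
    rw [abs_div, abs_of_pos hσ₀]
    gcongr
    exact (abs_sub _ _).trans (by gcongr)
  hellinger M a b ha := by
    -- The composed family has location `m + σ η₀` and scale `σ σ₀`, which explains the enlarged
    -- parameter box.
    obtain ⟨A, hA, h⟩ := hf.hellinger (M + b * |η₀|) (a * σ₀) (b * σ₀) (by positivity)
    refine ⟨A * (2 + 2 * η₀ ^ 2 + σ₀ ^ 2), by positivity, fun m m' σ σ' hm hm' hσ hσ' => ?_⟩
    have s0 : 0 < σ := ha.trans_le hσ.1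
    have s0' : 0 < σ' := ha.trans_le hσ'.1
    rw [locScale_locScale hσ₀ s0, locScale_locScale hσ₀ s0']
    have hbd : ∀ m σ, |m| ≤ M → 0 < σ → σ ≤ b → |m + σ * η₀| ≤ M + b * |η₀| := by
      intro m σ hm s0 hσ
      refine (abs_add_le _ _).trans (add_le_add hm ?_)
      rw [abs_mul, abs_of_pos s0]
      gcongr
    refine (h _ _ _ _ (hbd m σ hm s0 hσ.2) (hbd m' σ' hm' s0' hσ'.2)
      ⟨by have := hσ.1; gcongr, by have := hσ.2; gcongr⟩
      ⟨by have := hσ'.1; gcongr, by have := hσ'.2; gcongr⟩).trans ?_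
    rw [mul_assoc]
    gcongr
    nlinarith [sq_nonneg (m - m' - (σ - σ') * η₀), sq_nonneg (m - m'), sq_nonneg (σ - σ'),
      mul_nonneg (sq_nonneg η₀) (sq_nonneg (m - m')),
      mul_nonneg (sq_nonneg σ₀) (sq_nonneg (m - m'))]

end RegularDensity

end LocationScale

namespace LocationScale

/-! ### Hellinger regularity from the log-density -/

theorem abs_log_sub_log_le {A B c : ℝ} (hc : 0 < c) (hA : c ≤ A) (hB : c ≤ B) :
    |Real.log A - Real.log B| ≤ |A - B| / c := by
  wlog h : B ≤ A generalizing A B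
  · rw [abs_sub_comm, abs_sub_comm A]
    exact this hB hA (le_of_not_ge h)
  have hB0 := hc.trans_le hB
  have hA0 := hc.trans_le hA
  rw [abs_of_nonneg (sub_nonneg.2 (Real.log_le_log hB0 h)), abs_of_nonneg (sub_nonneg.2 h),
    ← Real.log_div hA0.ne' hB0.ne']
  refine (Real.log_le_sub_one_of_pos (div_pos hA0 hB0)).trans ?_
  rw [div_sub_one hB0.ne']
  exact div_le_div_of_nonneg_left (sub_nonneg.2 h) hc hB

/-- If `q ≤ p` and `u` is the log ratio, then `√q = √p exp (-u / 2)` and `0 ≤ 1 - exp (-u / 2) ≤ u`.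
The bound keeps both densities as weights so that each term can later be integrated against its own
law. -/
theorem sqrt_sub_sqrt_sq_le_log {p q : ℝ} (hp : 0 < p) (hq : 0 < q) :
    (√p - √q) ^ 2 ≤ p * (Real.log p - Real.log q) ^ 2 + q * (Real.log p - Real.log q) ^ 2 := by
  wlog h : q ≤ p generalizing p q
  · have := this hq hp (le_of_not_ge h)
    nlinarith
  have h1 : √q = √p * Real.exp (-(Real.log p - Real.log q) / 2) := by
    have e : q = p * Real.exp (-(Real.log p - Real.log q)) := by
      rw [neg_sub, Real.exp_sub, Real.exp_log hq, Real.exp_log hp]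
      field_simp
    conv_lhs => rw [e, Real.sqrt_mul hp.le, Real.sqrt_eq_rpow (Real.exp _), ← Real.exp_mul]
    ring_nf
  have hu : 0 ≤ Real.log p - Real.log q := sub_nonneg.2 (Real.log_le_log hq h)
  set u := Real.log p - Real.log q
  have h2 := Real.add_one_le_exp (-u / 2)
  have h3 : Real.exp (-u / 2) ≤ 1 := Real.exp_le_one_iff.2 (by linarith)
  have h4 : (1 - Real.exp (-u / 2)) ^ 2 ≤ u ^ 2 := by
    apply pow_le_pow_left₀ <;> linarith
  have h5 : (√p - √q) ^ 2 = p * (1 - Real.exp (-u / 2)) ^ 2 := by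
    rw [h1, ← Real.sq_sqrt hp.le, Real.sqrt_sq (Real.sqrt_nonneg _)]
    ring
  rw [h5]
  nlinarith [sq_nonneg u]

/-- A change of scale moves the standardised point `y` by an amount proportional to `1 + |y|`; the
factor `1 + |y|` in `hlog` compensates for this. What remains is the weight `G`, which needs only a
second moment under `f`. Restricting `hlog` to comparable arguments makes it usable for polynomial
tails. -/
theorem hellinger_of_log {f G : ℝ → ℝ} (hpos : ∀ y, 0 < f y)
    (hf : Integrable f) (hfm : Measurable f) (hG : ∀ y, 0 ≤ G y) (hGm : Measurable G)
    (hfG : Integrable fun y => G y ^ 2 * f y)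
    (hlog : ∀ R : ℝ, 1 ≤ R → ∃ A ≥ 0, ∀ y z, 1 + |y| ≤ R * (1 + |z|) → 1 + |z| ≤ R * (1 + |y|) →
      (1 + |y|) * |Real.log (f y) - Real.log (f z)| ≤ A * |y - z| * G y)
    (M a b : ℝ) (ha : 0 < a) : ∃ A > 0, ∀ m m' σ σ', |m| ≤ M → |m'| ≤ M →
      σ ∈ Icc a b → σ' ∈ Icc a b →
      hellingerSq (locScale f m σ) (locScale f m' σ') ≤ A * ((m - m') ^ 2 + (σ - σ') ^ 2) := by
  set R := 1 + (2 * |M| + |b|) / a with hR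
  have hR1 : 1 ≤ R := le_add_of_nonneg_right (by positivity)
  obtain ⟨A, hA, hlogA⟩ := hlog R hR1
  have hJi : Integrable fun y => (A * G y + 1) ^ 2 * f y := by
    refine ((hfG.const_mul (2 * A ^ 2)).add (hf.const_mul 2)).mono' (by fun_prop)
      (ae_of_all _ fun y => ?_)
    have := (hpos y).le
    rw [Real.norm_of_nonneg (by positivity)]
    simp only [Pi.add_apply]
    have : (A * G y + 1) ^ 2 ≤ 2 * A ^ 2 * G y ^ 2 + 2 := by nlinarith [sq_nonneg (A * G y - 1)]
    nlinarith
  set J := ∫ y, (A * G y + 1) ^ 2 * f y with hJ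
  have hJ0 : 0 ≤ J := integral_nonneg fun y => mul_nonneg (sq_nonneg _) (hpos y).le
  -- the pointwise bound, from the viewpoint of one of the two parameters
  have point : ∀ m m' σ σ', |m| ≤ M → |m'| ≤ M → σ ∈ Icc a b → σ' ∈ Icc a b → ∀ y,
      |Real.log (locScale f m σ y) - Real.log (locScale f m' σ' y)| ≤
        (|m - m'| + |σ - σ'|) / a * (A * G ((y - m) / σ) + 1) := by
    intro m m' σ σ' hm hm' hσ hσ' y
    -- The two standardised arguments are related by an affine map with bounded coefficients; `R` is
    -- chosen to bound the ratio of their weights.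
    have cmp : ∀ m m' σ σ', |m| ≤ M → |m'| ≤ M → σ ∈ Icc a b → σ' ∈ Icc a b →
        1 + |(y - m') / σ'| ≤ R * (1 + |(y - m) / σ|) := by
      intro m m' σ σ' hm hm' hσ hσ'
      have s0 : 0 < σ := ha.trans_le hσ.1
      have s0' : 0 < σ' := ha.trans_le hσ'.1
      have e : (y - m') / σ' = ((m - m') + σ * ((y - m) / σ)) / σ' := by field_simp; ring
      set z := (y - m) / σ
      have : |(y - m') / σ'| ≤ (2 * |M| + |b| * |z|) / a := by
        rw [e, abs_div, abs_of_pos s0']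
        refine div_le_div₀ (by positivity) ((abs_add_le _ _).trans (add_le_add ?_ ?_)) ha hσ'.1
        · exact (abs_sub _ _).trans (by have := le_abs_self M; linarith)
        · rw [abs_mul, abs_of_pos s0]
          gcongr
          exact hσ.2.trans (le_abs_self b)
      have h2 : (2 * |M| + |b| * |z|) / a ≤ (2 * |M| + |b|) / a * (1 + |z|) := by
        rw [div_mul_eq_mul_div]
        gcongr
        nlinarith [abs_nonneg z, abs_nonneg b, abs_nonneg M, mul_nonneg (abs_nonneg M) (abs_nonneg z)]
      rw [hR]
      nlinarith [abs_nonneg z]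
    have s0 : 0 < σ := ha.trans_le hσ.1
    have s0' : 0 < σ' := ha.trans_le hσ'.1
    have h1 := hlogA ((y - m) / σ) ((y - m') / σ') (cmp m' m σ' σ hm' hm hσ' hσ)
      (cmp m m' σ σ' hm hm' hσ hσ')
    have hl : ∀ m σ, 0 < σ → Real.log (locScale f m σ y) =
        Real.log (f ((y - m) / σ)) - Real.log σ := by
      intro m σ s0
      rw [locScale, Real.log_mul (by positivity) (hpos _).ne', one_div, Real.log_inv]
      ring
    have e : (y - m) / σ - (y - m') / σ' = ((σ' - σ) * ((y - m) / σ) - (m - m')) / σ' := by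
      field_simp; ring
    rw [hl m σ s0, hl m' σ' s0']
    set z := (y - m) / σ
    set z' := (y - m') / σ'
    have hd : |z - z'| ≤ (|m - m'| + |σ - σ'|) / a * (1 + |z|) := by
      rw [e, abs_div, abs_of_pos s0', div_mul_eq_mul_div]
      refine div_le_div₀ (by positivity) ?_ ha hσ'.1
      refine (abs_sub _ _).trans ?_
      rw [abs_mul, abs_sub_comm σ' σ]
      nlinarith [abs_nonneg z, abs_nonneg (m - m'), abs_nonneg (σ - σ'),
        mul_nonneg (abs_nonneg z) (abs_nonneg (m - m'))]
    have h2 : |Real.log (f z) - Real.log (f z')| ≤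
        (|m - m'| + |σ - σ'|) / a * (A * G z) := by
      have hz : 0 < 1 + |z| := by positivity
      refine le_of_mul_le_mul_left (h1.trans ?_) hz
      calc A * |z - z'| * G z ≤ A * ((|m - m'| + |σ - σ'|) / a * (1 + |z|)) * G z := by
            have := hG z
            gcongr
        _ = _ := by ring
    have h3 : |Real.log σ - Real.log σ'| ≤ (|m - m'| + |σ - σ'|) / a * 1 := by
      refine (abs_log_sub_log_le ha hσ.1 hσ'.1).trans ?_
      rw [mul_one]
      gcongr
      have := abs_nonneg (m - m')
      linarith
    calc _ = |(Real.log (f z) - Real.log (f z')) - (Real.log σ - Real.log σ')| := by ring_nf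
      _ ≤ _ := (abs_sub _ _).trans (by rw [mul_add]; exact add_le_add h2 h3)
  -- Each density contributes `D² J`, and `D² ≤ (2 / a²)` times the squared parameter distance; the
  -- `+ 1` only ensures positivity.
  refine ⟨4 / a ^ 2 * J + 1, by positivity, fun m m' σ σ' hm hm' hσ hσ' => ?_⟩
  have s0 : 0 < σ := ha.trans_le hσ.1
  have s0' : 0 < σ' := ha.trans_le hσ'.1
  set D := (|m - m'| + |σ - σ'|) / a with hD
  have hD0 : 0 ≤ D := by positivity
  have hIntegrable : ∀ m σ, 0 < σ →
      Integrable fun y => (A * G ((y - m) / σ) + 1) ^ 2 * locScale f m σ y := by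
    intro m σ s0
    have := ((hJi.comp_div s0.ne').comp_sub_right m).const_mul (1 / σ)
    refine this.congr (ae_of_all _ fun y => ?_)
    simp only [locScale]
    ring
  have hval : ∀ m σ, 0 < σ →
      ∫ y, (A * G ((y - m) / σ) + 1) ^ 2 * locScale f m σ y = J := by
    intro m σ s0
    rw [integral_mul_locScale f (fun y => (A * G ((y - m) / σ) + 1) ^ 2) m s0]
    congr 1
    ext z
    have : (m + σ * z - m) / σ = z := by field_simp; ring
    rw [this]
  have hi1 := (hIntegrable m σ s0).const_mul (D ^ 2)
  have hi2 := (hIntegrable m' σ' s0').const_mul (D ^ 2)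
  have main : hellingerSq (locScale f m σ) (locScale f m' σ') ≤ D ^ 2 * J + D ^ 2 * J := by
    calc hellingerSq (locScale f m σ) (locScale f m' σ') ≤
        ∫ y, (D ^ 2 * ((A * G ((y - m) / σ) + 1) ^ 2 * locScale f m σ y) +
          D ^ 2 * ((A * G ((y - m') / σ') + 1) ^ 2 * locScale f m' σ' y)) := by
          refine integral_mono_of_nonneg (ae_of_all _ fun y => sq_nonneg _) (hi1.add hi2)
            (ae_of_all _ fun y => ?_)
          have p0 : 0 < locScale f m σ y := mul_pos (one_div_pos.2 s0) (hpos _)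
          have q0 : 0 < locScale f m' σ' y := mul_pos (one_div_pos.2 s0') (hpos _)
          have b1 := point m m' σ σ' hm hm' hσ hσ' y
          have b2 := point m' m σ' σ hm' hm hσ' hσ y
          rw [abs_sub_comm m' m, abs_sub_comm σ' σ] at b2
          rw [abs_sub_comm (Real.log _)] at b2
          rw [← hD] at b1 b2
          refine (sqrt_sub_sqrt_sq_le_log p0 q0).trans (add_le_add ?_ ?_)
          · rw [mul_comm, ← mul_assoc, ← mul_pow]
            refine mul_le_mul_of_nonneg_right ?_ p0.le
            rw [← sq_abs]
            exact pow_le_pow_left₀ (abs_nonneg _) b1 2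
          · rw [mul_comm, ← mul_assoc, ← mul_pow]
            refine mul_le_mul_of_nonneg_right ?_ q0.le
            rw [← sq_abs]
            exact pow_le_pow_left₀ (abs_nonneg _) b2 2
      _ = _ := by
          rw [integral_add hi1 hi2, integral_const_mul, integral_const_mul, hval m σ s0,
            hval m' σ' s0']
  refine main.trans ?_
  have h6 : D ^ 2 ≤ 2 / a ^ 2 * ((m - m') ^ 2 + (σ - σ') ^ 2) := by
    rw [hD, div_pow, div_mul_eq_mul_div]
    gcongr
    rw [← sq_abs (m - m'), ← sq_abs (σ - σ')]
    nlinarith [sq_nonneg (|m - m'| - |σ - σ'|)]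
  have h7 : D ^ 2 * J ≤ 2 / a ^ 2 * ((m - m') ^ 2 + (σ - σ') ^ 2) * J := by gcongr
  have h8 : 0 ≤ (m - m') ^ 2 + (σ - σ') ^ 2 := by positivity
  calc _ ≤ 2 * (2 / a ^ 2 * ((m - m') ^ 2 + (σ - σ') ^ 2) * J) := by linarith
    _ = 4 / a ^ 2 * J * ((m - m') ^ 2 + (σ - σ') ^ 2) := by ring
    _ ≤ _ := by nlinarith

/-! ### Densities with exponential tails -/

theorem integrable_exp_neg_mul_abs {c : ℝ} (hc : 0 < c) :
    Integrable fun y : ℝ => Real.exp (-(c * |y|)) := by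
  rw [← integrableOn_univ, ← Iic_union_Ioi (a := (0 : ℝ))]
  refine IntegrableOn.union ?_ ?_
  · refine (integrableOn_exp_mul_Iic hc 0).congr_fun (fun y hy => ?_) measurableSet_Iic
    simp only [abs_of_nonpos (mem_Iic.1 hy)]
    ring_nf
  · refine (exp_neg_integrableOn_Ioi 0 hc).congr_fun (fun y hy => ?_) measurableSet_Ioi
    simp only [abs_of_pos (mem_Ioi.1 hy)]
    ring_nf

theorem one_add_pow_four_le {c t : ℝ} (hc : 0 < c) (ht : 0 ≤ t) :
    (1 + t) ^ 4 ≤ 24 / c ^ 4 * Real.exp c * Real.exp (c * t) := by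
  have h := Real.pow_div_factorial_le_exp (x := c * (1 + t)) (by positivity) 4
  have e : Real.exp (c * (1 + t)) = Real.exp c * Real.exp (c * t) := by
    rw [← Real.exp_add]; ring_nf
  rw [e] at h
  have h24 : ((Nat.factorial 4 : ℕ) : ℝ) = 24 := by norm_num [Nat.factorial]
  rw [h24, div_le_iff₀ (by norm_num), mul_pow] at h
  rw [mul_assoc, div_mul_eq_mul_div, le_div_iff₀ (by positivity)]
  linarith

/-- Positive densities with an exponential tail and a log-density of at most quadratic growth
are regular. -/
theorem regularDensity_of_exp_tail {f : ℝ → ℝ} (hfm : Measurable f) (hpos : ∀ y, 0 < f y)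
    {A c k : ℝ} (hA : 0 ≤ A) (hc : 0 < c)
    (hlog : ∀ y z, |Real.log (f y) - Real.log (f z)| ≤ A * |y - z| * (1 + |y| + |z|))
    (htail : ∀ y, f y ≤ k * Real.exp (-(c * |y|)))
    (h1 : (∫ y in Ioi 0, f (-y)) + ∫ y in Ioi 0, f y = 1) : RegularDensity f := by
  have hi : Integrable f := by
    refine ((integrable_exp_neg_mul_abs hc).const_mul k).mono' hfm.aestronglyMeasurable
      (ae_of_all _ fun y => ?_)
    rw [Real.norm_of_nonneg (hpos y).le]
    exact htail y
  refine ⟨hfm, hpos, ?_, ?_, ?_⟩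
  · rw [← intervalIntegral.integral_Iic_add_Ioi (b := 0) hi.integrableOn hi.integrableOn]
    have := integral_comp_neg_Ioi 0 f
    rw [neg_zero] at this
    rw [← this, h1]
  · intro M
    refine ⟨f 0 * Real.exp (-(A * |M| * (1 + |M|))), mul_pos (hpos 0) (Real.exp_pos _),
      fun y hy => ?_⟩
    rw [← Real.log_le_log_iff (mul_pos (hpos 0) (Real.exp_pos _)) (hpos y),
      Real.log_mul (hpos 0).ne' (Real.exp_pos _).ne', Real.log_exp]
    have h := hlog 0 y
    have hM : |y| ≤ |M| := hy.trans (le_abs_self M)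
    simp only [abs_zero, zero_sub, abs_neg, add_zero] at h
    have h2 := (le_abs_self _).trans h
    have h3 : A * |y| * (1 + |y|) ≤ A * |M| * (1 + |M|) := by gcongr
    linarith
  -- One factor of the weight is the linear growth of the log-density's slope, the other compensates
  -- the `1 + |y|` in `hlog`. The resulting fourth power is absorbed by half of the exponential
  -- decay.
  · refine hellinger_of_log (G := fun y => (1 + |y|) ^ 2) hpos hi hfm (fun y => by positivity)
      (by fun_prop) ?_ ?_
    · refine ((integrable_exp_neg_mul_abs (half_pos hc)).const_mul
        (24 / (c / 2) ^ 4 * Real.exp (c / 2) * k)).mono' (by fun_prop) (ae_of_all _ fun y => ?_)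
      have p0 := (hpos y).le
      rw [Real.norm_of_nonneg (by positivity), ← pow_mul]
      calc (1 + |y|) ^ (2 * 2) * f y ≤
          24 / (c / 2) ^ 4 * Real.exp (c / 2) * Real.exp (c / 2 * |y|) *
            (k * Real.exp (-(c * |y|))) :=
            mul_le_mul (one_add_pow_four_le (half_pos hc) (abs_nonneg y)) (htail y) p0
              (by positivity)
        _ = 24 / (c / 2) ^ 4 * Real.exp (c / 2) * k *
            (Real.exp (c / 2 * |y|) * Real.exp (-(c * |y|))) := by ring
        _ = _ := by
            rw [← Real.exp_add]
            ring_nf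
    · intro R hR
      refine ⟨A * (1 + R), by positivity, fun y z _ hz => ?_⟩
      calc (1 + |y|) * |Real.log (f y) - Real.log (f z)| ≤
          (1 + |y|) * (A * |y - z| * (1 + |y| + |z|)) := by
            gcongr
            exact hlog y z
        _ ≤ (1 + |y|) * (A * |y - z| * ((1 + |y|) + R * (1 + |y|))) := by
            gcongr
            linarith
        _ = _ := by ring

end LocationScale

namespace LocationScale

/-! ### The standard error densities are regular -/

/-- The tail is too heavy for a growing weight, but the slope of `log (1 + y²)` is of order `1 / (1
+ |y|)`. This absorbs the factor `1 + |y|`, so the constant weight `G = 1` suffices. -/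
theorem regularDensity_cauchy : RegularDensity (ProbabilityTheory.cauchyPDFReal 0 1) := by
  have hdef : ∀ y, ProbabilityTheory.cauchyPDFReal 0 1 y = Real.pi⁻¹ * (1 + y ^ 2)⁻¹ := by
    intro y
    simp [ProbabilityTheory.cauchyPDFReal_def, add_comm]
  have hpos : ∀ y, 0 < ProbabilityTheory.cauchyPDFReal 0 1 y := fun y => by
    rw [hdef]
    positivity
  have h1 : ∫ y, ProbabilityTheory.cauchyPDFReal 0 1 y = 1 :=
    ProbabilityTheory.integral_cauchyPDFReal_eq_one 0 one_ne_zero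
  have hi : Integrable (ProbabilityTheory.cauchyPDFReal 0 1) := by
    by_contra h
    exact zero_ne_one ((integral_undef h).symm.trans h1)
  have hm := ProbabilityTheory.measurable_cauchyPDFReal 0 1
  refine ⟨hm, hpos, h1, fun M => ⟨Real.pi⁻¹ * (1 + M ^ 2)⁻¹, by positivity, fun y hy => ?_⟩, ?_⟩
  · rw [hdef]
    gcongr Real.pi⁻¹ * (1 + ?_)⁻¹
    exact sq_le_sq' (abs_le.1 hy).1 (abs_le.1 hy).2
  refine hellinger_of_log (G := fun _ => 1) hpos hi hm (fun _ => zero_le_one) measurable_const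
    (by simpa using hi) fun R hR => ⟨2 * R * (R + 1), by positivity, fun y z hy hz => ?_⟩
  have e : |Real.log (ProbabilityTheory.cauchyPDFReal 0 1 y) -
      Real.log (ProbabilityTheory.cauchyPDFReal 0 1 z)| =
      |Real.log (1 + y ^ 2) - Real.log (1 + z ^ 2)| := by
    have : ∀ w, Real.log (ProbabilityTheory.cauchyPDFReal 0 1 w) =
        Real.log Real.pi⁻¹ - Real.log (1 + w ^ 2) := fun w => by
      rw [hdef, Real.log_mul (by positivity) (by positivity), Real.log_inv (1 + w ^ 2)]
      ring
    rw [this, this, abs_sub_comm]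
    ring_nf
  have habs : ∀ w : ℝ, (1 + |w|) ^ 2 ≤ 2 * (1 + w ^ 2) := fun w => by
    rw [← sq_abs w]
    nlinarith [sq_nonneg (1 - |w|)]
  have hR0 : 0 < R := by linarith
  -- the smaller of the two quadratics dominates the product of the weights
  have hc : ∀ w, 1 + |y| ≤ R * (1 + |w|) → |y| + |z| ≤ (R + 1) * (1 + |w|) →
      (1 + |y|) * (|y| + |z|) / (2 * R * (R + 1)) ≤ 1 + w ^ 2 := by
    intro w h1 h2
    rw [div_le_iff₀ (by positivity)]
    calc (1 + |y|) * (|y| + |z|) ≤ (R * (1 + |w|)) * ((R + 1) * (1 + |w|)) := by gcongr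
      _ = R * (R + 1) * (1 + |w|) ^ 2 := by ring
      _ ≤ R * (R + 1) * (2 * (1 + w ^ 2)) := by gcongr; exact habs w
      _ = _ := by ring
  rw [e, mul_one]
  -- The lower bound used for the Lipschitz estimate of the logarithm vanishes only at `y = z = 0`,
  -- where the claim is trivial.
  rcases (add_nonneg (abs_nonneg y) (abs_nonneg z)).eq_or_lt with h0 | h0
  · have hy0 : y = 0 := abs_eq_zero.1 (by linarith [abs_nonneg y, abs_nonneg z])
    have hz0 : z = 0 := abs_eq_zero.1 (by linarith [abs_nonneg y, abs_nonneg z])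
    simp [hy0, hz0]
  have hyy := hc y (by nlinarith [abs_nonneg y]) (by nlinarith [abs_nonneg y])
  have hzz := hc z hy (by nlinarith [abs_nonneg y])
  have hcpos : 0 < (1 + |y|) * (|y| + |z|) / (2 * R * (R + 1)) := by positivity
  have h2 := abs_log_sub_log_le hcpos hyy hzz
  have h3 : |1 + y ^ 2 - (1 + z ^ 2)| ≤ |y - z| * (|y| + |z|) := by
    rw [show 1 + y ^ 2 - (1 + z ^ 2) = (y - z) * (y + z) by ring, abs_mul]
    gcongr
    exact abs_add_le _ _
  calc (1 + |y|) * |Real.log (1 + y ^ 2) - Real.log (1 + z ^ 2)| ≤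
      (1 + |y|) * (|y - z| * (|y| + |z|) / ((1 + |y|) * (|y| + |z|) / (2 * R * (R + 1)))) := by
        gcongr
        exact h2.trans (by gcongr)
    _ = _ := by field_simp

/-- A function that is quadratically Lipschitz on both half-lines, and vanishes at the origin,
is so on the line. -/
theorem abs_sub_le_of_halves {V : ℝ → ℝ} {A : ℝ} (hA : 0 ≤ A)
    (h0 : ∀ y, |V y| ≤ A * |y| * (1 + |y|))
    (hp : ∀ y z, 0 < y → 0 < z → |V y - V z| ≤ A * |y - z| * (1 + |y| + |z|))
    (hn : ∀ y z, y ≤ 0 → z ≤ 0 → |V y - V z| ≤ A * |y - z| * (1 + |y| + |z|)) (y z : ℝ) :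
    |V y - V z| ≤ A * |y - z| * (1 + |y| + |z|) := by
  have opp : ∀ y z, 0 < y → z ≤ 0 → |V y - V z| ≤ A * |y - z| * (1 + |y| + |z|) := by
    intro y z hy hz
    have e : |y - z| = |y| + |z| := by
      rw [abs_of_pos (by linarith), abs_of_pos hy, abs_of_nonpos hz]; ring
    rw [e]
    refine (abs_sub _ _).trans ((add_le_add (h0 y) (h0 z)).trans ?_)
    have : 0 ≤ A * (|y| * |z|) := by positivity
    nlinarith
  rcases lt_or_ge 0 y with hy | hy <;> rcases lt_or_ge 0 z with hz | hz
  · exact hp y z hy hz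
  · exact opp y z hy hz
  · have := opp z y hz hy
    rwa [abs_sub_comm, abs_sub_comm z y, add_right_comm] at this
  · exact hn y z hy hz

theorem abs_sq_sub_sq_le {c A : ℝ} (hc : 0 ≤ c) (hA : c ≤ A) (y z : ℝ) :
    |c * y ^ 2 - c * z ^ 2| ≤ A * |y - z| * (1 + |y| + |z|) := by
  rw [← mul_sub, abs_mul, abs_of_nonneg hc, sq_sub_sq, abs_mul, mul_comm |y + z|, ← mul_assoc]
  have : |y + z| ≤ 1 + |y| + |z| := (abs_add_le _ _).trans (by linarith)
  have : 0 ≤ A * |y - z| := mul_nonneg (hc.trans hA) (abs_nonneg _)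
  gcongr

theorem exp_neg_mul_sq_le {c : ℝ} (hc : 0 < c) (y : ℝ) :
    Real.exp (-(c * y ^ 2)) ≤ Real.exp c * Real.exp (-(c * |y|)) := by
  rw [← Real.exp_add, Real.exp_le_exp, ← sq_abs y]
  nlinarith [mul_nonneg hc.le (sq_nonneg (|y| - 1)), mul_nonneg hc.le (abs_nonneg y)]

theorem regularDensity_asymNormal {φ : ℝ} (h0 : 0 < φ) (h1 : φ < 1) :
    RegularDensity (asymNormalDensity φ) := by
  have h1' : 0 < 1 - φ := by linarith
  set k := 2 / √Real.pi * (√(φ * (1 - φ)) / (√φ + √(1 - φ))) with hk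
  have hk0 : 0 < k := by positivity
  set V : ℝ → ℝ := fun y => (if 0 ≤ y then φ else 1 - φ) * y ^ 2 with hV
  have hf : ∀ y, asymNormalDensity φ y = k * Real.exp (-V y) := fun y => rfl
  have hVabs : ∀ y z, |V y - V z| ≤ 1 * |y - z| * (1 + |y| + |z|) := by
    have hpos : ∀ y, 0 ≤ y → V y = φ * y ^ 2 := fun y hy => by simp [hV, hy]
    have hneg : ∀ y, y ≤ 0 → V y = (1 - φ) * y ^ 2 := fun y hy => by
      rcases hy.eq_or_lt with rfl | hy
      · simp [hV]
      · simp [hV, not_le.2 hy]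
    refine abs_sub_le_of_halves zero_le_one (fun y => ?_) (fun y z hy hz => ?_)
      fun y z hy hz => ?_
    · rcases le_total 0 y with hy | hy
      · simpa [hpos y hy] using abs_sq_sub_sq_le h0.le h1.le y 0
      · simpa [hneg y hy] using abs_sq_sub_sq_le (A := 1) h1'.le (by linarith) y 0
    · rw [hpos y hy.le, hpos z hz.le]
      exact abs_sq_sub_sq_le h0.le h1.le y z
    · rw [hneg y hy, hneg z hz]
      exact abs_sq_sub_sq_le h1'.le (by linarith) y z
  set c := min φ (1 - φ) with hc
  have hc0 : 0 < c := lt_min h0 h1'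
  refine regularDensity_of_exp_tail (A := 1) (c := c) (k := k * Real.exp c) ?_
    (fun y => by rw [hf]; positivity) zero_le_one hc0 (fun y z => ?_) (fun y => ?_) ?_
  · have : Measurable V := (Measurable.ite measurableSet_Ici measurable_const
      measurable_const).mul (by fun_prop)
    exact (this.neg.exp).const_mul k
  · have hl : ∀ w, Real.log (asymNormalDensity φ w) = Real.log k - V w := fun w => by
      rw [hf, Real.log_mul hk0.ne' (Real.exp_pos _).ne', Real.log_exp]
      ring
    rw [hl, hl, show Real.log k - V y - (Real.log k - V z) = -(V y - V z) by ring, abs_neg]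
    exact hVabs y z
  · rw [hf, mul_assoc k]
    refine mul_le_mul_of_nonneg_left ?_ hk0.le
    refine le_trans ?_ (exp_neg_mul_sq_le hc0 y)
    rw [Real.exp_le_exp, neg_le_neg_iff]
    simp only [hV]
    gcongr
    split_ifs
    · exact min_le_left _ _
    · exact min_le_right _ _
  · have e1 : ∫ y in Ioi (0 : ℝ), asymNormalDensity φ (-y) =
        k * (√(Real.pi / (1 - φ)) / 2) := by
      rw [← integral_gaussian_Ioi, ← integral_const_mul]
      refine setIntegral_congr_fun measurableSet_Ioi fun y hy => ?_
      have : ¬ (0 ≤ -y) := by simpa using hy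
      simp only [hf, hV, this, if_false]
      ring_nf
    have e2 : ∫ y in Ioi (0 : ℝ), asymNormalDensity φ y = k * (√(Real.pi / φ) / 2) := by
      rw [← integral_gaussian_Ioi, ← integral_const_mul]
      refine setIntegral_congr_fun measurableSet_Ioi fun y hy => ?_
      simp [hf, hV, (mem_Ioi.1 hy).le]
    rw [e1, e2, hk, Real.sqrt_div Real.pi_pos.le, Real.sqrt_div Real.pi_pos.le,
      Real.sqrt_mul h0.le]
    have := Real.sqrt_pos.2 h0
    have := Real.sqrt_pos.2 h1'
    have := Real.sqrt_pos.2 Real.pi_pos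
    field_simp

/-- The continuity condition gives both branches the same prefactor `k`, so the log-density is `log
k - V` with `V` vanishing at the origin and quadratically Lipschitz on each half-line. The two
branches have masses `τ` and `1 - τ`. -/
theorem regularDensity_cnl {τ b : ℝ} (h0 : 0 < τ) (h1 : τ < 1) (hb : 0 < b)
    (hcont : (1 - τ) / b = 2 * τ / √(2 * Real.pi)) : RegularDensity (cnlDensity τ b) := by
  set k := 2 * τ / √(2 * Real.pi) with hk
  have hk0 : 0 < k := by positivity
  set V : ℝ → ℝ := fun y => if y ≤ 0 then y ^ 2 / 2 else y / b with hV
  have hf : ∀ y, cnlDensity τ b y = k * Real.exp (-V y) := fun y => by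
    simp only [cnlDensity, hV, hcont]
    split_ifs <;> rfl
  have hpos : ∀ y, 0 < y → V y = y / b := fun y hy => by simp [hV, not_le.2 hy]
  have hneg : ∀ y, y ≤ 0 → V y = 1 / 2 * y ^ 2 := fun y hy => by simp [hV, hy]; ring
  set A := 1 + 1 / b with hA
  have hA1 : 1 / 2 ≤ A := by
    have : 0 < 1 / b := by positivity
    rw [hA]; linarith
  have hlin : ∀ y z : ℝ, |y / b - z / b| ≤ A * |y - z| * (1 + |y| + |z|) := by
    intro y z
    rw [← sub_div, abs_div, abs_of_pos hb, div_eq_mul_one_div, mul_comm]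
    have : 1 / b * |y - z| ≤ A * |y - z| := by
      gcongr
      rw [hA]; linarith
    refine this.trans (le_mul_of_one_le_right (by positivity) ?_)
    linarith [abs_nonneg y, abs_nonneg z]
  have hVabs : ∀ y z, |V y - V z| ≤ A * |y - z| * (1 + |y| + |z|) := by
    refine abs_sub_le_of_halves (by linarith) (fun y => ?_) (fun y z hy hz => ?_)
      fun y z hy hz => ?_
    · rcases le_or_gt y 0 with hy | hy
      · simpa [hneg y hy] using abs_sq_sub_sq_le (by norm_num) hA1 y 0
      · simpa [hpos y hy] using hlin y 0
    · rw [hpos y hy, hpos z hz]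
      exact hlin y z
    · rw [hneg y hy, hneg z hz]
      exact abs_sq_sub_sq_le (by norm_num) hA1 y z
  set c := min (1 / 2) (1 / b) with hc
  have hc0 : 0 < c := lt_min (by norm_num) (by positivity)
  refine regularDensity_of_exp_tail (A := A) (c := c) (k := k * Real.exp c) ?_
    (fun y => by rw [hf]; positivity) (by linarith) hc0 (fun y z => ?_) (fun y => ?_) ?_
  · have : Measurable V := Measurable.ite measurableSet_Iic (by fun_prop) (by fun_prop)
    rw [show cnlDensity τ b = fun y => k * Real.exp (-V y) from funext hf]
    exact (this.neg.exp).const_mul k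
  · have hl : ∀ w, Real.log (cnlDensity τ b w) = Real.log k - V w := fun w => by
      rw [hf, Real.log_mul hk0.ne' (Real.exp_pos _).ne', Real.log_exp]
      ring
    rw [hl, hl, show Real.log k - V y - (Real.log k - V z) = -(V y - V z) by ring, abs_neg]
    exact hVabs y z
  · rw [hf, mul_assoc]
    gcongr
    rcases le_or_gt y 0 with hy | hy
    · refine le_trans ?_ (exp_neg_mul_sq_le hc0 y)
      rw [Real.exp_le_exp, neg_le_neg_iff, hneg y hy]
      gcongr
      exact min_le_left _ _
    · rw [← Real.exp_add, Real.exp_le_exp, hpos y hy, abs_of_pos hy]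
      have : c * y ≤ 1 / b * y := by gcongr; exact min_le_right _ _
      have e : 1 / b * y = y / b := by ring
      linarith
  · have e1 : ∫ y in Ioi (0 : ℝ), cnlDensity τ b (-y) = k * (√(Real.pi / (1 / 2)) / 2) := by
      rw [← integral_gaussian_Ioi, ← integral_const_mul]
      refine setIntegral_congr_fun measurableSet_Ioi fun y hy => ?_
      have : -y ≤ 0 := by simpa using (mem_Ioi.1 hy).le
      simp only [hf, hneg _ this]
      ring_nf
    have e2 : ∫ y in Ioi (0 : ℝ), cnlDensity τ b y = k * b := by
      have h := integral_exp_mul_Ioi (a := -(1 / b)) (by simpa using hb) 0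
      rw [show k * b = k * (-Real.exp (-(1 / b) * 0) / -(1 / b)) by simp, ← h,
        ← integral_const_mul]
      refine setIntegral_congr_fun measurableSet_Ioi fun y hy => ?_
      simp only [hf, hpos y hy]
      ring_nf
    have e3 : k * b = 1 - τ := by rw [← hcont]; field_simp
    have e4 : Real.pi / (1 / 2) = 2 * Real.pi := by ring
    rw [e1, e2, e3, e4, hk]
    have : 0 < √(2 * Real.pi) := by positivity
    field_simp
    ring

/-! The check loss and the gamma-type densities -/

theorem checkLoss_of_nonneg (τ : ℝ) {y : ℝ} (hy : 0 ≤ y) : checkLoss τ y = τ * y := by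
  simp [checkLoss, not_lt.2 hy, mul_comm]

theorem checkLoss_of_nonpos (τ : ℝ) {y : ℝ} (hy : y ≤ 0) : checkLoss τ y = (1 - τ) * -y := by
  rcases hy.eq_or_lt with rfl | hy
  · simp [checkLoss]
  · simp only [checkLoss, hy, if_true]
    ring

theorem measurable_checkLoss (τ : ℝ) : Measurable (checkLoss τ) :=
  measurable_id.mul (measurable_const.sub
    (Measurable.ite measurableSet_Iio measurable_const measurable_const))

theorem min_mul_abs_le_checkLoss (τ y : ℝ) : min τ (1 - τ) * |y| ≤ checkLoss τ y := by
  rcases le_total 0 y with hy | hy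
  · rw [checkLoss_of_nonneg τ hy, abs_of_nonneg hy]
    gcongr
    exact min_le_left _ _
  · rw [checkLoss_of_nonpos τ hy, abs_of_nonpos hy]
    have : 0 ≤ -y := by linarith
    gcongr
    exact min_le_right _ _

theorem checkLoss_nonneg {τ : ℝ} (h0 : 0 < τ) (h1 : τ < 1) (y : ℝ) : 0 ≤ checkLoss τ y :=
  le_trans (mul_nonneg (le_min h0.le (by linarith)) (abs_nonneg y)) (min_mul_abs_le_checkLoss τ y)

theorem abs_checkLoss_sub_le {τ : ℝ} (h0 : 0 < τ) (h1 : τ < 1) (y z : ℝ) :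
    |checkLoss τ y - checkLoss τ z| ≤ 1 * |y - z| * (1 + |y| + |z|) := by
  have lin : ∀ c y z : ℝ, 0 ≤ c → c ≤ 1 →
      |c * y - c * z| ≤ 1 * |y - z| * (1 + |y| + |z|) := by
    intro c y z hc hc1
    rw [← mul_sub, abs_mul, abs_of_nonneg hc]
    refine (mul_le_mul_of_nonneg_right hc1 (abs_nonneg _)).trans
      (le_mul_of_one_le_right (by positivity) ?_)
    linarith [abs_nonneg y, abs_nonneg z]
  refine abs_sub_le_of_halves zero_le_one (fun y => ?_) (fun y z hy hz => ?_)
    (fun y z hy hz => ?_) y z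
  · rcases le_total 0 y with hy | hy
    · simpa [checkLoss_of_nonneg τ hy] using lin τ y 0 h0.le h1.le
    · simpa [checkLoss_of_nonpos τ hy] using lin (1 - τ) y 0 (by linarith) (by linarith)
  · rw [checkLoss_of_nonneg τ hy.le, checkLoss_of_nonneg τ hz.le]
    exact lin τ y z h0.le h1.le
  · rw [checkLoss_of_nonpos τ hy, checkLoss_of_nonpos τ hz]
    have := lin (1 - τ) (-y) (-z) (by linarith) (by linarith)
    rwa [abs_neg, abs_neg, show -y - -z = -(y - z) by ring, abs_neg] at this

theorem upperGamma_integrableOn {a : ℝ} (ha : 0 ≤ a) :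
    IntegrableOn (fun x : ℝ => x ^ a * Real.exp (-x)) (Ioi a) := by
  have := (Real.GammaIntegral_convergent (s := a + 1) (by linarith)).mono_set (Ioi_subset_Ioi ha)
  simpa [mul_comm] using this

theorem upperGamma_pos {a : ℝ} (ha : 0 ≤ a) : 0 < upperGamma (a + 1) a := by
  have e : upperGamma (a + 1) a = ∫ x in Ioi a, x ^ a * Real.exp (-x) := by simp [upperGamma]
  have hpos : ∀ x ∈ Ioi a, 0 < x ^ a * Real.exp (-x) := fun x hx =>
    mul_pos (Real.rpow_pos_of_pos (ha.trans_lt hx) _) (Real.exp_pos _)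
  rw [e, setIntegral_pos_iff_support_of_nonneg_ae _ (upperGamma_integrableOn ha)]
  · refine lt_of_lt_of_le ?_ (measure_mono (s := Ioi a) fun x hx => ⟨(hpos x hx).ne', hx⟩)
    simp
  · exact (ae_restrict_iff' measurableSet_Ioi).2 (ae_of_all _ fun x hx => (hpos x hx).le)

theorem integral_Ioi_affine (g : ℝ → ℝ) (a : ℝ) {c : ℝ} (hc : 0 < c) :
    ∫ y in Ioi (0 : ℝ), g (a + c * y) = c⁻¹ * ∫ x in Ioi a, g x := by
  rw [integral_comp_mul_left_Ioi (fun x => g (a + x)) 0 hc, mul_zero, smul_eq_mul]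
  congr 1
  rw [← integral_indicator measurableSet_Ioi, ← integral_indicator measurableSet_Ioi,
    ← integral_add_left_eq_self ((Ioi a).indicator g) a]
  congr 1
  ext x
  by_cases h : 0 < x <;> simp [indicator, h]

/-- The derivative `a / (a + r)` is at most one. Hence the power factor in the gamma-type density
does not spoil the Lipschitz bound on its logarithm. -/
theorem abs_mul_log_sub_le {a r t : ℝ} (ha : 0 ≤ a) (hr : 0 ≤ r) (ht : 0 ≤ t) :
    |a * Real.log (a + r) - a * Real.log (a + t)| ≤ |r - t| := by
  rcases ha.eq_or_lt with rfl | ha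
  · simp
  rw [← mul_sub, abs_mul, abs_of_pos ha]
  have := abs_log_sub_log_le ha (le_add_of_nonneg_right hr) (le_add_of_nonneg_right ht)
  rw [add_sub_add_left_eq_sub] at this
  calc _ ≤ a * (|r - t| / a) := by gcongr
    _ = _ := by field_simp

/-- The tangent to the logarithm at `2a` is used rather than at `a`: its slope consumes only half of
the linear term, so the factor `exp (-(a + r))` retains half of its decay. -/
theorem mul_log_le {a r : ℝ} (ha : 0 ≤ a) (hr : 0 ≤ r) :
    a * Real.log (a + r) ≤ a * Real.log (2 * a) + (a + r) / 2 := by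
  rcases ha.eq_or_lt with rfl | ha
  · simpa using by positivity
  have h := Real.log_le_sub_one_of_pos (x := (a + r) / (2 * a)) (by positivity)
  rw [Real.log_div (by positivity) (by positivity)] at h
  have e : a * ((a + r) / (2 * a)) = (a + r) / 2 := by field_simp
  nlinarith

theorem regularDensity_acdtg {a τ : ℝ} (ha : 0 ≤ a) (h0 : 0 < τ) (h1 : τ < 1) :
    RegularDensity (acdtgDensity a τ) := by
  have hg := upperGamma_pos ha
  have h1' : 0 < 1 - τ := by linarith
  set k := τ * (1 - τ) / upperGamma (a + 1) a with hk
  have hk0 : 0 < k := by positivity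
  have hr : ∀ y, 0 ≤ checkLoss τ y := checkLoss_nonneg h0 h1
  have hf : ∀ y, acdtgDensity a τ y =
      k * Real.exp (a * Real.log (a + checkLoss τ y) - (a + checkLoss τ y)) := by
    intro y
    rw [acdtgDensity, ← hk, mul_assoc, sub_eq_add_neg, Real.exp_add]
    congr 2
    -- For `a = 0` the base vanishes at `y = 0`; the conventions `0 ^ 0 = 1` and `0 * log 0 = 0`
    -- agree there.
    rcases ha.eq_or_lt with rfl | ha
    · simp
    · rw [Real.rpow_def_of_pos (by linarith [hr y]), mul_comm]
  set c := min τ (1 - τ) / 2 with hc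
  have hc0 : 0 < c := half_pos (lt_min h0 h1')
  refine regularDensity_of_exp_tail (A := 2) (c := c) (k := k * Real.exp (a * Real.log (2 * a))) ?_
    (fun y => by rw [hf]; positivity) zero_le_two hc0 (fun y z => ?_) (fun y => ?_) ?_
  · have := measurable_checkLoss τ
    unfold acdtgDensity
    fun_prop
  · have hl : ∀ w, Real.log (acdtgDensity a τ w) = Real.log k +
        (a * Real.log (a + checkLoss τ w) - (a + checkLoss τ w)) := fun w => by
      rw [hf, Real.log_mul hk0.ne' (Real.exp_pos _).ne', Real.log_exp]
    have b1 := abs_mul_log_sub_le ha (hr y) (hr z)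
    have b2 := abs_checkLoss_sub_le h0 h1 y z
    rw [hl, hl]
    calc _ = |(a * Real.log (a + checkLoss τ y) - a * Real.log (a + checkLoss τ z)) -
          (checkLoss τ y - checkLoss τ z)| := by ring_nf
      _ ≤ _ := (abs_sub _ _).trans (by linarith)
  · rw [hf, mul_assoc, ← Real.exp_add]
    gcongr
    have b1 := mul_log_le ha (hr y)
    have b2 := min_mul_abs_le_checkLoss τ y
    rw [hc]
    linarith
  · have e : ∀ c > 0, (∫ y in Ioi (0 : ℝ), k * (a + c * y) ^ a * Real.exp (-(a + c * y))) =
        k * (c⁻¹ * upperGamma (a + 1) a) := by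
      intro c hc
      have := integral_Ioi_affine (fun x => x ^ a * Real.exp (-x)) a hc
      rw [show upperGamma (a + 1) a = ∫ x in Ioi a, x ^ a * Real.exp (-x) by simp [upperGamma],
        ← this, ← integral_const_mul]
      simp_rw [mul_assoc]
    have e1 : ∫ y in Ioi (0 : ℝ), acdtgDensity a τ (-y) =
        k * ((1 - τ)⁻¹ * upperGamma (a + 1) a) := by
      rw [← e _ h1']
      refine setIntegral_congr_fun measurableSet_Ioi fun y hy => ?_
      have : -y ≤ 0 := by simpa using (mem_Ioi.1 hy).le
      simp only [acdtgDensity, checkLoss_of_nonpos τ this, neg_neg, ← hk]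
    have e2 : ∫ y in Ioi (0 : ℝ), acdtgDensity a τ y = k * (τ⁻¹ * upperGamma (a + 1) a) := by
      rw [← e _ h0]
      refine setIntegral_congr_fun measurableSet_Ioi fun y hy => ?_
      simp only [acdtgDensity, checkLoss_of_nonneg τ (mem_Ioi.1 hy).le, ← hk]
    rw [e1, e2, hk]
    field_simp
    ring

theorem aldDensity_eq_acdtgDensity (τ : ℝ) : aldDensity τ = acdtgDensity 0 τ := by
  ext y
  have : upperGamma (0 + 1) 0 = 1 := by
    simp only [upperGamma, zero_add, sub_self, Real.rpow_zero, one_mul]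
    exact integral_exp_neg_Ioi_zero
  simp only [aldDensity, acdtgDensity, this]
  simp

theorem IsStandardErrorDensity.regularDensity {f : ℝ → ℝ} (hf : IsStandardErrorDensity f) :
    RegularDensity f := by
  cases hf with
  | asymmetricLaplace τ h0 h1 =>
    rw [aldDensity_eq_acdtgDensity]
    exact regularDensity_acdtg le_rfl h0 h1
  | connectedGamma a τ ha h0 h1 => exact regularDensity_acdtg ha h0 h1
  | connectedNormalLaplace τ b h0 h1 hb hcont => exact regularDensity_cnl h0 h1 hb hcont
  | cauchy => exact regularDensity_cauchy
  | asymmetricNormal φ h0 h1 => exact regularDensity_asymNormal h0 h1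

end LocationScale

namespace LocationScale

/-! ### The estimator built from a finite net -/

variable {d : ℕ}

/-- A measurable mean function bounded by `M`, and a measurable positive scale function with
values in `[a, b]`, on the cube. -/
structure Admissible (M a b : ℝ) (μ σ : (Fin d → ℝ) → ℝ) : Prop where
  measurable_mean : Measurable μ
  measurable_scale : Measurable σ
  scale_pos : ∀ x, 0 < σ x
  abs_mean_le : ∀ x ∈ cube d, |μ x| ≤ M
  scale_mem : ∀ x ∈ cube d, σ x ∈ Icc a b

/-- The squared distance of two functions in `L²` of the cube. -/
def sqDist (μ μ' : (Fin d → ℝ) → ℝ) : ℝ := ∫ x in cube d, (μ x - μ' x) ^ 2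

theorem sqDist_comm (μ μ' : (Fin d → ℝ) → ℝ) : sqDist μ μ' = sqDist μ' μ := by
  unfold sqDist
  congr 1
  ext x
  ring

theorem ae_covariateLaw_mem_cube (h : (Fin d → ℝ) → ℝ) : ∀ᵐ x ∂(covariateLaw h), x ∈ cube d :=
  (withDensity_absolutelyContinuous _ _).ae_le (ae_restrict_mem (measurableSet_cube d))

theorem lintegral_covariateLaw_le {K : ℝ} {h : (Fin d → ℝ) → ℝ} (hh : h ∈ densityClass d K)
    {F : (Fin d → ℝ) → ℝ≥0∞} (hF : Measurable F) :
    ∫⁻ x, F x ∂(covariateLaw h) ≤ ENNReal.ofReal K * ∫⁻ x in cube d, F x := by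
  obtain ⟨hm, hb, -⟩ := hh
  rw [covariateLaw, lintegral_withDensity_eq_lintegral_mul _ hm.ennreal_ofReal hF,
    ← lintegral_const_mul _ hF]
  refine setLIntegral_mono' (measurableSet_cube d) fun x hx => ?_
  simp only [Pi.mul_apply]
  gcongr
  exact (hb x hx).2

theorem integral_covariateLaw_ge {K : ℝ} (hK : 1 < K) {h : (Fin d → ℝ) → ℝ}
    (hh : h ∈ densityClass d K) {F : (Fin d → ℝ) → ℝ} (hF : Measurable F) {B : ℝ}
    (hF0 : ∀ x ∈ cube d, 0 ≤ F x) (hFB : ∀ x ∈ cube d, F x ≤ B) :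
    1 / K * ∫ x in cube d, F x ≤ ∫ x, F x ∂(covariateLaw h) := by
  obtain ⟨hm, hb, h1⟩ := hh
  have hfin : IsFiniteMeasure ((volume : Measure (Fin d → ℝ)).restrict (cube d)) :=
    ⟨by simp [volume_cube]⟩
  have hcube := (ae_restrict_mem (μ := volume) (measurableSet_cube d))
  have hIntegrable : Integrable F ((volume : Measure (Fin d → ℝ)).restrict (cube d)) := by
    refine Integrable.of_bound hF.aestronglyMeasurable B ?_
    filter_upwards [hcube] with x hx
    rw [Real.norm_of_nonneg (hF0 x hx)]
    exact hFB x hx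
  rw [covariateLaw, integral_withDensity_eq_integral_toReal_smul hm.ennreal_ofReal
    (ae_of_all _ fun x => ENNReal.ofReal_lt_top), ← integral_const_mul]
  have hpos : ∀ x ∈ cube d, 0 ≤ h x := fun x hx => le_trans (by positivity) (hb x hx).1
  refine integral_mono_ae (hIntegrable.const_mul _) ?_ ?_
  · refine Integrable.of_bound (by fun_prop) (K * B) ?_
    filter_upwards [hcube] with x hx
    rw [smul_eq_mul, ENNReal.toReal_ofReal (hpos x hx),
      Real.norm_of_nonneg (mul_nonneg (hpos x hx) (hF0 x hx))]
    exact mul_le_mul (hb x hx).2 (hFB x hx) (hF0 x hx) (by linarith)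
  · filter_upwards [hcube] with x hx
    rw [smul_eq_mul, ENNReal.toReal_ofReal (hpos x hx)]
    exact mul_le_mul_of_nonneg_right (hb x hx).1 (hF0 x hx)

theorem isProbabilityMeasure_observationLaw {f : ℝ → ℝ} (hf : RegularDensity f)
    {μ σ h : (Fin d → ℝ) → ℝ} (hμ : Measurable μ) (hσ : Measurable σ) (hσ0 : ∀ x, 0 < σ x)
    [IsProbabilityMeasure (covariateLaw h)] :
    IsProbabilityMeasure (observationLaw f μ σ h) := by
  refine ⟨?_⟩
  have hden := (measurable_locScale_comp hf.measurable hμ hσ).ennreal_ofReal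
  rw [observationLaw_eq_withDensity hf.measurable hμ hσ hσ0, withDensity_apply _ MeasurableSet.univ,
    setLIntegral_univ, lintegral_prod _ hden.aemeasurable]
  simp [hf.lintegral_locScale_eq_one _ (hσ0 _)]

/-- Combined with the separation inequality this bounds `c (μ - μ')²` by `2`, so the bound on the
conditional expectation of the test ratio is nonnegative and passing through `ENNReal.ofReal` loses
nothing. -/
theorem RegularDensity.hellingerSq_locScale_le_two {f : ℝ → ℝ} (hf : RegularDensity f)
    (m m' : ℝ) {σ σ' : ℝ} (hσ : 0 < σ) (hσ' : 0 < σ') :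
    hellingerSq (locScale f m σ) (locScale f m' σ') ≤ 2 := by
  have i1 := hf.integrable_locScale m hσ
  have i2 := hf.integrable_locScale m' hσ'
  calc _ ≤ ∫ y, (locScale f m σ y + locScale f m' σ' y) :=
        integral_mono_of_nonneg (ae_of_all _ fun _ => sq_nonneg _) (i1.add i2)
          (ae_of_all _ fun y => sqrt_sub_sqrt_sq_le (hf.locScale_pos m hσ y).le
            (hf.locScale_pos m' hσ' y).le)
    _ = 2 := by
        rw [integral_add i1 i2, hf.integral_locScale m hσ, hf.integral_locScale m' hσ']
        norm_num

/-- The test ratio of two regression models at an observation. -/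
def modelRatio (f : ℝ → ℝ) (μ σ μ' σ' : (Fin d → ℝ) → ℝ) (z : (Fin d → ℝ) × ℝ) : ℝ :=
  testRatio (locScale f (μ z.1) (σ z.1) z.2) (locScale f (μ' z.1) (σ' z.1) z.2)

theorem measurable_modelRatio {f : ℝ → ℝ} (hf : Measurable f) {μ σ μ' σ' : (Fin d → ℝ) → ℝ}
    (hμ : Measurable μ) (hσ : Measurable σ) (hμ' : Measurable μ') (hσ' : Measurable σ') :
    Measurable (modelRatio f μ σ μ' σ') := by
  have h1 := measurable_locScale_comp hf hμ hσ
  have h2 := measurable_locScale_comp hf hμ' hσ'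
  unfold modelRatio testRatio
  fun_prop

/-- The expected test ratio is small when the truth is close to the first model and the second
model is far from the first. -/
theorem lintegral_modelRatio_le {f : ℝ → ℝ} (hf : RegularDensity f) {K : ℝ} (hK : 1 < K)
    (M a b : ℝ) (ha : 0 < a) (hb : 0 < b) : ∃ A > 0, ∃ c > 0,
    ∀ μ₀ σ₀ μ σ μ' σ' h : (Fin d → ℝ) → ℝ, ∀ ε : ℝ,
      Admissible M a b μ₀ σ₀ → Admissible M a b μ σ → Admissible M a b μ' σ' →
      h ∈ densityClass d K → (∀ x ∈ cube d, |μ₀ x - μ x| ≤ ε ∧ |σ₀ x - σ x| ≤ ε) →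
      ∫⁻ z, ENNReal.ofReal (modelRatio f μ σ μ' σ' z) ∂(observationLaw f μ₀ σ₀ h) ≤
        ENNReal.ofReal (Real.exp (A * ε ^ 2 - c * sqDist μ μ')) := by
  obtain ⟨A, hA, hup⟩ := hf.hellinger M a b ha
  obtain ⟨c, hc, hlow⟩ := hf.sq_sub_le_hellingerSq M a b ha hb
  have hK0 : 0 < K := by linarith
  -- The `12` is `6` from the test inequality times `2` for the errors in mean and scale; `1 / 8` is
  -- its gain, and `1 / K` passes from the design law to Lebesgue measure.
  refine ⟨12 * A, by positivity, c / 8 * (1 / K), by positivity, ?_⟩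
  intro μ₀ σ₀ μ σ μ' σ' h ε h₀ h₁ h₂ hh hclose
  have hprob := isProbabilityMeasure_covariateLaw hK hh
  have hden := (measurable_locScale_comp hf.measurable h₀.measurable_mean
    h₀.measurable_scale).ennreal_ofReal
  have hZ := (measurable_modelRatio hf.measurable h₁.measurable_mean h₁.measurable_scale
    h₂.measurable_mean h₂.measurable_scale).ennreal_ofReal
  have hgm : Measurable fun x => (μ x - μ' x) ^ 2 :=
    (h₁.measurable_mean.sub h₂.measurable_mean).pow_const 2
  have hgB : ∀ x ∈ cube d, (μ x - μ' x) ^ 2 ≤ (2 * M) ^ 2 := fun x hx => by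
    rw [← sq_abs]
    refine pow_le_pow_left₀ (abs_nonneg _) ((abs_sub _ _).trans ?_) 2
    linarith [h₁.abs_mean_le x hx, h₂.abs_mean_le x hx]
  have hgI : Integrable (fun x => (μ x - μ' x) ^ 2) (covariateLaw h) := by
    refine Integrable.of_bound hgm.aestronglyMeasurable ((2 * M) ^ 2) ?_
    filter_upwards [ae_covariateLaw_mem_cube h] with x hx
    rw [Real.norm_of_nonneg (sq_nonneg _)]
    exact hgB x hx
  have inner : ∀ x ∈ cube d, 0 ≤ 1 + 12 * A * ε ^ 2 - c / 8 * (μ x - μ' x) ^ 2 ∧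
      ∫⁻ y, ENNReal.ofReal (locScale f (μ₀ x) (σ₀ x) y) *
        ENNReal.ofReal (modelRatio f μ σ μ' σ' (x, y)) ≤
        ENNReal.ofReal (1 + 12 * A * ε ^ 2 - c / 8 * (μ x - μ' x) ^ 2) := by
    intro x hx
    have l := hlow _ _ _ _ (h₁.abs_mean_le x hx) (h₂.abs_mean_le x hx) (h₁.scale_mem x hx)
      (h₂.scale_mem x hx)
    have u := hup _ _ _ _ (h₀.abs_mean_le x hx) (h₁.abs_mean_le x hx) (h₀.scale_mem x hx)
      (h₁.scale_mem x hx)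
    have t := hf.hellingerSq_locScale_le_two (μ x) (μ' x) (h₁.scale_pos x) (h₂.scale_pos x)
    have u1 : (μ₀ x - μ x) ^ 2 ≤ ε ^ 2 := by
      rw [← sq_abs]; exact pow_le_pow_left₀ (abs_nonneg _) (hclose x hx).1 2
    have u2 : (σ₀ x - σ x) ^ 2 ≤ ε ^ 2 := by
      rw [← sq_abs]; exact pow_le_pow_left₀ (abs_nonneg _) (hclose x hx).2 2
    have u3 : A * ((μ₀ x - μ x) ^ 2 + (σ₀ x - σ x) ^ 2) ≤ A * (2 * ε ^ 2) := by
      gcongr; linarith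
    refine ⟨by nlinarith [mul_nonneg hA.le (sq_nonneg ε)], ?_⟩
    simp_rw [mul_comm (ENNReal.ofReal (locScale f (μ₀ x) (σ₀ x) _))]
    have key := lintegral_testRatio_le (p := locScale f (μ x) (σ x)) (q := locScale f (μ' x) (σ' x))
      (r := locScale f (μ₀ x) (σ₀ x)) (hf.integrable_locScale _ (h₁.scale_pos x))
      (hf.integrable_locScale _ (h₂.scale_pos x)) (hf.integrable_locScale _ (h₀.scale_pos x))
      (hf.locScale_pos _ (h₁.scale_pos x)) (hf.locScale_pos _ (h₂.scale_pos x))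
      (fun y => (hf.locScale_pos _ (h₀.scale_pos x) y).le)
      (hf.integral_locScale _ (h₁.scale_pos x)) (hf.integral_locScale _ (h₂.scale_pos x))
      (hf.integral_locScale _ (h₀.scale_pos x))
    simp only [modelRatio]
    refine key.trans (ENNReal.ofReal_le_ofReal ?_)
    linarith
  rw [observationLaw_eq_withDensity hf.measurable h₀.measurable_mean h₀.measurable_scale
    h₀.scale_pos, lintegral_withDensity_eq_lintegral_mul _ hden hZ,
    lintegral_prod _ (hden.mul hZ).aemeasurable]
  calc _ ≤ ∫⁻ x, ENNReal.ofReal (1 + 12 * A * ε ^ 2 - c / 8 * (μ x - μ' x) ^ 2)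
        ∂(covariateLaw h) := by
        refine lintegral_mono_ae ?_
        filter_upwards [ae_covariateLaw_mem_cube h] with x hx using (inner x hx).2
    _ = ENNReal.ofReal (∫ x, (1 + 12 * A * ε ^ 2 - c / 8 * (μ x - μ' x) ^ 2)
        ∂(covariateLaw h)) := by
        have hI : Integrable (fun x => 1 + 12 * A * ε ^ 2 - c / 8 * (μ x - μ' x) ^ 2)
            (covariateLaw h) := (integrable_const _).sub (hgI.const_mul _)
        rw [ofReal_integral_eq_lintegral_ofReal hI]
        filter_upwards [ae_covariateLaw_mem_cube h] with x hx using (inner x hx).1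
    _ ≤ _ := by
        refine ENNReal.ofReal_le_ofReal ?_
        rw [integral_sub (integrable_const _) (hgI.const_mul _), integral_const_mul]
        have hge := integral_covariateLaw_ge hK hh hgm (fun x _ => sq_nonneg _) hgB
        simp only [integral_const, probReal_univ, smul_eq_mul, one_mul]
        refine le_trans ?_ (Real.add_one_le_exp _)
        have : c / 8 * (1 / K * sqDist μ μ') ≤ c / 8 * ∫ x, (μ x - μ' x) ^ 2 ∂(covariateLaw h) :=
          mul_le_mul_of_nonneg_left hge (by positivity)
        linarith

/-- A selection rule: pick an index that beats every index far from it, if there is one. -/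
theorem exists_selector {ι : Type*} [Nonempty ι] (far : ι → ι → Prop) :
    ∃ sel : (ι → ι → Prop) → ι, ∀ W i, (∀ j, far i j → W i j) →
      ∀ j, far (sel W) j → W (sel W) j := by
  classical
  refine ⟨fun W => if h : ∃ i, ∀ j, far i j → W i j then h.choose else Classical.arbitrary ι,
    fun W i hi j hj => ?_⟩
  have h : ∃ i, ∀ j, far i j → W i j := ⟨i, hi⟩
  simp only [h, dite_true] at hj ⊢
  exact h.choose_spec j hj

/-- Risk bound for the estimator that selects a member of a finite net by robust tests. -/
theorem exists_estimator_risk_le {f : ℝ → ℝ} (hf : RegularDensity f) {K : ℝ} (hK : 1 < K)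
    (M a b : ℝ) (ha : 0 < a) (hb : 0 < b) : ∃ A > 0, ∃ c > 0, ∀ (n N : ℕ) (D ε : ℝ),
    0 ≤ D → ∀ (μ σ : Fin (N + 1) → (Fin d → ℝ) → ℝ), (∀ i, Admissible M a b (μ i) (σ i)) →
    ∃ est : (Fin n → (Fin d → ℝ) × ℝ) → (Fin d → ℝ) → ℝ, Measurable (Function.uncurry est) ∧
      ∀ μ₀ σ₀ h : (Fin d → ℝ) → ℝ, Admissible M a b μ₀ σ₀ → h ∈ densityClass d K →
        (∃ i, ∀ x ∈ cube d, |μ₀ x - μ i x| ≤ ε ∧ |σ₀ x - σ i x| ≤ ε) →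
        risk f μ₀ σ₀ h est ≤ ENNReal.ofReal (2 * K * (ε ^ 2 + D) +
          (2 * M) ^ 2 * ((N + 1) * Real.exp (n * (A * ε ^ 2 - c * D)))) := by
  classical
  obtain ⟨A, hA, c, hc, hratio⟩ := lintegral_modelRatio_le (d := d) hf hK M a b ha hb
  have hK0 : 0 < K := by linarith
  refine ⟨A, hA, c, hc, fun n N D ε hD μ σ hadm => ?_⟩
  -- `W i j` is the test statistic of the pair on the whole sample: a value below one means that `i`
  -- is preferred to `j`.
  set W : Fin (N + 1) → Fin (N + 1) → (Fin n → (Fin d → ℝ) × ℝ) → ℝ := fun i j S =>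
    ∏ k, modelRatio f (μ i) (σ i) (μ j) (σ j) (S k) with hW
  have hZm : ∀ i j, Measurable (modelRatio f (μ i) (σ i) (μ j) (σ j)) := fun i j =>
    measurable_modelRatio hf.measurable (hadm i).measurable_mean (hadm i).measurable_scale
      (hadm j).measurable_mean (hadm j).measurable_scale
  have hWm : ∀ i j, Measurable (W i j) := fun i j =>
    Finset.measurable_prod _ fun k _ => (hZm i j).comp (measurable_pi_apply k)
  have hZ0 : ∀ i j z, 0 ≤ modelRatio f (μ i) (σ i) (μ j) (σ j) z := fun i j z =>
    testRatio_nonneg _ _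
  have hW0 : ∀ i j S, 0 ≤ W i j S := fun i j S => Finset.prod_nonneg fun k _ => hZ0 i j _
  have hW1 : ∀ i j S, W i j S * W j i S = 1 := fun i j S => by
    simp only [hW]
    rw [← Finset.prod_mul_distrib]
    exact Finset.prod_eq_one fun k _ => testRatio_mul_testRatio
      (hf.locScale_pos _ ((hadm i).scale_pos _) _) (hf.locScale_pos _ ((hadm j).scale_pos _) _)
  obtain ⟨sel, hsel⟩ := exists_selector fun i j : Fin (N + 1) => D < sqDist (μ i) (μ j)
  set win : (Fin n → (Fin d → ℝ) × ℝ) → Fin (N + 1) → Fin (N + 1) → Prop :=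
    fun S i j => W i j S < 1 with hwin
  have hwinm : Measurable win := measurable_pi_lambda _ fun i => measurable_pi_lambda _ fun j =>
    measurableSet_setOfPred.1 (measurableSet_lt (hWm i j) measurable_const)
  refine ⟨fun S x => μ (sel (win S)) x, ?_, ?_⟩
  · have h1 : Measurable fun q : Fin (N + 1) × (Fin d → ℝ) => μ q.1 q.2 :=
      measurable_from_prod_countable_right fun i => (hadm i).measurable_mean
    -- The relations on a finite index set form a countable type, so the selection rule is
    -- measurable for free.
    have h2 : Measurable sel := measurable_of_countable sel
    exact h1.comp (((h2.comp hwinm).comp measurable_fst).prodMk measurable_snd)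
  intro μ₀ σ₀ h h₀ hh ⟨i, hi⟩
  have hprob := isProbabilityMeasure_covariateLaw hK hh
  have hobs := isProbabilityMeasure_observationLaw hf h₀.measurable_mean h₀.measurable_scale
    h₀.scale_pos (h := h)
  have hsample : IsProbabilityMeasure (sampleLaw n f μ₀ σ₀ h) := by
    unfold sampleLaw; infer_instance
  have hdiffm : ∀ j, Measurable fun x => ENNReal.ofReal ((μ₀ x - μ j x) ^ 2) := fun j =>
    ((h₀.measurable_mean.sub (hadm j).measurable_mean).pow_const 2).ennreal_ofReal
  -- the loss when the selected index is close to the reference index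
  have near : ∀ j, sqDist (μ i) (μ j) ≤ D →
      ∫⁻ x, ENNReal.ofReal ((μ₀ x - μ j x) ^ 2) ∂(covariateLaw h) ≤
        ENNReal.ofReal (2 * K * (ε ^ 2 + D)) := by
    intro j hj
    have hfin : IsFiniteMeasure ((volume : Measure (Fin d → ℝ)).restrict (cube d)) :=
      ⟨by simp [volume_cube]⟩
    have hgI : Integrable (fun x => (μ i x - μ j x) ^ 2)
        ((volume : Measure (Fin d → ℝ)).restrict (cube d)) := by
      refine Integrable.of_bound (((hadm i).measurable_mean.sub
        (hadm j).measurable_mean).pow_const 2).aestronglyMeasurable ((2 * M) ^ 2) ?_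
      filter_upwards [ae_restrict_mem (measurableSet_cube d)] with x hx
      rw [Real.norm_of_nonneg (sq_nonneg _), ← sq_abs]
      refine pow_le_pow_left₀ (abs_nonneg _) ((abs_sub _ _).trans ?_) 2
      linarith [(hadm i).abs_mean_le x hx, (hadm j).abs_mean_le x hx]
    refine (lintegral_covariateLaw_le hh (hdiffm j)).trans ?_
    rw [show 2 * K * (ε ^ 2 + D) = K * (2 * ε ^ 2 + 2 * D) by ring, ENNReal.ofReal_mul hK0.le]
    gcongr
    calc _ ≤ ∫⁻ x in cube d, ENNReal.ofReal (2 * ε ^ 2 + 2 * (μ i x - μ j x) ^ 2) := by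
          refine setLIntegral_mono' (measurableSet_cube d) fun x hx => ENNReal.ofReal_le_ofReal ?_
          have : (μ₀ x - μ i x) ^ 2 ≤ ε ^ 2 := by
            rw [← sq_abs]; exact pow_le_pow_left₀ (abs_nonneg _) (hi x hx).1 2
          nlinarith [sq_nonneg ((μ₀ x - μ i x) - (μ i x - μ j x))]
      _ = ENNReal.ofReal (∫ x in cube d, (2 * ε ^ 2 + 2 * (μ i x - μ j x) ^ 2)) := by
          have hI : Integrable (fun x => 2 * ε ^ 2 + 2 * (μ i x - μ j x) ^ 2)
              ((volume : Measure (Fin d → ℝ)).restrict (cube d)) :=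
            (integrable_const _).add (hgI.const_mul _)
          rw [ofReal_integral_eq_lintegral_ofReal hI (ae_of_all _ fun x => by positivity)]
      _ ≤ _ := by
          refine ENNReal.ofReal_le_ofReal ?_
          rw [integral_add (integrable_const _) (hgI.const_mul _),
            integral_const_mul 2 fun x => (μ i x - μ j x) ^ 2]
          have hvol : (volume : Measure (Fin d → ℝ)).real (cube d) = 1 := by
            simp [Measure.real, volume_cube]
          simp only [integral_const, measureReal_restrict_apply_univ, hvol, smul_eq_mul, one_mul]
          have : ∫ x in cube d, (μ i x - μ j x) ^ 2 ≤ D := hj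
          linarith
  -- the loss is never larger than the squared diameter
  have always : ∀ j, ∫⁻ x, ENNReal.ofReal ((μ₀ x - μ j x) ^ 2) ∂(covariateLaw h) ≤
      ENNReal.ofReal ((2 * M) ^ 2) := by
    intro j
    calc _ ≤ ∫⁻ _, ENNReal.ofReal ((2 * M) ^ 2) ∂(covariateLaw h) := by
          refine lintegral_mono_ae ?_
          filter_upwards [ae_covariateLaw_mem_cube h] with x hx
          refine ENNReal.ofReal_le_ofReal ?_
          rw [← sq_abs]
          refine pow_le_pow_left₀ (abs_nonneg _) ((abs_sub _ _).trans ?_) 2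
          linarith [h₀.abs_mean_le x hx, (hadm j).abs_mean_le x hx]
      _ = _ := by simp
  -- If the reference index beats all far indices, the selected index cannot be far from it: each
  -- would beat the other, contradicting `hW1`. Otherwise some far `j` has `W i j ≥ 1`, and the sum
  -- of the statistics dominates the indicator of this event, as in Markov's inequality.
  have loss : ∀ S, ∫⁻ x, ENNReal.ofReal ((μ₀ x - μ (sel (win S)) x) ^ 2) ∂(covariateLaw h) ≤
      ENNReal.ofReal (2 * K * (ε ^ 2 + D)) + ENNReal.ofReal ((2 * M) ^ 2) *
        ∑ j ∈ Finset.univ.filter (fun j => D < sqDist (μ i) (μ j)), ENNReal.ofReal (W i j S) := by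
    intro S
    by_cases hgood : ∀ j, D < sqDist (μ i) (μ j) → win S i j
    · refine (near _ ?_).trans le_self_add
      by_contra hfar
      rw [not_le] at hfar
      have h1 : W i (sel (win S)) S < 1 := hgood _ hfar
      have h2 : W (sel (win S)) i S < 1 := hsel (win S) i hgood i (by rwa [sqDist_comm])
      have h3 := hW1 i (sel (win S)) S
      nlinarith [hW0 i (sel (win S)) S, hW0 (sel (win S)) i S]
    · push Not at hgood
      obtain ⟨j, hj, hjw⟩ := hgood
      refine (always _).trans (le_trans ?_ le_add_self)
      refine le_mul_of_one_le_right zero_le ?_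
      have hjw' : 1 ≤ W i j S := not_lt.1 hjw
      calc (1 : ℝ≥0∞) ≤ ENNReal.ofReal (W i j S) := by
            rw [← ENNReal.ofReal_one]; exact ENNReal.ofReal_le_ofReal hjw'
        _ ≤ _ := Finset.single_le_sum (f := fun j => ENNReal.ofReal (W i j S))
            (fun _ _ => zero_le) (Finset.mem_filter.2 ⟨Finset.mem_univ j, hj⟩)
  have expW : ∀ j, D < sqDist (μ i) (μ j) →
      ∫⁻ S, ENNReal.ofReal (W i j S) ∂(sampleLaw n f μ₀ σ₀ h) ≤
        ENNReal.ofReal (Real.exp (n * (A * ε ^ 2 - c * D))) := by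
    intro j hj
    have : ∀ S, ENNReal.ofReal (W i j S) =
        ∏ k, ENNReal.ofReal (modelRatio f (μ i) (σ i) (μ j) (σ j) (S k)) := fun S =>
      ENNReal.ofReal_prod_of_nonneg fun k _ => hZ0 i j _
    simp_rw [this]
    rw [sampleLaw, lintegral_pi_prod (fun _ z => ENNReal.ofReal
      (modelRatio f (μ i) (σ i) (μ j) (σ j) z)) fun _ => (hZm i j).ennreal_ofReal,
      Finset.prod_const, Finset.card_univ, Fintype.card_fin, Real.exp_nat_mul,
      ENNReal.ofReal_pow (Real.exp_pos _).le]
    gcongr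
    refine (hratio μ₀ σ₀ _ _ _ _ h ε h₀ (hadm i) (hadm j) hh hi).trans ?_
    gcongr
  calc risk f μ₀ σ₀ h (fun S x => μ (sel (win S)) x) ≤
      ∫⁻ S, (ENNReal.ofReal (2 * K * (ε ^ 2 + D)) + ENNReal.ofReal ((2 * M) ^ 2) *
        ∑ j ∈ Finset.univ.filter (fun j => D < sqDist (μ i) (μ j)), ENNReal.ofReal (W i j S))
        ∂(sampleLaw n f μ₀ σ₀ h) := lintegral_mono loss
    _ = ENNReal.ofReal (2 * K * (ε ^ 2 + D)) + ENNReal.ofReal ((2 * M) ^ 2) *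
        ∑ j ∈ Finset.univ.filter (fun j => D < sqDist (μ i) (μ j)),
          ∫⁻ S, ENNReal.ofReal (W i j S) ∂(sampleLaw n f μ₀ σ₀ h) := by
        rw [lintegral_add_left measurable_const, lintegral_const, measure_univ, mul_one,
          lintegral_const_mul _ (Finset.measurable_sum _ fun j _ => (hWm i j).ennreal_ofReal),
          lintegral_finsetSum _ fun j _ => (hWm i j).ennreal_ofReal]
    _ ≤ ENNReal.ofReal (2 * K * (ε ^ 2 + D)) + ENNReal.ofReal ((2 * M) ^ 2) *
        ∑ _j : Fin (N + 1), ENNReal.ofReal (Real.exp (n * (A * ε ^ 2 - c * D))) := by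
        gcongr
        refine (Finset.sum_le_sum fun j hj => expW j (Finset.mem_filter.1 hj).2).trans ?_
        exact Finset.sum_le_sum_of_subset (Finset.filter_subset _ _)
    _ = _ := by
        rw [Finset.sum_const, Finset.card_univ, Fintype.card_fin, nsmul_eq_mul,
          ENNReal.ofReal_add (by positivity) (by positivity), ENNReal.ofReal_mul (sq_nonneg (2 * M)),
          ENNReal.ofReal_mul (p := (N : ℝ) + 1) (by positivity)]
        congr 3
        rw [← Nat.cast_succ, ENNReal.ofReal_natCast]

end LocationScale

namespace LocationScale

/-! ### Finite codes -/

/-- The members of `P` can be encoded by at most `N` labels such that members with the same label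
are related by `R`. -/
def Codable {Θ : Type*} (P : Θ → Prop) (R : Θ → Θ → Prop) (N : ℝ) : Prop :=
  ∃ (T : Type) (_ : Fintype T) (code : Θ → T), (Fintype.card T : ℝ) ≤ N ∧
    ∀ θ θ', P θ → P θ' → code θ = code θ' → R θ θ'

namespace Codable

variable {Θ : Type*} {P : Θ → Prop} {R R' : Θ → Θ → Prop} {N N' : ℝ}

theorem mono (h : Codable P R N) (hR : ∀ θ θ', P θ → P θ' → R θ θ' → R' θ θ') (hN : N ≤ N') :
    Codable P R' N' := by
  obtain ⟨T, _, code, hc, hcode⟩ := h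
  exact ⟨T, _, code, hc.trans hN, fun θ θ' h h' e => hR θ θ' h h' (hcode θ θ' h h' e)⟩

theorem comap {Θ' : Type*} {Q : Θ' → Prop} (h : Codable P R N) (φ : Θ' → Θ)
    (hφ : ∀ θ, Q θ → P (φ θ)) : Codable Q (fun θ θ' => R (φ θ) (φ θ')) N := by
  obtain ⟨T, _, code, hc, hcode⟩ := h
  exact ⟨T, _, code ∘ φ, hc, fun θ θ' h h' e => hcode _ _ (hφ θ h) (hφ θ' h') e⟩

theorem and (h : Codable P R N) (h' : Codable P R' N') :
    Codable P (fun θ θ' => R θ θ' ∧ R' θ θ') (N * N') := by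
  obtain ⟨T, _, code, hc, hcode⟩ := h
  obtain ⟨T', _, code', hc', hcode'⟩ := h'
  refine ⟨T × T', inferInstance, fun θ => (code θ, code' θ), ?_, fun θ θ' h h' e => ?_⟩
  · rw [Fintype.card_prod, Nat.cast_mul]
    exact mul_le_mul hc hc' (Nat.cast_nonneg _) ((Nat.cast_nonneg _).trans hc)
  · rw [Prod.mk.injEq] at e
    exact ⟨hcode _ _ h h' e.1, hcode' _ _ h h' e.2⟩

theorem pi {m : ℕ} {R : Fin m → Θ → Θ → Prop} (h : ∀ i, Codable P (R i) N) :
    Codable P (fun θ θ' => ∀ i, R i θ θ') (N ^ m) := by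
  choose T inst code hc hcode using h
  refine ⟨∀ i, T i, inferInstance, fun θ i => code i θ, ?_, fun θ θ' h h' e i =>
    hcode i _ _ h h' (congrFun e i)⟩
  rw [Fintype.card_pi, Nat.cast_prod]
  calc _ ≤ ∏ _i : Fin m, N := Finset.prod_le_prod (fun _ _ => Nat.cast_nonneg _) fun i _ => hc i
    _ = _ := by simp

/-- Bounded integers. -/
theorem of_int (v : Θ → ℤ) (W : ℕ) (hv : ∀ θ, P θ → |v θ| ≤ W) :
    Codable P (fun θ θ' => v θ = v θ') (2 * W + 1) := by
  -- After the shift by `W` the values lie in `[0, 2W]`, so the reduction modulo `2W + 1` is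
  -- injective on them.
  refine ⟨Fin (2 * W + 1), inferInstance, fun θ => Fin.ofNat _ (v θ + W).toNat, by simp,
    fun θ θ' h h' e => ?_⟩
  have b := abs_le.1 (hv θ h)
  have b' := abs_le.1 (hv θ' h')
  have := congrArg Fin.val e
  simp only [Fin.val_ofNat] at this
  rw [Nat.mod_eq_of_lt (by omega), Nat.mod_eq_of_lt (by omega)] at this
  omega

/-- Bounded reals, up to a given resolution. -/
theorem of_real (v : Θ → ℝ) {V η : ℝ} (hη : 0 < η) (hV : 0 ≤ V) (hv : ∀ θ, P θ → |v θ| ≤ V) :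
    Codable P (fun θ θ' => |v θ - v θ'| ≤ η) (2 * V / η + 5) := by
  refine (of_int (P := P) (fun θ => ⌊v θ / η⌋) (⌈V / η⌉₊ + 1) fun θ h => ?_).mono
    (fun θ θ' _ _ e => ?_) ?_
  · have h1 : |v θ / η| ≤ V / η := by
      rw [abs_div, abs_of_pos hη]
      exact div_le_div_of_nonneg_right (hv θ h) hη.le
    have h2 := Nat.le_ceil (V / η)
    have h3 := Int.floor_le (v θ / η)
    have h4 := Int.lt_floor_add_one (v θ / η)
    rw [abs_le] at h1 ⊢
    constructor
    · have : (-(⌈V / η⌉₊ + 1 : ℕ) : ℝ) - 1 < ⌊v θ / η⌋ := by push_cast; linarith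
      have : (-(⌈V / η⌉₊ + 1 : ℕ) : ℤ) - 1 < ⌊v θ / η⌋ := by exact_mod_cast this
      omega
    · have : (⌊v θ / η⌋ : ℝ) ≤ (⌈V / η⌉₊ + 1 : ℕ) := by push_cast; linarith
      exact_mod_cast this
  · have := Int.abs_sub_lt_one_of_floor_eq_floor e
    rw [← sub_div, abs_div, abs_of_pos hη, div_lt_one hη] at this
    exact this.le
  · push_cast
    have := Nat.ceil_lt_add_one (div_nonneg hV hη.le)
    have e : 2 * V / η = 2 * (V / η) := by ring
    linarith

/-- One representative is chosen in each code class that meets `P`. The net thus consists of members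
of `P`, which is what makes its elements admissible models. -/
theorem exists_net (h : Codable P R N) : ∃ (m : ℕ) (net : Fin m → Θ), (m : ℝ) ≤ N ∧
    (∀ i, P (net i)) ∧ ∀ θ, P θ → ∃ i, R θ (net i) := by
  classical
  obtain ⟨T, _, code, hc, hcode⟩ := h
  let T' := {t : T // ∃ θ, P θ ∧ code θ = t}
  have e := (Fintype.equivFin T').symm
  refine ⟨Fintype.card T', fun i => (e i).2.choose, ?_, fun i => (e i).2.choose_spec.1,
    fun θ hθ => ⟨e.symm ⟨code θ, θ, hθ, rfl⟩, ?_⟩⟩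
  · exact le_trans (by exact_mod_cast Fintype.card_subtype_le _) hc
  · refine hcode _ _ hθ (e _).2.choose_spec.1 ?_
    have := (e (e.symm ⟨code θ, θ, hθ, rfl⟩)).2.choose_spec.2
    rw [this, Equiv.apply_symm_apply]

end Codable

/-- Relations at scale `δ` that can be encoded by `exp (A / δ)` labels. -/
def ExpCodable {Θ : Type*} (P : Θ → Prop) (R : ℝ → Θ → Θ → Prop) : Prop :=
  ∃ A, 0 ≤ A ∧ ∀ δ, 0 < δ → δ ≤ 1 → Codable P (R δ) (Real.exp (A / δ))

namespace ExpCodable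

variable {Θ : Type*} {P : Θ → Prop} {R R' : ℝ → Θ → Θ → Prop}

theorem mono (h : ExpCodable P R)
    (hR : ∀ δ, 0 < δ → δ ≤ 1 → ∀ θ θ', P θ → P θ' → R δ θ θ' → R' δ θ θ') : ExpCodable P R' := by
  obtain ⟨A, hA, h⟩ := h
  exact ⟨A, hA, fun δ h0 h1 => (h δ h0 h1).mono (hR δ h0 h1) le_rfl⟩

theorem comap {Θ' : Type*} {Q : Θ' → Prop} (h : ExpCodable P R) (φ : Θ' → Θ)
    (hφ : ∀ θ, Q θ → P (φ θ)) : ExpCodable Q (fun δ θ θ' => R δ (φ θ) (φ θ')) := by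
  obtain ⟨A, hA, h⟩ := h
  exact ⟨A, hA, fun δ h0 h1 => (h δ h0 h1).comap φ hφ⟩

theorem and (h : ExpCodable P R) (h' : ExpCodable P R') :
    ExpCodable P (fun δ θ θ' => R δ θ θ' ∧ R' δ θ θ') := by
  obtain ⟨A, hA, h⟩ := h
  obtain ⟨A', hA', h'⟩ := h'
  refine ⟨A + A', add_nonneg hA hA', fun δ h0 h1 => ?_⟩
  rw [add_div, Real.exp_add]
  exact (h δ h0 h1).and (h' δ h0 h1)

theorem pi {m : ℕ} {R : Fin m → ℝ → Θ → Θ → Prop} (h : ∀ i, ExpCodable P (R i)) :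
    ExpCodable P (fun δ θ θ' => ∀ i, R i δ θ θ') := by
  choose A hA h using h
  refine ⟨m * ∑ i, A i, mul_nonneg (Nat.cast_nonneg _) (Finset.sum_nonneg fun i _ => hA i),
    fun δ h0 h1 => ?_⟩
  rw [mul_div_assoc, Real.exp_nat_mul]
  refine Codable.pi fun i => (h i δ h0 h1).mono (fun _ _ _ _ h => h) ?_
  gcongr
  exact Finset.single_le_sum (fun i _ => hA i) (Finset.mem_univ i)

end ExpCodable

/-- From `log (1 / δ) ≤ 1 / δ - 1`. It shows that a number of labels polynomial in `1 / δ` is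
negligible on the scale `exp (A / δ)`, and it also disposes of the exponential remainder in the risk
bound. -/
theorem rpow_neg_le_exp {δ q : ℝ} (h0 : 0 < δ) (hq : 0 ≤ q) : δ ^ (-q) ≤ Real.exp (q / δ) := by
  rw [Real.rpow_def_of_pos h0, Real.exp_le_exp]
  have := Real.one_sub_inv_le_log_of_pos h0
  rw [div_eq_mul_inv]
  nlinarith

theorem mul_rpow_neg_add_le_exp {δ a b q : ℝ} (h0 : 0 < δ) (h1 : δ ≤ 1) (ha : 0 ≤ a) (hb : 0 ≤ b)
    (hq : 0 ≤ q) : a * δ ^ (-q) + b ≤ Real.exp ((a + b + q) / δ) := by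
  have h2 : 1 ≤ δ ^ (-q) := Real.one_le_rpow_of_pos_of_le_one_of_nonpos h0 h1 (by linarith)
  have h3 := rpow_neg_le_exp h0 hq
  have h4 : a + b ≤ Real.exp ((a + b) / δ) := by
    have h5 := Real.add_one_le_exp ((a + b) / δ)
    have h6 : a + b ≤ (a + b) / δ := le_div_self (by positivity) h0 h1
    linarith
  calc a * δ ^ (-q) + b ≤ (a + b) * δ ^ (-q) := by nlinarith
    _ ≤ Real.exp ((a + b) / δ) * Real.exp (q / δ) :=
        mul_le_mul h4 h3 (by positivity) (Real.exp_pos _).le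
    _ = _ := by rw [← Real.exp_add, ← add_div]

theorem ExpCodable.of_real {Θ : Type*} {P : Θ → Prop} (v : Θ → ℝ) {V k q : ℝ} (hk : 0 < k)
    (hq : 0 ≤ q) (hV : 0 ≤ V) (hv : ∀ θ, P θ → |v θ| ≤ V) :
    ExpCodable P (fun δ θ θ' => |v θ - v θ'| ≤ k * δ ^ q) := by
  refine ⟨2 * V / k + 5 + q, by positivity, fun δ h0 h1 => ?_⟩
  refine (Codable.of_real v (η := k * δ ^ q) (by positivity) hV hv).mono (fun _ _ _ _ h => h) ?_
  have := mul_rpow_neg_add_le_exp (a := 2 * V / k) (b := 5) (q := q) h0 h1 (by positivity)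
    (by norm_num) hq
  rw [Real.rpow_neg h0.le] at this
  refine le_trans (le_of_eq ?_) this
  field_simp

/-! ### Metric entropy of the Hölder class -/

/-- Induction on `s`: the derivative of a Taylor remainder is the remainder of one order less for
the derivative, and the mean value inequality adds one power of `r`. The derivatives form an
abstract sequence `D` so that the induction can shift it. -/
theorem taylor_holder {s : ℕ} {γ L : ℝ} (hγ : 0 < γ) (hL : 0 ≤ L) {D : ℕ → ℝ → ℝ}
    (hD : ∀ k < s, ∀ t, HasDerivAt (D k) (D (k + 1) t) t)
    (hH : ∀ t u, |D s t - D s u| ≤ L * |t - u| ^ γ) (t₀ : ℝ) {r : ℝ} (hr : 0 ≤ r) :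
    |D 0 (t₀ + r) - ∑ i ∈ Finset.range (s + 1), D i t₀ * (r ^ i / i.factorial)| ≤
      L * r ^ (s + γ) := by
  induction s generalizing D r with
  | zero =>
    simpa [abs_of_nonneg hr] using hH (t₀ + r) t₀
  | succ s ih =>
    have ih' := fun r hr => ih (D := fun k => D (k + 1)) (r := r)
      (fun k hk t => hD (k + 1) (by omega) t) hH hr
    have hder : ∀ t, HasDerivAt
        (fun t => D 0 (t₀ + t) - ∑ i ∈ Finset.range (s + 2), D i t₀ * (t ^ i / i.factorial))
        (D 1 (t₀ + t) - ∑ i ∈ Finset.range (s + 1), D (i + 1) t₀ * (t ^ i / i.factorial)) t := by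
      intro t
      refine ((hD 0 (by omega) (t₀ + t)).comp_const_add t₀ t).sub ?_
      have e : (fun t => ∑ i ∈ Finset.range (s + 2), D i t₀ * (t ^ i / (i.factorial : ℝ))) =
          fun t => ∑ i ∈ Finset.range (s + 1),
            D (i + 1) t₀ * (t ^ (i + 1) / ((i + 1).factorial : ℝ)) + D 0 t₀ := by
        ext t
        rw [Finset.sum_range_succ']
        simp
      rw [e]
      refine HasDerivAt.add_const _ (HasDerivAt.fun_sum fun i _ => ?_)
      refine HasDerivAt.const_mul _ (((hasDerivAt_pow (i + 1) t).div_const _).congr_deriv ?_)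
      rw [Nat.factorial_succ]
      push_cast
      have : ((i.factorial : ℕ) : ℝ) ≠ 0 := by positivity
      field_simp
    have := norm_image_sub_le_of_norm_deriv_le_segment' (a := 0) (b := r)
      (C := L * r ^ (s + γ)) (fun t _ => (hder t).hasDerivWithinAt) (fun t ht => by
        refine (ih' t ht.1).trans ?_
        have := ht.1
        have := ht.2.le
        gcongr) r ⟨hr, le_rfl⟩
    have e0 : D 0 (t₀ + 0) - ∑ i ∈ Finset.range (s + 2), D i t₀ * ((0 : ℝ) ^ i / i.factorial) = 0 := by
      rw [Finset.sum_range_succ']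
      simp
    rw [e0, sub_zero, sub_zero, Real.norm_eq_abs] at this
    refine this.trans (le_of_eq ?_)
    rw [mul_assoc]
    congr 1
    rcases hr.eq_or_lt with rfl | hr
    · rw [mul_zero, Real.zero_rpow (by positivity)]
    · rw [← Real.rpow_add_one hr.ne']
      congr 1
      push_cast
      ring

theorem hasDerivAt_iteratedDeriv {s : ℕ} {g : ℝ → ℝ} (hg : ContDiff ℝ s g) {k : ℕ} (hk : k < s)
    (t : ℝ) : HasDerivAt (iteratedDeriv k g) (iteratedDeriv (k + 1) g t) t := by
  rw [iteratedDeriv_succ]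
  exact (hg.differentiable_iteratedDeriv k (by exact_mod_cast hk) t).hasDerivAt

/-- Taylor expansion of the derivatives of a member of the Hölder class. -/
theorem holderClass_taylor {s : ℕ} {γ L : ℝ} (hγ : 0 < γ) (hL : 0 ≤ L) {B : ℕ → ℝ} {g : ℝ → ℝ}
    (hg : g ∈ holderClass s γ L B) {k : ℕ} (hk : k ≤ s) (t₀ : ℝ) {r : ℝ} (hr : 0 ≤ r) :
    |iteratedDeriv k g (t₀ + r) - ∑ i ∈ Finset.range (s - k + 1),
      iteratedDeriv (k + i) g t₀ * (r ^ i / i.factorial)| ≤ L * r ^ ((s : ℝ) - k + γ) := by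
  have := taylor_holder (s := s - k) hγ hL (D := fun i => iteratedDeriv (k + i) g)
    (fun i hi t => hasDerivAt_iteratedDeriv hg.1 (by omega) t)
    (by rw [Nat.add_sub_cancel' hk]; exact hg.2.1) t₀ hr
  rwa [Nat.cast_sub hk] at this

/-- If a vector recursion holds up to a bounded error, the integer parts along the recursion can be
encoded with a bounded number of labels per step. -/
theorem codable_recursion {Θ : Type*} {P : Θ → Prop} {s m W : ℕ} {N : ℝ} {A : ℝ}
    (u : Θ → ℕ → ℕ → ℝ) (hW : A + s + 3 ≤ W)
    (h0 : ∀ k : Fin (s + 1), Codable P (fun θ θ' => ⌊u θ 0 k⌋ = ⌊u θ' 0 k⌋) N)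
    (hrec : ∀ θ, P θ → ∀ j, ∀ k ≤ s, |u θ (j + 1) k - ∑ i ∈ Finset.range (s - k + 1),
      u θ j (k + i) * ((i.factorial : ℝ))⁻¹| ≤ A) :
    Codable P (fun θ θ' => ∀ j ≤ m, ∀ k ≤ s, ⌊u θ j k⌋ = ⌊u θ' j k⌋)
      (N ^ (s + 1) * ((2 * W + 1) ^ (s + 1)) ^ m) := by
  -- The next integer part is predicted from the current ones. Only the deviation from the
  -- prediction is coded: it is bounded by `A` from the recursion, `s + 1` from rounding the terms,
  -- and less than `1` from the final integer parts.
  set pred : Θ → ℕ → ℕ → ℤ := fun θ j k =>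
    ⌊∑ i ∈ Finset.range (s - k + 1), (⌊u θ j (k + i)⌋ : ℝ) * ((i.factorial : ℝ))⁻¹⌋ with hpred
  have step : ∀ (j : Fin m) (k : Fin (s + 1)), Codable P (fun θ θ' =>
      ⌊u θ (j + 1) k⌋ - pred θ j k = ⌊u θ' (j + 1) k⌋ - pred θ' j k) (2 * W + 1) := by
    intro j k
    refine Codable.of_int _ W fun θ hθ => ?_
    have hk : (k : ℕ) ≤ s := by omega
    have h1 := hrec θ hθ j k hk
    have h2 : |∑ i ∈ Finset.range (s - k + 1), u θ j (k + i) * ((i.factorial : ℝ))⁻¹ -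
        ∑ i ∈ Finset.range (s - k + 1), (⌊u θ j (k + i)⌋ : ℝ) * ((i.factorial : ℝ))⁻¹| ≤ s + 1 := by
      rw [← Finset.sum_sub_distrib]
      refine (Finset.abs_sum_le_sum_abs _ _).trans ?_
      calc _ ≤ ∑ _i ∈ Finset.range (s - k + 1), (1 : ℝ) := by
            refine Finset.sum_le_sum fun i _ => ?_
            rw [← sub_mul, abs_mul]
            have a1 : |u θ j (k + i) - ⌊u θ j (k + i)⌋| ≤ 1 := by
              rw [abs_le]
              constructor <;> linarith [Int.floor_le (u θ j (k + i)),
                Int.lt_floor_add_one (u θ j (k + i))]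
            have a2 : |((i.factorial : ℝ))⁻¹| ≤ 1 := by
              rw [abs_of_nonneg (by positivity)]
              exact inv_le_one_of_one_le₀ (Nat.one_le_cast.2 (Nat.factorial_pos i))
            exact mul_le_one₀ a1 (abs_nonneg _) a2
        _ ≤ _ := by
            simp only [Finset.sum_const, Finset.card_range, nsmul_eq_mul, mul_one]
            push_cast
            have : ((s - k : ℕ) : ℝ) ≤ s := by exact_mod_cast Nat.sub_le _ _
            linarith
    have h3 := Int.floor_le (u θ (j + 1) k)
    have h4 := Int.lt_floor_add_one (u θ (j + 1) k)
    have h5 := Int.floor_le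
      (∑ i ∈ Finset.range (s - k + 1), (⌊u θ j (k + i)⌋ : ℝ) * ((i.factorial : ℝ))⁻¹)
    have h6 := Int.lt_floor_add_one
      (∑ i ∈ Finset.range (s - k + 1), (⌊u θ j (k + i)⌋ : ℝ) * ((i.factorial : ℝ))⁻¹)
    rw [abs_le] at h1 h2
    have : |((⌊u θ (j + 1) k⌋ - pred θ j k : ℤ) : ℝ)| ≤ W := by
      rw [abs_le]
      simp only [hpred]
      push_cast
      constructor <;> linarith [h1.1, h1.2, h2.1, h2.2]
    exact_mod_cast this
  refine ((Codable.pi h0).and (Codable.pi fun j => Codable.pi fun k => step j k)).mono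
    (fun θ θ' _ _ h => ?_) le_rfl
  intro j
  induction j with
  | zero => exact fun _ k hk => h.1 ⟨k, by omega⟩
  | succ j ih =>
    intro hj k hk
    have e := h.2 ⟨j, by omega⟩ ⟨k, by omega⟩
    have : pred θ j k = pred θ' j k := by
      simp only [hpred]
      congr 1
      refine Finset.sum_congr rfl fun i hi => ?_
      rw [ih (by omega) (k + i) (by have := Finset.mem_range.1 hi; omega)]
    simp only [this] at e
    omega

/-- The Kolmogorov-Tikhomirov argument. Derivatives up to order `s` are rounded on a grid of step
`δ`. Taylor's formula predicts the data at one grid point from those at the previous one, so each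
point needs a bounded number of labels. Coding the points independently would cost an extra factor
`log (1 / δ)` in the exponent. -/
theorem expCodable_holderClass {s : ℕ} {γ L : ℝ} (hγ : 0 < γ) (hL : 0 < L) {B : ℕ → ℝ}
    (hB : ∀ k ≤ s, 0 < B k) {T : ℝ} (hT : 0 ≤ T) :
    ExpCodable (fun g => g ∈ holderClass s γ L B)
      (fun δ g g' => ∀ z, |z| ≤ T → |g z - g' z| ≤ (s + 1 + 2 * L) * δ ^ (s + γ)) := by
  set Bm := ∑ k ∈ Finset.range (s + 1), B k with hBm
  have hBk : ∀ k ≤ s, B k ≤ Bm := fun k hk => Finset.single_le_sum (f := B)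
    (fun i hi => (hB i (by have := Finset.mem_range.1 hi; omega)).le)
    (Finset.mem_range.2 (by omega))
  have hBm0 : 0 ≤ Bm := (hB 0 (by omega)).le.trans (hBk 0 (by omega))
  set W : ℕ := ⌈L⌉₊ + s + 3 with hW
  set q : ℝ := s + γ with hq
  have hq0 : 0 < q := by positivity
  set A₀ := 2 * Bm + 5 + q with hA₀
  have hlogW : 0 ≤ Real.log (2 * W + 1) := Real.log_nonneg (by
    have : (0 : ℝ) ≤ W := Nat.cast_nonneg _
    linarith)
  refine ⟨(s + 1 : ℕ) * A₀ + (2 * T + 1) * ((s + 1 : ℕ) * Real.log (2 * W + 1)), by positivity,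
    fun δ h0 h1 => ?_⟩
  -- The `k`-th derivative is resolved to `δ ^ (q - k)`. In these units the step `δ` drops out of
  -- the Taylor recursion: its coefficients become `1 / i!` and its error becomes `L`.
  set e : ℕ → ℝ := fun k => δ ^ (q - k) with he
  have he0 : ∀ k, 0 < e k := fun k => Real.rpow_pos_of_pos h0 _
  have hei : ∀ k i, e (k + i) * δ ^ i = e k := fun k i => by
    simp only [he]
    rw [← Real.rpow_natCast, ← Real.rpow_add h0]
    congr 1
    push_cast
    ring
  set m := ⌈2 * T / δ⌉₊ with hm
  set u : (ℝ → ℝ) → ℕ → ℕ → ℝ := fun g j k => iteratedDeriv k g (-T + j * δ) / e k with hu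
  have hcode := codable_recursion (P := fun g => g ∈ holderClass s γ L B) (s := s) (m := m) (W := W)
    (N := Real.exp (A₀ / δ)) (A := L) u
    (by rw [hW]; push_cast; linarith [Nat.le_ceil L]) ?_ ?_
  · refine hcode.mono (fun g g' hg hg' h z hz => ?_) ?_
    -- Both functions are expanded at the grid point to the left of `z`. Their two remainders give
    -- `2 * L`, and each of the `s + 1` rounded derivatives contributes at most one `δ ^ q`.
    · set j := ⌊(z + T) / δ⌋₊ with hj
      have hz' := abs_le.1 hz
      have hzT : 0 ≤ (z + T) / δ := div_nonneg (by linarith) h0.le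
      have hjm : j ≤ m := by
        refine (Nat.floor_le_floor ?_).trans (Nat.floor_le_ceil (2 * T / δ))
        gcongr
        linarith
      set t := -T + j * δ with ht
      have hj1 := Nat.floor_le hzT
      have hj2 := Nat.lt_floor_add_one ((z + T) / δ)
      rw [le_div_iff₀ h0] at hj1
      rw [div_lt_iff₀ h0] at hj2
      have hr0 : 0 ≤ z - t := by rw [ht]; linarith
      have hr1 : z - t ≤ δ := by rw [ht]; linarith
      have t1 := holderClass_taylor hγ hL.le hg (Nat.zero_le s) t hr0
      have t2 := holderClass_taylor hγ hL.le hg' (Nat.zero_le s) t hr0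
      simp only [iteratedDeriv_zero, add_sub_cancel, Nat.cast_zero, sub_zero, Nat.sub_zero,
        zero_add] at t1 t2
      have hrq : L * (z - t) ^ q ≤ L * δ ^ q := by gcongr
      have hsum : |∑ i ∈ Finset.range (s + 1), iteratedDeriv i g t * ((z - t) ^ i / i.factorial) -
          ∑ i ∈ Finset.range (s + 1), iteratedDeriv i g' t * ((z - t) ^ i / i.factorial)| ≤
          (s + 1) * δ ^ q := by
        rw [← Finset.sum_sub_distrib]
        refine (Finset.abs_sum_le_sum_abs _ _).trans ?_
        calc _ ≤ ∑ _i ∈ Finset.range (s + 1), δ ^ q := by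
              refine Finset.sum_le_sum fun i hi => ?_
              have hi' : i ≤ s := by have := Finset.mem_range.1 hi; omega
              have hfl := Int.abs_sub_lt_one_of_floor_eq_floor (h j hjm i hi')
              simp only [hu] at hfl
              rw [← sub_div, abs_div, abs_of_pos (he0 i), div_lt_one (he0 i)] at hfl
              rw [← sub_mul, abs_mul, abs_of_nonneg (a := (z - t) ^ i / _) (by positivity)]
              have hfac : (1 : ℝ) ≤ i.factorial :=
                Nat.one_le_cast.2 (Nat.factorial_pos i)
              calc _ ≤ e i * δ ^ i := by
                    refine mul_le_mul hfl.le ?_ (by positivity) (he0 i).le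
                    exact (div_le_self (by positivity) hfac).trans (by gcongr)
                _ = δ ^ q := by
                    have := hei 0 i
                    rw [zero_add] at this
                    rw [this]
                    simp [he]
          _ = _ := by simp
      calc |g z - g' z| = |(g z - ∑ i ∈ Finset.range (s + 1),
            iteratedDeriv i g t * ((z - t) ^ i / i.factorial)) -
            (g' z - ∑ i ∈ Finset.range (s + 1),
              iteratedDeriv i g' t * ((z - t) ^ i / i.factorial)) +
            (∑ i ∈ Finset.range (s + 1), iteratedDeriv i g t * ((z - t) ^ i / i.factorial) -
            ∑ i ∈ Finset.range (s + 1),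
              iteratedDeriv i g' t * ((z - t) ^ i / i.factorial))| := by ring_nf
        _ ≤ (L * (z - t) ^ q + L * (z - t) ^ q) + (s + 1) * δ ^ q :=
            (abs_add_le _ _).trans (add_le_add ((abs_sub _ _).trans (add_le_add t1 t2)) hsum)
        _ ≤ _ := by linarith
    · rw [add_div (_ * A₀), Real.exp_add, mul_div_assoc, Real.exp_nat_mul]
      gcongr
      have hmle : (m : ℝ) ≤ (2 * T + 1) / δ := by
        have h2 := Nat.ceil_lt_add_one (div_nonneg (mul_nonneg zero_le_two hT) h0.le)
        have h3 : 1 ≤ 1 / δ := (one_le_div h0).2 h1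
        rw [add_div]
        linarith
      have hW1 : (0 : ℝ) < 2 * W + 1 := by positivity
      rw [← pow_mul, ← Real.rpow_natCast, Real.rpow_def_of_pos hW1, Real.exp_le_exp]
      push_cast
      calc _ = m * ((s + 1) * Real.log (2 * W + 1)) := by ring
        _ ≤ (2 * T + 1) / δ * ((s + 1) * Real.log (2 * W + 1)) := by gcongr
        _ = _ := by ring
  · intro k
    have hk : (k : ℕ) ≤ s := by omega
    -- At the first grid point nothing can be predicted; the bounds on the derivatives give
    -- polynomially many values.
    refine (Codable.of_int (P := fun g => g ∈ holderClass s γ L B) _ (⌈Bm * δ ^ (-q)⌉₊ + 1)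
      fun g hg => ?_).mono (fun _ _ _ _ h => h) ?_
    · have hb : |u g 0 k| ≤ Bm * δ ^ (-q) := by
        simp only [hu]
        rw [abs_div, abs_of_pos (he0 k), div_eq_mul_inv]
        refine mul_le_mul ((hg.2.2 k hk _).trans (hBk k hk)) ?_ (inv_nonneg.2 (he0 k).le) hBm0
        simp only [he]
        rw [← Real.rpow_neg h0.le]
        refine Real.rpow_le_rpow_of_exponent_ge h0 h1 ?_
        have : (0 : ℝ) ≤ (k : ℕ) := Nat.cast_nonneg _
        linarith
      have h2 := Nat.le_ceil (Bm * δ ^ (-q))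
      have h3 := Int.floor_le (u g 0 k)
      have h4 := Int.lt_floor_add_one (u g 0 k)
      rw [abs_le] at hb
      have : |((⌊u g 0 k⌋ : ℤ) : ℝ)| ≤ (⌈Bm * δ ^ (-q)⌉₊ + 1 : ℕ) := by
        rw [abs_le]
        push_cast
        constructor <;> linarith [hb.1, hb.2]
      exact_mod_cast this
    · refine le_trans ?_ (mul_rpow_neg_add_le_exp (a := 2 * Bm) (b := 5) (q := q) h0 h1
        (by positivity) (by norm_num) hq0.le)
      push_cast
      have := Nat.ceil_lt_add_one (mul_nonneg hBm0 (Real.rpow_nonneg h0.le (-q)))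
      linarith
  · intro g hg j k hk
    have ht := holderClass_taylor hγ hL.le hg hk (-T + j * δ) h0.le
    have e1 : u g (j + 1) k - ∑ i ∈ Finset.range (s - k + 1), u g j (k + i) * ((i.factorial : ℝ))⁻¹ =
        (iteratedDeriv k g (-T + j * δ + δ) - ∑ i ∈ Finset.range (s - k + 1),
          iteratedDeriv (k + i) g (-T + j * δ) * (δ ^ i / i.factorial)) / e k := by
      rw [sub_div, Finset.sum_div]
      congr 1
      · simp only [hu]
        push_cast
        ring_nf
      · refine Finset.sum_congr rfl fun i _ => ?_
        simp only [hu]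
        rw [← hei k i]
        have := (he0 (k + i)).ne'
        have : δ ^ i ≠ 0 := by positivity
        have : ((i.factorial : ℕ) : ℝ) ≠ 0 := by positivity
        field_simp
    rw [e1, abs_div, abs_of_pos (he0 k), div_le_iff₀ (he0 k)]
    refine ht.trans (le_of_eq ?_)
    simp only [he, hq]
    ring_nf

end LocationScale

namespace LocationScale

/-! ### Finite nets for the regression models -/

/-- For `s ≥ 1` the functions are even Lipschitz, but the weaker exponent `γ` covers the case `s =
0` too and gives one rule for the accuracy required of the directions. -/
theorem holderClass_modulus {s : ℕ} {γ L : ℝ} (hγ₁ : γ ≤ 1) (hL : 0 < L) {B : ℕ → ℝ}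
    (hB : ∀ k ≤ s, 0 < B k) : ∃ A ≥ 0, ∀ g ∈ holderClass s γ L B, ∀ z z', |z - z'| ≤ 1 →
      |g z - g z'| ≤ A * |z - z'| ^ γ := by
  rcases Nat.eq_zero_or_pos s with rfl | hs
  · exact ⟨L, hL.le, fun g hg z z' _ => by simpa using hg.2.1 z z'⟩
  · refine ⟨B 1, (hB 1 hs).le, fun g hg z z' hz => ?_⟩
    have h1 : |g z - g z'| ≤ B 1 * |z - z'| := by
      have := Convex.norm_image_sub_le_of_norm_deriv_le (f := g) (s := univ) (C := B 1)
        (fun x _ => hg.1.differentiable (by exact_mod_cast hs.ne') x)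
        (fun x _ => by simpa [iteratedDeriv_one] using hg.2.2 1 hs x) convex_univ
        (mem_univ z') (mem_univ z)
      simpa [Real.norm_eq_abs] using this
    refine h1.trans (mul_le_mul_of_nonneg_left ?_ (hB 1 hs).le)
    rcases (abs_nonneg (z - z')).eq_or_lt with h0 | h0
    · rw [← h0]
      exact Real.rpow_nonneg le_rfl _
    · simpa using Real.rpow_le_rpow_of_exponent_ge h0 hz hγ₁

theorem abs_sum_mul_le {d : ℕ} {b x : Fin d → ℝ} {η : ℝ} (hb : ∀ j, |b j| ≤ η)
    (hx : x ∈ cube d) : |∑ j, b j * x j| ≤ d * η := by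
  refine (Finset.abs_sum_le_sum_abs _ _).trans ?_
  calc _ ≤ ∑ _j : Fin d, η := by
        refine Finset.sum_le_sum fun j _ => ?_
        rw [abs_mul, abs_of_nonneg (hx.1 j)]
        exact (mul_le_of_le_one_right (abs_nonneg _) (hx.2 j)).trans (hb j)
    _ = _ := by simp

theorem abs_exp_sub_exp_le {a b c : ℝ} (ha : a ≤ c) (hb : b ≤ c) :
    |Real.exp a - Real.exp b| ≤ Real.exp c * |a - b| := by
  wlog h : b ≤ a generalizing a b
  · rw [abs_sub_comm, abs_sub_comm a]
    exact this hb ha (le_of_not_ge h)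
  rw [abs_of_nonneg (sub_nonneg.2 (Real.exp_le_exp.2 h)), abs_of_nonneg (sub_nonneg.2 h)]
  have h1 := Real.add_one_le_exp (b - a)
  have e : Real.exp b = Real.exp a * Real.exp (b - a) := by rw [← Real.exp_add]; ring_nf
  calc Real.exp a - Real.exp b = Real.exp a * (1 - Real.exp (b - a)) := by rw [e]; ring
    _ ≤ Real.exp a * (a - b) := mul_le_mul_of_nonneg_left (by linarith) (Real.exp_pos a).le
    _ ≤ _ := by
        have : 0 ≤ a - b := sub_nonneg.2 h
        gcongr

/-- Parameters of a regression model: profiles, directions and log-scale coefficients. -/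
abbrev ModelParam (d p : ℕ) :=
  (Fin p → ℝ → ℝ) × (Fin p → EuclideanSpace ℝ (Fin d)) × (Fin d → ℝ)

namespace ModelParam

variable {d p : ℕ}

/-- The regression function of a model. -/
def mean (θ : ModelParam d p) (x : Fin d → ℝ) : ℝ := ∑ i, θ.1 i (∑ j, θ.2.1 i j * x j)

/-- The scale function of a model. -/
def scale (θ : ModelParam d p) (x : Fin d → ℝ) : ℝ := Real.exp (∑ i, θ.2.2 i * x i)

/-- The parameters that satisfy the constraints of the model classes. -/
def Valid (s : ℕ) (γ L : ℝ) (B : ℕ → ℝ) (C : ℝ) (θ : ModelParam d p) : Prop :=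
  (∀ i, θ.1 i ∈ holderClass s γ L B) ∧ (∀ i, ‖θ.2.1 i‖ = 1) ∧ ∀ i, |θ.2.2 i| ≤ C

variable {s : ℕ} {γ L : ℝ} {B : ℕ → ℝ} {C : ℝ} {θ : ModelParam d p}

theorem Valid.abs_direction_le (hθ : θ.Valid s γ L B C) (i : Fin p) (j : Fin d) :
    |θ.2.1 i j| ≤ 1 := by
  have := PiLp.norm_apply_le (θ.2.1 i) j
  rwa [hθ.2.1 i, Real.norm_eq_abs] at this

theorem Valid.admissible (hθ : θ.Valid s γ L B C) :
    Admissible (p * B 0) (Real.exp (-(d * C))) (Real.exp (d * C)) θ.mean θ.scale where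
  measurable_mean := by
    have : ∀ i, Measurable (θ.1 i) := fun i => (hθ.1 i).1.continuous.measurable
    unfold mean
    fun_prop
  measurable_scale := by
    unfold scale
    fun_prop
  scale_pos x := Real.exp_pos _
  abs_mean_le x _ := by
    refine (Finset.abs_sum_le_sum_abs _ _).trans ?_
    calc _ ≤ ∑ _i : Fin p, B 0 := Finset.sum_le_sum fun i _ => by
          simpa using (hθ.1 i).2.2 0 (Nat.zero_le s) _
      _ = _ := by simp
  scale_mem x hx := by
    have := abs_le.1 (abs_sum_mul_le hθ.2.2 hx)
    exact ⟨Real.exp_le_exp.2 this.1, Real.exp_le_exp.2 this.2⟩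

/-- Profiles are coded on `[-d, d]`, which contains every projection of the cube on a unit
direction. Directions need the finer accuracy `δ ^ (α / γ)` because a profile may turn an error `η`
in its argument into `η ^ γ`; this still costs only polynomially many labels. -/
theorem expCodable_valid (hγ₀ : 0 < γ) (hγ₁ : γ ≤ 1) (hL : 0 < L) (hB : ∀ k ≤ s, 0 < B k)
    (hC : 0 ≤ C) (hd : 1 ≤ d) : ∃ A ≥ 0, ExpCodable (fun θ : ModelParam d p => θ.Valid s γ L B C)
      fun δ θ θ' => ∀ x ∈ cube d, |θ.mean x - θ'.mean x| ≤ A * δ ^ (s + γ) ∧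
        |θ.scale x - θ'.scale x| ≤ A * δ ^ (s + γ) := by
  obtain ⟨A, hA, hmod⟩ := holderClass_modulus hγ₁ hL hB
  have hd0 : (0 : ℝ) < d := by exact_mod_cast hd
  have hα : 0 < s + γ := by positivity
  have c1 : ExpCodable (fun θ : ModelParam d p => θ.Valid s γ L B C) fun δ θ θ' => ∀ i : Fin p,
      ∀ z : ℝ, |z| ≤ d → |θ.1 i z - θ'.1 i z| ≤ (s + 1 + 2 * L) * δ ^ (s + γ) :=
    ExpCodable.pi fun i => (expCodable_holderClass hγ₀ hL hB hd0.le).comap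
      (Q := fun θ : ModelParam d p => θ.Valid s γ L B C) (fun θ => θ.1 i) fun θ hθ => hθ.1 i
  have c2 : ExpCodable (fun θ : ModelParam d p => θ.Valid s γ L B C) fun δ θ θ' => ∀ (i : Fin p)
      (j : Fin d), |θ.2.1 i j - θ'.2.1 i j| ≤ 1 / d * δ ^ ((s + γ) / γ) :=
    ExpCodable.pi fun i => ExpCodable.pi fun j => ExpCodable.of_real
      (P := fun θ : ModelParam d p => θ.Valid s γ L B C) (fun θ => θ.2.1 i j)
      (by positivity) (by positivity) zero_le_one fun θ hθ => hθ.abs_direction_le i j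
  have c3 : ExpCodable (fun θ : ModelParam d p => θ.Valid s γ L B C) fun δ θ θ' => ∀ i : Fin d,
      |θ.2.2 i - θ'.2.2 i| ≤ 1 / d * δ ^ (s + γ) :=
    ExpCodable.pi fun i => ExpCodable.of_real
      (P := fun θ : ModelParam d p => θ.Valid s γ L B C) (fun θ => θ.2.2 i) (by positivity) hα.le hC
      fun θ hθ => hθ.2.2 i
  refine ⟨p * (s + 1 + 2 * L + A) + Real.exp (d * C), by positivity,
    (c1.and (c2.and c3)).mono fun δ h0 h1 θ θ' hθ hθ' ⟨r1, r2, r3⟩ x hx => ⟨?_, ?_⟩⟩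
  · have hδ : 0 ≤ δ ^ (s + γ) := by positivity
    have term : ∀ i, |θ.1 i (∑ j, θ.2.1 i j * x j) - θ'.1 i (∑ j, θ'.2.1 i j * x j)| ≤
        (s + 1 + 2 * L + A) * δ ^ (s + γ) := by
      intro i
      have b1 := r1 i (∑ j, θ.2.1 i j * x j)
        (by simpa using abs_sum_mul_le (hθ.abs_direction_le i) hx)
      have hz : |∑ j, θ.2.1 i j * x j - ∑ j, θ'.2.1 i j * x j| ≤ δ ^ ((s + γ) / γ) := by
        rw [← Finset.sum_sub_distrib]
        simp_rw [← sub_mul]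
        refine (abs_sum_mul_le (r2 i) hx).trans (le_of_eq ?_)
        field_simp
      have b2 := hmod _ (hθ'.1 i) _ _ (hz.trans (Real.rpow_le_one h0.le h1 (by positivity)))
      have b3 : A * |∑ j, θ.2.1 i j * x j - ∑ j, θ'.2.1 i j * x j| ^ γ ≤ A * δ ^ (s + γ) := by
        refine mul_le_mul_of_nonneg_left ?_ hA
        calc _ ≤ (δ ^ ((s + γ) / γ)) ^ γ := Real.rpow_le_rpow (abs_nonneg _) hz hγ₀.le
          _ = _ := by
              rw [← Real.rpow_mul h0.le]
              congr 1
              field_simp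
      calc _ ≤ |θ.1 i (∑ j, θ.2.1 i j * x j) - θ'.1 i (∑ j, θ.2.1 i j * x j)| +
            |θ'.1 i (∑ j, θ.2.1 i j * x j) - θ'.1 i (∑ j, θ'.2.1 i j * x j)| := abs_sub_le _ _ _
        _ ≤ _ := by linarith
    have hexp := Real.exp_pos (d * C)
    unfold mean
    rw [← Finset.sum_sub_distrib]
    refine (Finset.abs_sum_le_sum_abs _ _).trans ((Finset.sum_le_sum fun i _ => term i).trans ?_)
    simp only [Finset.sum_const, Finset.card_univ, Fintype.card_fin, nsmul_eq_mul]
    rw [← mul_assoc]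
    gcongr
    linarith
  · have b := abs_exp_sub_exp_le (abs_le.1 (abs_sum_mul_le hθ.2.2 hx)).2
      (abs_le.1 (abs_sum_mul_le hθ'.2.2 hx)).2
    refine b.trans ?_
    have hz : |∑ j, θ.2.2 j * x j - ∑ j, θ'.2.2 j * x j| ≤ δ ^ (s + γ) := by
      rw [← Finset.sum_sub_distrib]
      simp_rw [← sub_mul]
      refine (abs_sum_mul_le r3 hx).trans (le_of_eq ?_)
      field_simp
    gcongr
    have : 0 ≤ p * (s + 1 + 2 * L + A) := by positivity
    linarith

end ModelParam

/-! ### The upper bound -/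

/-- The approximation error `ε²` and the separation threshold `D` are both of order `δ ^ (2α)`,
while the number of competitors is `exp (A₂ / δ)` and `n δ ^ (2α) = 1 / δ`. -/
theorem minimaxRisk_le {f : ℝ → ℝ} (hf : RegularDensity f) {d p : ℕ} (hd : 1 ≤ d) {s : ℕ}
    {γ : ℝ} (hγ₀ : 0 < γ) (hγ₁ : γ ≤ 1) {L : ℝ} (hL : 0 < L) {B : ℕ → ℝ}
    (hB : ∀ k ≤ s, 0 < B k) {K : ℝ} (hK : 1 < K) {C : ℝ} (hC : 0 ≤ C) :
    ∃ c₂ > 0, ∀ n : ℕ, 1 ≤ n →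
      minimaxRisk n f (multipleIndexClass d p s γ L B) (scaleClass d C) (densityClass d K) ≤
        ENNReal.ofReal (c₂ * (n : ℝ) ^ (-(2 * (s + γ)) / (2 * (s + γ) + 1))) := by
  set α : ℝ := s + γ with hα
  have hα0 : 0 < α := by positivity
  obtain ⟨A₁, hA₁, A₂, hA₂, hcode⟩ :=
    ModelParam.expCodable_valid (p := p) hγ₀ hγ₁ hL hB hC hd
  rw [← hα] at hcode
  obtain ⟨A, hA, c, hc, hest⟩ := exists_estimator_risk_le (d := d) hf hK (p * B 0)
    (Real.exp (-(d * C))) (Real.exp (d * C)) (Real.exp_pos _) (Real.exp_pos _)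
  have hK0 : 0 < K := by linarith
  -- The threshold must outweigh the net size (`A₂`) and the approximation error (`A * A₁ ^ 2`), and
  -- leave `exp (-2α / δ) ≤ δ ^ (2α)`.
  set κ := (A₂ + A * A₁ ^ 2 + 2 * α) / c with hκ
  have hκ0 : 0 < κ := by positivity
  refine ⟨2 * K * (A₁ ^ 2 + κ) + (2 * (p * B 0)) ^ 2, by positivity, fun n hn => ?_⟩
  have hn0 : (0 : ℝ) < n := by exact_mod_cast hn
  have hn1 : (1 : ℝ) ≤ n := by exact_mod_cast hn
  set δ : ℝ := (n : ℝ) ^ (-(1 / (2 * α + 1))) with hδ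
  have h0 : 0 < δ := by positivity
  have h1 : δ ≤ 1 := Real.rpow_le_one_of_one_le_of_nonpos hn1 (by
    have : 0 < 1 / (2 * α + 1) := by positivity
    linarith)
  have hrate : (n : ℝ) ^ (-(2 * α) / (2 * α + 1)) = δ ^ (2 * α) := by
    rw [hδ, ← Real.rpow_mul hn0.le]
    congr 1
    ring
  have hbal : n * δ ^ (2 * α) = 1 / δ := by
    have e : -(1 / (2 * α + 1)) * (2 * α + 1) = -1 := by field_simp
    rw [eq_div_iff h0.ne', mul_assoc, ← Real.rpow_add_one h0.ne', hδ, ← Real.rpow_mul hn0.le, e,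
      Real.rpow_neg_one, mul_inv_cancel₀ hn0.ne']
  rw [hrate]
  obtain ⟨m, net, hm, hnet, hcover⟩ := (hcode δ h0 h1).exists_net
  rcases m with _ | N
  -- An empty net means an empty class of regression functions, so the supremum is vacuous for any
  -- estimator.
  · refine iInf₂_le_of_le (fun _ _ => 0) measurable_const (iSup₂_le fun μ hμ => ?_)
    obtain ⟨g, β, hg, hβ, -, rfl⟩ := hμ
    obtain ⟨i, -⟩ := hcover (g, β, 0) ⟨fun i => (hg i).1, hβ, fun i => by simpa using hC⟩
    exact i.elim0
  set D := κ * δ ^ (2 * α) with hD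
  have hD0 : 0 ≤ D := by positivity
  obtain ⟨est, hestm, hrisk⟩ := hest n N D (A₁ * δ ^ α) hD0 (fun i => (net i).mean)
    (fun i => (net i).scale) fun i => (hnet i).admissible
  refine iInf₂_le_of_le est hestm (iSup₂_le fun μ hμ => iSup₂_le fun σ hσ => iSup₂_le
    fun h hh => ?_)
  obtain ⟨g, β, hg, hβ, -, rfl⟩ := hμ
  obtain ⟨c', hc', rfl⟩ := hσ
  -- The net covers a larger class in which directions may coincide and profiles may be constant.
  have hvalid : ModelParam.Valid s γ L B C (g, β, c') := ⟨fun i => (hg i).1, hβ, hc'⟩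
  refine (hrisk _ _ h hvalid.admissible hh (hcover _ hvalid)).trans (ENNReal.ofReal_le_ofReal ?_)
  have hsq : (A₁ * δ ^ α) ^ 2 = A₁ ^ 2 * δ ^ (2 * α) := by
    rw [mul_pow, ← Real.rpow_natCast (δ ^ α), ← Real.rpow_mul h0.le]
    push_cast
    ring_nf
  have hexp : ((N : ℝ) + 1) * Real.exp (n * (A * (A₁ * δ ^ α) ^ 2 - c * D)) ≤ δ ^ (2 * α) := by
    have e1 : n * (A * (A₁ * δ ^ α) ^ 2 - c * D) = -(A₂ + 2 * α) / δ := by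
      have : c * κ = A₂ + A * A₁ ^ 2 + 2 * α := by rw [hκ]; field_simp
      calc _ = (n * δ ^ (2 * α)) * (A * A₁ ^ 2 - c * κ) := by rw [hsq, hD]; ring
        _ = _ := by rw [hbal, this]; ring
    have e2 : (N : ℝ) + 1 ≤ Real.exp (A₂ / δ) := by exact_mod_cast hm
    have e3 := rpow_neg_le_exp h0 (q := 2 * α) (by positivity)
    rw [Real.rpow_neg h0.le] at e3
    rw [e1]
    calc _ ≤ Real.exp (A₂ / δ) * Real.exp (-(A₂ + 2 * α) / δ) := by gcongr
      _ = (Real.exp (2 * α / δ))⁻¹ := by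
          rw [← Real.exp_add, ← Real.exp_neg]
          ring_nf
      _ ≤ _ := inv_le_of_inv_le₀ (by positivity) e3
  calc _ ≤ 2 * K * (A₁ ^ 2 * δ ^ (2 * α) + κ * δ ^ (2 * α)) +
        (2 * (p * B 0)) ^ 2 * δ ^ (2 * α) := by
        rw [hsq]
        gcongr
        rwa [hsq] at hexp
    _ = _ := by ring

end LocationScale

namespace LocationScale

/-! ### Assouad's method -/

variable {d : ℕ}

theorem one_mem_scaleClass {C : ℝ} (hC : 0 ≤ C) : (fun _ => 1) ∈ scaleClass d C :=
  ⟨0, fun i => by simpa using hC, by ext x; simp⟩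

theorem one_mem_densityClass {K : ℝ} (hK : 1 < K) : (fun _ => 1) ∈ densityClass d K := by
  refine ⟨measurable_const, fun x _ => ⟨?_, hK.le⟩, ?_⟩
  · rw [div_le_one (by linarith)]
    exact hK.le
  · simp [Measure.real, volume_cube]

theorem covariateLaw_one : covariateLaw (fun _ : Fin d → ℝ => 1) = volume.restrict (cube d) := by
  simp [covariateLaw]

theorem isProbabilityMeasure_covariateLaw_one :
    IsProbabilityMeasure (covariateLaw fun _ : Fin d → ℝ => 1) :=
  isProbabilityMeasure_covariateLaw one_lt_two (one_mem_densityClass one_lt_two)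

/-- The affinity of two samples is at least `1/2` when the regression functions are closer
than `1 / √n` in mean square. -/
theorem half_le_affinity {f : ℝ → ℝ} (hf : RegularDensity f) (M : ℝ) : ∃ A > 0,
    ∀ n : ℕ, 1 ≤ n → ∀ μ μ' : (Fin d → ℝ) → ℝ, Measurable μ → Measurable μ' →
      (∀ x ∈ cube d, |μ x| ≤ M) → (∀ x ∈ cube d, |μ' x| ≤ M) →
      ∫⁻ x, ENNReal.ofReal ((μ x - μ' x) ^ 2) ∂(covariateLaw fun _ => 1) ≤
        ENNReal.ofReal (1 / (A * n)) →
      ENNReal.ofReal (1 / 2) ≤ ∫⁻ S : Fin n → (Fin d → ℝ) × ℝ,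
        ((∏ k, ENNReal.ofReal (locScale f (μ (S k).1) 1 (S k).2)) *
          ∏ k, ENNReal.ofReal (locScale f (μ' (S k).1) 1 (S k).2)) ^ (1 / 2 : ℝ)
        ∂(Measure.pi fun _ => (covariateLaw fun _ => 1).prod volume) := by
  obtain ⟨A, hA, hup⟩ := hf.hellinger M 1 1 one_pos
  refine ⟨A, hA, fun n hn μ μ' hμ hμ' hM hM' hclose => ?_⟩
  have hprob := isProbabilityMeasure_covariateLaw_one (d := d)
  have hn0 : (0 : ℝ) < n := by exact_mod_cast hn
  have hn1 : (1 : ℝ) ≤ n := by exact_mod_cast hn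
  have m1 := (measurable_locScale_comp hf.measurable hμ
    (measurable_const (a := (1 : ℝ)))).ennreal_ofReal
  have m2 := (measurable_locScale_comp hf.measurable hμ'
    (measurable_const (a := (1 : ℝ)))).ennreal_ofReal
  set F : (Fin d → ℝ) × ℝ → ℝ≥0∞ := fun z => (ENNReal.ofReal (locScale f (μ z.1) 1 z.2) *
    ENNReal.ofReal (locScale f (μ' z.1) 1 z.2)) ^ (1 / 2 : ℝ) with hF
  have hFm : Measurable F := (m1.mul m2).pow_const _
  -- One observation loses at most half the mean squared Hellinger distance. The deficit is moved to
  -- the other side as a sum to avoid truncated subtraction under the integral.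
  have single : ENNReal.ofReal (1 - 1 / (2 * n)) ≤
      ∫⁻ z, F z ∂((covariateLaw fun _ => 1).prod volume) := by
    rw [lintegral_prod _ hFm.aemeasurable]
    have e : ∀ x, ∫⁻ y, F (x, y) = ENNReal.ofReal
        (1 - hellingerSq (locScale f (μ x) 1) (locScale f (μ' x) 1) / 2) := fun x =>
      affinity_eq (p := locScale f (μ x) 1) (q := locScale f (μ' x) 1)
        (hf.integrable_locScale _ one_pos) (hf.integrable_locScale _ one_pos)
        (fun y => (hf.locScale_pos _ one_pos y).le) (fun y => (hf.locScale_pos _ one_pos y).le)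
        (hf.integral_locScale _ one_pos) (hf.integral_locScale _ one_pos)
    have hFm' : Measurable fun x => ∫⁻ y, F (x, y) := hFm.lintegral_prod_right'
    have h1 : (1 : ℝ≥0∞) ≤ ∫⁻ x, (∫⁻ y, F (x, y)) ∂(covariateLaw fun _ => 1) +
        ENNReal.ofReal (1 / (2 * n)) := by
      calc (1 : ℝ≥0∞) = ∫⁻ _ : Fin d → ℝ, 1 ∂(covariateLaw fun _ => 1) := by simp
        _ ≤ ∫⁻ x, ((∫⁻ y, F (x, y)) + ENNReal.ofReal (A / 2) *
            ENNReal.ofReal ((μ x - μ' x) ^ 2)) ∂(covariateLaw fun _ => 1) := by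
            refine lintegral_mono_ae ?_
            filter_upwards [ae_covariateLaw_mem_cube fun _ => 1] with x hx
            have hh := hup _ _ 1 1 (hM x hx) (hM' x hx) ⟨le_rfl, le_rfl⟩ ⟨le_rfl, le_rfl⟩
            rw [e x, ← ENNReal.ofReal_mul (by positivity), ← ENNReal.ofReal_one]
            refine le_trans (ENNReal.ofReal_le_ofReal ?_) ENNReal.ofReal_add_le
            linarith
        _ = ∫⁻ x, (∫⁻ y, F (x, y)) ∂(covariateLaw fun _ => 1) + ENNReal.ofReal (A / 2) *
            ∫⁻ x, ENNReal.ofReal ((μ x - μ' x) ^ 2) ∂(covariateLaw fun _ => 1) := by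
            rw [lintegral_add_left hFm', lintegral_const_mul _ (by fun_prop)]
        _ ≤ _ := by
            gcongr
            refine (mul_le_mul_right hclose _).trans (le_of_eq ?_)
            rw [← ENNReal.ofReal_mul (by positivity)]
            congr 1
            field_simp
    rw [ENNReal.ofReal_sub _ (by positivity), ENNReal.ofReal_one]
    exact tsub_le_iff_right.2 h1
  have hprod : ∀ S : Fin n → (Fin d → ℝ) × ℝ,
      ((∏ k, ENNReal.ofReal (locScale f (μ (S k).1) 1 (S k).2)) *
        ∏ k, ENNReal.ofReal (locScale f (μ' (S k).1) 1 (S k).2)) ^ (1 / 2 : ℝ) =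
      ∏ k, F (S k) := fun S => by
    rw [← Finset.prod_mul_distrib, ENNReal.prod_rpow_of_nonneg (by norm_num)]
  simp_rw [hprod]
  rw [lintegral_pi_prod (fun _ => F) fun _ => hFm, Finset.prod_const, Finset.card_univ,
    Fintype.card_fin]
  refine le_trans ?_ (pow_le_pow_left' single n)
  have hle : (1 : ℝ) / (2 * n) ≤ 1 := by
    rw [div_le_one (by positivity)]
    linarith
  rw [← ENNReal.ofReal_pow (by linarith)]
  refine ENNReal.ofReal_le_ofReal ?_
  -- Bernoulli's inequality gives `(1 - 1 / (2n)) ^ n ≥ 1 / 2`.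
  have hb := one_add_mul_le_pow (a := -(1 / (2 * (n : ℝ)))) (by linarith) n
  have e : 1 + (n : ℝ) * -(1 / (2 * n)) = 1 / 2 := by field_simp; norm_num
  rw [e] at hb
  simpa [sub_eq_add_neg] using hb

/-- Two regression functions that are separated on a set `T` but close overall cannot both be
estimated well on `T`. -/
theorem pair_bound {f : ℝ → ℝ} (hf : RegularDensity f) (M : ℝ) : ∃ A > 0,
    ∀ n : ℕ, 1 ≤ n → ∀ μ μ' : (Fin d → ℝ) → ℝ, Measurable μ → Measurable μ' →
      (∀ x ∈ cube d, |μ x| ≤ M) → (∀ x ∈ cube d, |μ' x| ≤ M) →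
      ∫⁻ x, ENNReal.ofReal ((μ x - μ' x) ^ 2) ∂(covariateLaw fun _ => 1) ≤
        ENNReal.ofReal (1 / (A * n)) →
      ∀ est : (Fin n → (Fin d → ℝ) × ℝ) → (Fin d → ℝ) → ℝ, Measurable (Function.uncurry est) →
      ∀ (T : Set (Fin d → ℝ)) (Δ : ℝ≥0∞),
      Δ ≤ ∫⁻ x in T, ENNReal.ofReal ((μ x - μ' x) ^ 2) ∂(covariateLaw fun _ => 1) →
      Δ ≤ 16 *
        (∫⁻ S, ∫⁻ x in T, ENNReal.ofReal ((μ x - est S x) ^ 2) ∂(covariateLaw fun _ => 1)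
          ∂(sampleLaw n f μ (fun _ => 1) fun _ => 1) +
        ∫⁻ S, ∫⁻ x in T, ENNReal.ofReal ((μ' x - est S x) ^ 2) ∂(covariateLaw fun _ => 1)
          ∂(sampleLaw n f μ' (fun _ => 1) fun _ => 1)) := by
  obtain ⟨A, hA, haff⟩ := half_le_affinity (d := d) hf M
  refine ⟨A, hA, fun n hn μ μ' hμ hμ' hM hM' hclose est hest T Δ hΔ => ?_⟩
  have hprob := isProbabilityMeasure_covariateLaw_one (d := d)
  have aff := haff n hn μ μ' hμ hμ' hM hM' hclose
  set ν := covariateLaw fun _ : Fin d → ℝ => 1 with hν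
  have law : ∀ μ : (Fin d → ℝ) → ℝ, Measurable μ →
      sampleLaw n f μ (fun _ => 1) (fun _ => 1) =
        (Measure.pi fun _ : Fin n => ν.prod volume).withDensity fun S =>
          ∏ k, ENNReal.ofReal (locScale f (μ (S k).1) 1 (S k).2) := by
    intro μ hμ
    have hobs := isProbabilityMeasure_observationLaw hf hμ (measurable_const (a := (1 : ℝ)))
      (fun _ => one_pos) (h := fun _ => 1)
    have e := observationLaw_eq_withDensity (h := fun _ => 1) hf.measurable hμ
      (measurable_const (a := (1 : ℝ))) (fun _ => one_pos)
    rw [← hν] at e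
    rw [e] at hobs
    rw [sampleLaw, e]
    exact pi_withDensity (measurable_locScale_comp hf.measurable hμ
      (measurable_const (a := (1 : ℝ)))).ennreal_ofReal
  have denm : ∀ μ : (Fin d → ℝ) → ℝ, Measurable μ → Measurable
      fun S : Fin n → (Fin d → ℝ) × ℝ =>
        ∏ k, ENNReal.ofReal (locScale f (μ (S k).1) 1 (S k).2) := fun μ hμ =>
    Finset.measurable_prod _ fun k _ => ((measurable_locScale_comp hf.measurable hμ
      (measurable_const (a := (1 : ℝ)))).ennreal_ofReal).comp (measurable_pi_apply k)
  have den1 : ∀ μ : (Fin d → ℝ) → ℝ, Measurable μ →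
      ∫⁻ S : Fin n → (Fin d → ℝ) × ℝ, ∏ k, ENNReal.ofReal (locScale f (μ (S k).1) 1 (S k).2)
        ∂(Measure.pi fun _ : Fin n => ν.prod volume) = 1 := by
    intro μ hμ
    have hobs := isProbabilityMeasure_observationLaw hf hμ (measurable_const (a := (1 : ℝ)))
      (fun _ => one_pos) (h := fun _ => 1)
    have : IsProbabilityMeasure (sampleLaw n f μ (fun _ => 1) fun _ => 1) := by
      unfold sampleLaw; infer_instance
    have h1 := measure_univ (μ := sampleLaw n f μ (fun _ => 1) fun _ => 1)
    rwa [law μ hμ, withDensity_apply _ MeasurableSet.univ, setLIntegral_univ] at h1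
  have lossm : ∀ μ : (Fin d → ℝ) → ℝ, Measurable μ → Measurable
      fun S : Fin n → (Fin d → ℝ) × ℝ => ∫⁻ x in T, ENNReal.ofReal ((μ x - est S x) ^ 2) ∂ν :=
    fun μ hμ => (((hμ.comp measurable_snd).sub hest).pow_const 2).ennreal_ofReal.lintegral_prod_right'
  have sum_ge : ∀ S : Fin n → (Fin d → ℝ) × ℝ,
      Δ ≤ 2 * ∫⁻ x in T, ENNReal.ofReal ((μ x - est S x) ^ 2) ∂ν +
        2 * ∫⁻ x in T, ENNReal.ofReal ((μ' x - est S x) ^ 2) ∂ν := by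
    intro S
    have hS : Measurable (est S) := hest.comp measurable_prodMk_left
    refine hΔ.trans ?_
    rw [← lintegral_const_mul _ (by fun_prop), ← lintegral_const_mul _ (by fun_prop),
      ← lintegral_add_left (by fun_prop)]
    refine lintegral_mono fun x => ?_
    rw [← ENNReal.ofReal_ofNat, ← ENNReal.ofReal_mul zero_le_two,
      ← ENNReal.ofReal_mul zero_le_two, ← ENNReal.ofReal_add (by positivity) (by positivity)]
    refine ENNReal.ofReal_le_ofReal ?_
    nlinarith [sq_nonneg ((μ x - est S x) + (μ' x - est S x))]
  -- The final factor `16` is `2` from the triangle inequality for squares, `2` from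
  -- `affinity_sq_le` and `4` from the squared affinity `1 / 2`.
  have key := affinity_sq_le (κ := Measure.pi fun _ : Fin n => ν.prod volume) (denm μ hμ)
    (denm μ' hμ') ((lossm μ hμ).const_mul 2) ((lossm μ' hμ').const_mul 2) (den1 μ hμ) (den1 μ' hμ')
    sum_ge
  have conv : ∀ μ : (Fin d → ℝ) → ℝ, Measurable μ →
      ∫⁻ S, (2 * ∫⁻ x in T, ENNReal.ofReal ((μ x - est S x) ^ 2) ∂ν) *
        ∏ k, ENNReal.ofReal (locScale f (μ (S k).1) 1 (S k).2)
        ∂(Measure.pi fun _ : Fin n => ν.prod volume) =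
      2 * ∫⁻ S, ∫⁻ x in T, ENNReal.ofReal ((μ x - est S x) ^ 2) ∂ν
          ∂(sampleLaw n f μ (fun _ => 1) fun _ => 1) := by
    intro μ hμ
    rw [law μ hμ, lintegral_withDensity_eq_lintegral_mul _ (denm μ hμ) (lossm μ hμ),
      ← lintegral_const_mul _ ((denm μ hμ).mul (lossm μ hμ))]
    refine lintegral_congr fun S => ?_
    simp only [Pi.mul_apply]
    ring
  rw [conv μ hμ, conv μ' hμ', ← mul_add, ← mul_assoc] at key
  have h2 : Δ * (ENNReal.ofReal (1 / 2)) ^ 2 ≤ _ := (mul_le_mul_right (pow_le_pow_left' aff 2) Δ).trans key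
  have h4 : (ENNReal.ofReal (1 / 2)) ^ 2 * 4 = 1 := by
    rw [← ENNReal.ofReal_pow (by norm_num), ← ENNReal.ofReal_ofNat, ← ENNReal.ofReal_mul (by norm_num)]
    norm_num
  calc Δ = Δ * (ENNReal.ofReal (1 / 2)) ^ 2 * 4 := by rw [mul_assoc, h4, mul_one]
    _ ≤ _ := (mul_le_mul_left h2 4)
    _ = _ := by ring

/-- Flipping one coordinate of a vertex of the hypercube. -/
def flip {m : ℕ} (j : Fin m) (ω : Fin m → Bool) : Fin m → Bool := Function.update ω j (!ω j)

theorem flip_involutive {m : ℕ} (j : Fin m) : Function.Involutive (flip j) := fun ω => by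
  simp [flip]

/-- Assouad's lemma for regression functions indexed by the hypercube. -/
theorem assouad {f : ℝ → ℝ} (hf : RegularDensity f) (M : ℝ) : ∃ A > 0,
    ∀ n : ℕ, 1 ≤ n → ∀ (m : ℕ) (μ : (Fin m → Bool) → (Fin d → ℝ) → ℝ), (∀ ω, Measurable (μ ω)) →
      (∀ ω, ∀ x ∈ cube d, |μ ω x| ≤ M) →
      (∀ ω j, ∫⁻ x, ENNReal.ofReal ((μ ω x - μ (flip j ω) x) ^ 2) ∂(covariateLaw fun _ => 1) ≤
        ENNReal.ofReal (1 / (A * n))) →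
      ∀ (T : Fin m → Set (Fin d → ℝ)), (∀ j, MeasurableSet (T j)) →
      Pairwise (Function.onFun Disjoint T) → ∀ Δ : ℝ≥0∞,
      (∀ ω j, Δ ≤ ∫⁻ x in T j, ENNReal.ofReal ((μ ω x - μ (flip j ω) x) ^ 2)
        ∂(covariateLaw fun _ => 1)) →
      ∀ est : (Fin n → (Fin d → ℝ) × ℝ) → (Fin d → ℝ) → ℝ, Measurable (Function.uncurry est) →
      ∀ R : ℝ≥0∞, (∀ ω, risk f (μ ω) (fun _ => 1) (fun _ => 1) est ≤ R) → m * Δ ≤ 32 * R := by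
  obtain ⟨A, hA, hpair⟩ := pair_bound (d := d) hf M
  refine ⟨A, hA, fun n hn m μ hμ hM hclose T hT hdisj Δ hΔ est hest R hR => ?_⟩
  set r : (Fin m → Bool) → Fin m → ℝ≥0∞ := fun ω j =>
    ∫⁻ S, ∫⁻ x in T j, ENNReal.ofReal ((μ ω x - est S x) ^ 2) ∂(covariateLaw fun _ => 1)
      ∂(sampleLaw n f (μ ω) (fun _ => 1) fun _ => 1) with hr
  -- The sets `T j` are disjoint, so local risks add up to at most the global risk.
  have split : ∀ ω, ∑ j, r ω j ≤ R := by
    intro ω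
    refine le_trans ?_ (hR ω)
    have hm : ∀ j, Measurable fun S : Fin n → (Fin d → ℝ) × ℝ => ∫⁻ x in T j,
        ENNReal.ofReal ((μ ω x - est S x) ^ 2) ∂(covariateLaw fun _ => 1) := by
      have := isProbabilityMeasure_covariateLaw_one (d := d)
      exact fun j => ((((hμ ω).comp measurable_snd).sub
        hest).pow_const 2).ennreal_ofReal.lintegral_prod_right'
    simp only [hr]
    rw [← lintegral_finsetSum _ fun j _ => hm j]
    refine lintegral_mono fun S => ?_
    rw [← lintegral_biUnion_finset (fun i _ j _ hij => hdisj hij) fun j _ => hT j]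
    -- Restriction to the union of the `T j` only decreases the loss.
    exact setLIntegral_le_lintegral _ _
  have pair : ∀ j, 2 ^ m * Δ ≤ 32 * ∑ ω, r ω j := by
    intro j
    -- Averaging over all vertices makes the two members of a pair contribute equally, since
    -- flipping a coordinate permutes the vertices; this turns `16` into `32`.
    have h1 : ∑ ω, r (flip j ω) j = ∑ ω, r ω j :=
      Equiv.sum_comp (flip_involutive j).toPerm fun ω => r ω j
    calc 2 ^ m * Δ = ∑ _ω : Fin m → Bool, Δ := by simp
      _ ≤ ∑ ω, 16 * (r ω j + r (flip j ω) j) := Finset.sum_le_sum fun ω _ =>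
          hpair n hn _ _ (hμ ω) (hμ _) (hM ω) (hM _) (hclose ω j) est hest (T j) Δ (hΔ ω j)
      _ = 16 * (∑ ω, r ω j + ∑ ω, r (flip j ω) j) := by
          rw [← Finset.mul_sum, Finset.sum_add_distrib]
      _ = _ := by rw [h1]; ring
  have total : 2 ^ m * (m * Δ) ≤ 2 ^ m * (32 * R) := by
    calc (2 : ℝ≥0∞) ^ m * (m * Δ) = ∑ _j : Fin m, 2 ^ m * Δ := by simp; ring
      _ ≤ ∑ j, 32 * ∑ ω, r ω j := Finset.sum_le_sum fun j _ => pair j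
      _ = 32 * ∑ ω, ∑ j, r ω j := by rw [← Finset.mul_sum, Finset.sum_comm]
      _ ≤ 32 * ∑ _ω : Fin m → Bool, R := by
          gcongr with ω _
          exact split ω
      _ = _ := by simp; ring
  rwa [ENNReal.mul_le_mul_iff_right (by simp) (by simp)] at total

end LocationScale

namespace LocationScale

open scoped ContDiff

/-! ### Sums of bumps in the Hölder class -/

theorem exists_bump : ∃ ψ : ℝ → ℝ, ContDiff ℝ ∞ ψ ∧ (∀ z ∈ Icc (1 / 4 : ℝ) (3 / 4), ψ z = 1) ∧
    (∀ z, 0 ≤ ψ z ∧ ψ z ≤ 1) ∧ (∀ k z, z ∉ Ioo (0 : ℝ) 1 → iteratedDeriv k ψ z = 0) ∧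
    ∀ k, ∃ M, ∀ z, |iteratedDeriv k ψ z| ≤ M := by
  -- The outer radius `3/8` keeps the closed support strictly inside `(0, 1)`, so all derivatives
  -- vanish off the open interval.
  let b : ContDiffBump (1 / 2 : ℝ) := ⟨1 / 4, 3 / 8, by norm_num, by norm_num⟩
  have hb : ContDiff ℝ ∞ b := b.contDiff
  refine ⟨b, hb, fun z hz => b.one_of_mem_closedBall ?_, fun z => ⟨b.nonneg, b.le_one⟩,
    fun k z hz => ?_, fun k => ?_⟩
  · rw [Metric.mem_closedBall, Real.dist_eq, abs_le]
    constructor <;> linarith [hz.1, hz.2]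
  · by_contra hne
    have h1 : z ∈ Function.support (iteratedFDeriv ℝ k b) := by
      rw [Function.mem_support]
      intro h0
      apply hne
      rw [← norm_eq_zero, ← norm_iteratedFDeriv_eq_norm_iteratedDeriv, h0, norm_zero]
    have h2 := support_iteratedFDeriv_subset (𝕜 := ℝ) k h1
    rw [b.tsupport_eq, Metric.mem_closedBall, Real.dist_eq, abs_le] at h2
    apply hz
    have h3 : b.rOut = 3 / 8 := rfl
    rw [h3] at h2
    constructor <;> linarith [h2.1, h2.2]
  · obtain ⟨M, hM⟩ := (hb.continuous_iteratedFDeriv (m := k)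
      (by exact_mod_cast le_top)).bounded_above_of_compact_support
      (b.hasCompactSupport.iteratedFDeriv (𝕜 := ℝ) k)
    refine ⟨M, fun z => ?_⟩
    rw [← Real.norm_eq_abs, ← norm_iteratedFDeriv_eq_norm_iteratedDeriv]
    exact hM z

/-- Integer translates of `(0, 1)` are disjoint, so at most one term is nonzero and the bound does
not depend on `N`. -/
theorem abs_sum_translates_le {φ : ℝ → ℝ} {M : ℝ} (hM : ∀ z, |φ z| ≤ M)
    (hφ : ∀ z, z ∉ Ioo (0 : ℝ) 1 → φ z = 0) {w : ℕ → ℝ} (hw : ∀ j, |w j| ≤ 1) (N : ℕ) (u : ℝ) :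
    |∑ j ∈ Finset.range N, w j * φ (u - j)| ≤ M := by
  by_cases h : ∃ j ∈ Finset.range N, u - j ∈ Ioo (0 : ℝ) 1
  · obtain ⟨j, hj, hju⟩ := h
    rw [Finset.sum_eq_single_of_mem j hj, abs_mul]
    · exact (mul_le_of_le_one_left (abs_nonneg _) (hw j)).trans (hM _)
    · intro i _ hij
      rw [hφ, mul_zero]
      rintro ⟨h1, h2⟩
      have h3 : (i : ℝ) < j + 1 := by linarith [hju.2]
      have h4 : (j : ℝ) < i + 1 := by linarith [hju.1]
      have h3' : i < j + 1 := by exact_mod_cast h3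
      have h4' : j < i + 1 := by exact_mod_cast h4
      omega
  · push Not at h
    rw [Finset.sum_eq_zero fun j hj => by rw [hφ _ (h j hj), mul_zero], abs_zero]
    exact (abs_nonneg _).trans (hM 0)

/-- The sum of rescaled bumps with weights `w`, at scale `1 / m`. -/
def bumpSum (ψ : ℝ → ℝ) (α a : ℝ) (m : ℕ) (w : ℕ → ℝ) (z : ℝ) : ℝ :=
  a * (m : ℝ) ^ (-α) * ∑ j ∈ Finset.range (m + 1), w j * ψ (m * z - j)

theorem iteratedDeriv_bumpSum {ψ : ℝ → ℝ} (hψ : ContDiff ℝ ∞ ψ) (α a : ℝ) (m : ℕ) (w : ℕ → ℝ)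
    (k : ℕ) (z : ℝ) : iteratedDeriv k (bumpSum ψ α a m w) z =
      a * (m : ℝ) ^ (-α) * (m : ℝ) ^ k *
        ∑ j ∈ Finset.range (m + 1), w j * iteratedDeriv k ψ (m * z - j) := by
  have hk : ContDiff ℝ k ψ := hψ.of_le (by exact_mod_cast le_top)
  unfold bumpSum
  rw [iteratedDeriv_const_mul_field, iteratedDeriv_fun_sum fun j _ => by fun_prop,
    mul_assoc (a * (m : ℝ) ^ (-α))]
  congr 1
  rw [Finset.mul_sum]
  refine Finset.sum_congr rfl fun j _ => ?_
  rw [iteratedDeriv_const_mul_field]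
  have h1 := iteratedDeriv_comp_const_mul (n := k) (f := fun u => ψ (u - j)) (by fun_prop) (m : ℝ)
  rw [congrFun h1 z, iteratedDeriv_comp_sub_const]
  ring

theorem contDiff_bumpSum {ψ : ℝ → ℝ} (hψ : ContDiff ℝ ∞ ψ) (α a : ℝ) (m : ℕ) (w : ℕ → ℝ) :
    ContDiff ℝ ∞ (bumpSum ψ α a m w) := by
  unfold bumpSum
  fun_prop

theorem abs_sub_le_rpow_of_lipschitz {F : ℝ → ℝ} {M γ : ℝ} (hγ₀ : 0 < γ) (hγ₁ : γ ≤ 1)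
    (hM : ∀ u, |F u| ≤ M) (hLip : ∀ u v, |F u - F v| ≤ M * |u - v|) (u v : ℝ) :
    |F u - F v| ≤ 2 * M * |u - v| ^ γ := by
  have hM0 : 0 ≤ M := (abs_nonneg _).trans (hM 0)
  rcases le_or_gt |u - v| 1 with h | h
  · rcases (abs_nonneg (u - v)).eq_or_lt with h0 | h0
    · have := hLip u v
      rw [← h0, mul_zero] at this
      exact this.trans (by positivity)
    · have h1 : |u - v| ≤ |u - v| ^ γ := by
        simpa using Real.rpow_le_rpow_of_exponent_ge h0 h hγ₁
      have h2 : 0 ≤ |u - v| ^ γ := by positivity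
      nlinarith [hLip u v]
  · have h1 : 1 ≤ |u - v| ^ γ := Real.one_le_rpow h.le hγ₀.le
    have h2 : |F u - F v| ≤ 2 * M := (abs_sub _ _).trans (by linarith [hM u, hM v])
    nlinarith

/-- The `k`-th derivative scales like `a m ^ (k - α)`, harmless for `k ≤ s`, and the rescaling of
the argument multiplies the Hölder seminorm of the `s`-th derivative by `m ^ (s + γ - α) = 1`. Hence
the admissible amplitude `a₀` does not depend on `m` or the weights. -/
theorem bumpSum_mem_holderClass {ψ : ℝ → ℝ} (hψ : ContDiff ℝ ∞ ψ)
    (hsupp : ∀ k z, z ∉ Ioo (0 : ℝ) 1 → iteratedDeriv k ψ z = 0)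
    (hbdd : ∀ k, ∃ M, ∀ z, |iteratedDeriv k ψ z| ≤ M) {s : ℕ} {γ L : ℝ} (hγ₀ : 0 < γ)
    (hγ₁ : γ ≤ 1) (hL : 0 < L) {B : ℕ → ℝ} (hB : ∀ k ≤ s, 0 < B k) :
    ∃ a₀ > 0, ∀ a, 0 < a → a ≤ a₀ → ∀ m : ℕ, 1 ≤ m → ∀ w : ℕ → ℝ, (∀ j, |w j| ≤ 1) →
      bumpSum ψ (s + γ) a m w ∈ holderClass s γ L B := by
  choose M' hM' using hbdd
  have hM'0 : ∀ k, 0 ≤ M' k := fun k => (abs_nonneg _).trans (hM' k 0)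
  set M := 1 + ∑ k ∈ Finset.range (s + 2), M' k with hMdef
  have hM0 : 0 < M := add_pos_of_pos_of_nonneg one_pos (Finset.sum_nonneg fun k _ => hM'0 k)
  have hM : ∀ k ≤ s + 1, ∀ z, |iteratedDeriv k ψ z| ≤ M := fun k hk z => by
    refine (hM' k z).trans ?_
    have := Finset.single_le_sum (f := M') (fun i _ => hM'0 i) (Finset.mem_range.2
      (show k < s + 2 by omega))
    linarith
  obtain ⟨k₀, hk₀, hmin⟩ := (Finset.range (s + 1)).exists_min_image B ⟨0, by simp⟩
  have hBk₀ : 0 < B k₀ := hB k₀ (by have := Finset.mem_range.1 hk₀; omega)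
  refine ⟨min (L / (2 * M)) (B k₀ / M), by positivity, fun a ha haa m hm w hw => ?_⟩
  have ha1 : 2 * a * M ≤ L := by
    have := haa.trans (min_le_left _ _)
    rw [le_div_iff₀ (by positivity)] at this
    linarith
  have ha2 : ∀ k ≤ s, a * M ≤ B k := fun k hk => by
    have := haa.trans (min_le_right _ _)
    rw [le_div_iff₀ hM0] at this
    exact this.trans (hmin k (Finset.mem_range.2 (by omega)))
  have hm1 : (1 : ℝ) ≤ m := by exact_mod_cast hm
  have hm0 : (0 : ℝ) < m := by linarith
  have hsum : ∀ k ≤ s + 1, ∀ u, |∑ j ∈ Finset.range (m + 1), w j * iteratedDeriv k ψ (u - j)| ≤ M :=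
    fun k hk u => abs_sum_translates_le (hM k hk) (hsupp k) hw (m + 1) u
  refine ⟨(contDiff_bumpSum hψ _ _ _ _).of_le (by exact_mod_cast le_top), ?_, ?_⟩
  · intro z₁ z₂
    have hlip : ∀ u v, |∑ j ∈ Finset.range (m + 1), w j * iteratedDeriv s ψ (u - j) -
        ∑ j ∈ Finset.range (m + 1), w j * iteratedDeriv s ψ (v - j)| ≤ M * |u - v| := by
      intro u v
      have hder : ∀ u, HasDerivAt (fun u => ∑ j ∈ Finset.range (m + 1),
          w j * iteratedDeriv s ψ (u - j)) (∑ j ∈ Finset.range (m + 1),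
          w j * iteratedDeriv (s + 1) ψ (u - j)) u := by
        intro u
        refine HasDerivAt.fun_sum fun j _ => HasDerivAt.const_mul _ ?_
        exact (hasDerivAt_iteratedDeriv (s := s + 1) (hψ.of_le (by exact_mod_cast le_top))
          (Nat.lt_succ_self s) (u - j)).comp_sub_const u j
      have := Convex.norm_image_sub_le_of_norm_hasDerivWithin_le (s := univ) (C := M)
        (fun u _ => (hder u).hasDerivWithinAt) (fun u _ => hsum (s + 1) le_rfl u) convex_univ
        (mem_univ v) (mem_univ u)
      simpa [Real.norm_eq_abs] using this
    have h1 := abs_sub_le_rpow_of_lipschitz hγ₀ hγ₁ (hsum s (by omega)) hlip (m * z₁) (m * z₂)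
    rw [iteratedDeriv_bumpSum hψ, iteratedDeriv_bumpSum hψ, ← mul_sub, abs_mul,
      abs_of_nonneg (by positivity)]
    rw [← mul_sub, abs_mul, abs_of_pos hm0, Real.mul_rpow hm0.le (abs_nonneg _)] at h1
    have e : (m : ℝ) ^ (-(s + γ)) * (m : ℝ) ^ s * (m : ℝ) ^ γ = 1 := by
      rw [← Real.rpow_natCast, ← Real.rpow_add hm0, ← Real.rpow_add hm0]
      have : -(s + γ) + s + γ = 0 := by ring
      rw [this, Real.rpow_zero]
    calc _ ≤ a * (m : ℝ) ^ (-(s + γ)) * (m : ℝ) ^ s * (2 * M * ((m : ℝ) ^ γ * |z₁ - z₂| ^ γ)) := by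
          gcongr
      _ = 2 * a * M * ((m : ℝ) ^ (-(s + γ)) * (m : ℝ) ^ s * (m : ℝ) ^ γ) * |z₁ - z₂| ^ γ := by ring
      _ ≤ _ := by
          rw [e, mul_one]
          gcongr
  · intro k hk z
    rw [iteratedDeriv_bumpSum hψ, abs_mul, abs_of_nonneg (by positivity)]
    have e : (m : ℝ) ^ (-(s + γ)) * (m : ℝ) ^ k ≤ 1 := by
      rw [← Real.rpow_natCast, ← Real.rpow_add hm0]
      refine Real.rpow_le_one_of_one_le_of_nonpos hm1 ?_
      have : (k : ℝ) ≤ s := by exact_mod_cast hk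
      linarith
    calc _ ≤ a * (m : ℝ) ^ (-(s + γ)) * (m : ℝ) ^ k * M := by
          gcongr
          exact hsum k (by omega) _
      _ = a * ((m : ℝ) ^ (-(s + γ)) * (m : ℝ) ^ k) * M := by ring
      _ ≤ a * 1 * M := by gcongr
      _ ≤ _ := by rw [mul_one]; exact ha2 k hk

/-- The weights attached to a vertex of the hypercube; the extra weight makes the bump sum
non-constant. -/
def cubeWeight {m : ℕ} (ξ : Fin m → Bool) (j : ℕ) : ℝ :=
  if h : j < m then (if ξ ⟨j, h⟩ then 1 else 0) else 1

theorem abs_cubeWeight_le {m : ℕ} (ξ : Fin m → Bool) (j : ℕ) : |cubeWeight ξ j| ≤ 1 := by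
  unfold cubeWeight
  split_ifs <;> simp

theorem bumpSum_cubeWeight_nonconst {ψ : ℝ → ℝ} (hone : ∀ z ∈ Icc (1 / 4 : ℝ) (3 / 4), ψ z = 1)
    (hzero : ∀ z, z ∉ Ioo (0 : ℝ) 1 → ψ z = 0) {α a : ℝ} (ha : 0 < a) {m : ℕ} (hm : 1 ≤ m)
    (ξ : Fin m → Bool) : ∃ z₁ z₂, bumpSum ψ α a m (cubeWeight ξ) z₁ ≠
      bumpSum ψ α a m (cubeWeight ξ) z₂ := by
  have hm0 : (0 : ℝ) < m := by exact_mod_cast hm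
  -- The first point is the centre of the extra bump of index `m`, which is always switched on; the
  -- second lies to the left of all bumps.
  refine ⟨1 + 1 / (2 * m), -1, ?_⟩
  have e : (m : ℝ) * (1 + 1 / (2 * m)) = m + 1 / 2 := by field_simp
  have h1 : bumpSum ψ α a m (cubeWeight ξ) (1 + 1 / (2 * m)) = a * (m : ℝ) ^ (-α) := by
    unfold bumpSum
    rw [Finset.sum_eq_single_of_mem m (by simp), e]
    · rw [hone _ (by constructor <;> linarith)]
      simp [cubeWeight]
    · intro j hj hjm
      have : j < m := by have := Finset.mem_range.1 hj; omega
      have : (j : ℝ) + 1 ≤ m := by exact_mod_cast this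
      rw [e, hzero, mul_zero]
      rintro ⟨-, h⟩
      linarith
  have h2 : bumpSum ψ α a m (cubeWeight ξ) (-1) = 0 := by
    unfold bumpSum
    rw [Finset.sum_eq_zero, mul_zero]
    intro j _
    rw [hzero, mul_zero]
    rintro ⟨h, -⟩
    have : (0 : ℝ) ≤ j := Nat.cast_nonneg j
    linarith
  rw [h1, h2]
  positivity

theorem bumpSum_flip_sub_sq (ψ : ℝ → ℝ) (α a : ℝ) {m : ℕ} (ξ : Fin m → Bool) (j : Fin m) (z : ℝ) :
    (bumpSum ψ α a m (cubeWeight ξ) z - bumpSum ψ α a m (cubeWeight (flip j ξ)) z) ^ 2 =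
      (a * (m : ℝ) ^ (-α)) ^ 2 * ψ (m * z - j) ^ 2 := by
  unfold bumpSum
  rw [← mul_sub, ← Finset.sum_sub_distrib, mul_pow]
  congr 1
  rw [Finset.sum_eq_single_of_mem (j : ℕ) (Finset.mem_range.2 (by omega))]
  · have h1 : (cubeWeight ξ j - cubeWeight (flip j ξ) j) ^ 2 = 1 := by
      simp only [cubeWeight, flip, j.2, dite_true, Fin.eta, Function.update_self]
      cases ξ j <;> simp
    rw [← sub_mul, mul_pow, h1, one_mul]
  · intro i _ hij
    have : cubeWeight ξ i = cubeWeight (flip j ξ) i := by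
      by_cases h : i < m
      · have hne : (⟨i, h⟩ : Fin m) ≠ j := fun h' => hij (by rw [← h'])
        simp [cubeWeight, h, flip, Function.update_of_ne hne]
      · simp [cubeWeight, h]
    rw [this, sub_self]

/-! ### Directions -/

/-- On the line the only unit vectors are `±1`, whence the restriction. In higher dimension,
distinct angles in `[0, 1]` within the first coordinate plane give distinct directions because the
cosine is injective on `[0, π]`. -/
theorem exists_directions {e q : ℕ} (h : e = 0 → q ≤ 1) :
    ∃ β : Fin (q + 1) → EuclideanSpace ℝ (Fin (e + 1)), (∀ i, ‖β i‖ = 1) ∧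
      Function.Injective β ∧ ∀ x : Fin (e + 1) → ℝ, ∑ j, β 0 j * x j = x 0 := by
  rcases Nat.eq_zero_or_pos e with rfl | he
  · have hq := h rfl
    refine ⟨fun i => WithLp.toLp 2 fun _ => if i = 0 then 1 else -1, fun i => ?_, ?_, fun x => ?_⟩
    · by_cases hi : i = 0 <;> simp [EuclideanSpace.norm_eq, hi]
    · intro i j hij
      have h0 := congrArg (fun v : EuclideanSpace ℝ (Fin 1) => v 0) hij
      by_cases hi : i = 0 <;> by_cases hj : j = 0
      · rw [hi, hj]
      · norm_num [hi, hj] at h0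
      · norm_num [hi, hj] at h0
      · ext
        have := Fin.val_ne_zero_iff.2 hi
        have := Fin.val_ne_zero_iff.2 hj
        omega
    · simp
  · obtain ⟨e, rfl⟩ : ∃ e', e = e' + 1 := ⟨e - 1, by omega⟩
    set t : Fin (q + 1) → ℝ := fun i => (i : ℕ) / ((q : ℝ) + 1) with ht
    refine ⟨fun i => WithLp.toLp 2 (Fin.cons (Real.cos (t i)) (Fin.cons (Real.sin (t i)) 0)),
      fun i => ?_, ?_, fun x => ?_⟩
    · rw [EuclideanSpace.norm_eq, Fin.sum_univ_succ, Fin.sum_univ_succ]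
      simp
    · intro i j hij
      have h0 := congrArg (fun v : EuclideanSpace ℝ (Fin (e + 1 + 1)) => v 0) hij
      simp only [Fin.cons_zero] at h0
      have hmem : ∀ i, t i ∈ Icc 0 Real.pi := fun i => by
        refine ⟨by positivity, ?_⟩
        have h1 : t i ≤ 1 := by
          rw [ht, div_le_one (by positivity)]
          have : (i : ℕ) ≤ q + 1 := i.2.le
          exact_mod_cast this
        linarith [Real.pi_gt_three]
      have h1 := Real.injOn_cos (hmem i) (hmem j) h0
      have hq : (q : ℝ) + 1 ≠ 0 := by positivity
      simp only [ht] at h1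
      rw [div_left_inj' hq] at h1
      ext
      exact_mod_cast h1
    · rw [Fin.sum_univ_succ, Fin.sum_univ_succ]
      simp [ht]

/-! ### The lower bound -/

theorem volume_slab {e : ℕ} {u v : ℝ} (hu : 0 ≤ u) (hv : v ≤ 1) :
    (volume.restrict (cube (e + 1))) {x | x 0 ∈ Icc u v} = ENNReal.ofReal (v - u) := by
  have hS : MeasurableSet {x : Fin (e + 1) → ℝ | x 0 ∈ Icc u v} :=
    measurable_pi_apply 0 measurableSet_Icc
  rw [Measure.restrict_apply hS]
  have : {x : Fin (e + 1) → ℝ | x 0 ∈ Icc u v} ∩ cube (e + 1) =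
      univ.pi (Fin.cons (Icc u v) fun _ => Icc 0 1 : Fin (e + 1) → Set ℝ) := by
    ext x
    simp only [mem_inter_iff, mem_ofPred_eq, cube, mem_Icc, mem_univ_pi, Fin.forall_fin_succ,
      Fin.cons_zero, Fin.cons_succ, Pi.le_def, Pi.zero_apply, Pi.one_apply]
    constructor
    · rintro ⟨⟨h1, h2⟩, ⟨h3, h4⟩, h5, h6⟩
      exact ⟨⟨h1, h2⟩, fun i => ⟨h4 i, h6 i⟩⟩
    · rintro ⟨⟨h1, h2⟩, h3⟩
      exact ⟨⟨h1, h2⟩, ⟨hu.trans h1, fun i => (h3 i).1⟩, h2.trans hv, fun i => (h3 i).2⟩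
  rw [this, volume_pi_pi, Fin.prod_univ_succ]
  simp

theorem le_minimaxRisk {f : ℝ → ℝ} (hf : RegularDensity f) {d p : ℕ} (hd : 1 ≤ d) (hp : 1 ≤ p)
    (hdp : d = 1 → p ≤ 2) {s : ℕ} {γ : ℝ} (hγ₀ : 0 < γ) (hγ₁ : γ ≤ 1) {L : ℝ} (hL : 0 < L)
    {B : ℕ → ℝ} (hB : ∀ k ≤ s, 0 < B k) {K : ℝ} (hK : 1 < K) {C : ℝ} (hC : 0 ≤ C) :
    ∃ c₁ > 0, ∀ n : ℕ, 1 ≤ n →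
      ENNReal.ofReal (c₁ * (n : ℝ) ^ (-(2 * (s + γ)) / (2 * (s + γ) + 1))) ≤
        minimaxRisk n f (multipleIndexClass d p s γ L B) (scaleClass d C) (densityClass d K) := by
  obtain ⟨e, rfl⟩ : ∃ e, d = e + 1 := ⟨d - 1, by omega⟩
  obtain ⟨q, rfl⟩ : ∃ q, p = q + 1 := ⟨p - 1, by omega⟩
  set α : ℝ := s + γ with hα
  have hα0 : 0 < α := by positivity
  obtain ⟨ψ, hψ, hone, h01, hsupp, hbdd⟩ := exists_bump
  have hzero : ∀ z, z ∉ Ioo (0 : ℝ) 1 → ψ z = 0 := fun z hz => by simpa using hsupp 0 z hz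
  obtain ⟨β, hβ1, hβinj, hβ0⟩ := exists_directions (e := e) (q := q) fun h => by
    have := hdp (by omega)
    omega
  obtain ⟨a₀, ha₀, hmem⟩ := bumpSum_mem_holderClass hψ hsupp hbdd hγ₀ hγ₁ hL hB
  rw [← hα] at hmem
  obtain ⟨A, hA, hass⟩ := assouad (d := e + 1) hf ((q + 1 : ℕ) * B 0)
  -- The first bound keeps the profiles in the Hölder class; the second makes neighbouring vertices
  -- close enough for the affinity bound.
  set a := min a₀ (1 / √A) with ha
  have hsA : 0 < √A := Real.sqrt_pos.2 hA
  have ha0 : 0 < a := lt_min ha₀ (by positivity)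
  have haA : a ^ 2 * A ≤ 1 := by
    have h1 : a ≤ 1 / √A := min_le_right _ _
    rw [le_div_iff₀ hsA] at h1
    have h2 := pow_le_one₀ (n := 2) (by positivity) h1
    rwa [mul_pow, Real.sq_sqrt hA.le] at h2
  -- Assouad's lemma yields `b / 2 ≤ 32 R`, and `2 ^ (-(2 * α))` is the price of rounding `t` up to
  -- `m ≤ 2t`.
  refine ⟨a ^ 2 * 2 ^ (-(2 * α)) / 64, by positivity, fun n hn => ?_⟩
  have hn0 : (0 : ℝ) < n := by exact_mod_cast hn
  have hn1 : (1 : ℝ) ≤ n := by exact_mod_cast hn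
  set t : ℝ := (n : ℝ) ^ (1 / (2 * α + 1)) with ht
  have ht1 : 1 ≤ t := Real.one_le_rpow hn1 (by positivity)
  set m : ℕ := ⌈t⌉₊ with hm
  have htm : t ≤ m := Nat.le_ceil t
  have hmt : (m : ℝ) ≤ 2 * t := by
    have := Nat.ceil_lt_add_one (zero_le_one.trans ht1)
    linarith
  have hm1' : (1 : ℝ) ≤ m := ht1.trans htm
  have hm1 : 1 ≤ m := by exact_mod_cast hm1'
  have hm0 : (0 : ℝ) < m := by linarith
  set b : ℝ := (a * (m : ℝ) ^ (-α)) ^ 2 with hb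
  have hb' : b = a ^ 2 * (m : ℝ) ^ (-(2 * α)) := by
    rw [hb, mul_pow, ← Real.rpow_natCast ((m : ℝ) ^ (-α)), ← Real.rpow_mul hm0.le]
    push_cast
    ring_nf
  have hb0 : 0 ≤ b := sq_nonneg _
  -- the family of regression functions
  set g : (Fin m → Bool) → ℝ → ℝ := fun ξ => bumpSum ψ α a m (cubeWeight ξ) with hg
  have hgmem : ∀ ξ, g ξ ∈ holderClass s γ L B := fun ξ =>
    hmem a ha0 (min_le_left _ _) m hm1 _ (abs_cubeWeight_le ξ)
  -- Only the first profile varies. The others use the all-`false` vertex, still non-constant thanks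
  -- to the extra bump, and cancel in differences.
  set prof : (Fin m → Bool) → Fin (q + 1) → ℝ → ℝ := fun ξ =>
    Fin.cons (g ξ) fun _ => g fun _ => false with hprof
  have hprofmem : ∀ ξ i, prof ξ i ∈ holderClass s γ L B := fun ξ i => by
    refine Fin.cases ?_ (fun i => ?_) i
    · simpa [hprof] using hgmem ξ
    · simpa [hprof] using hgmem _
  set μ : (Fin m → Bool) → (Fin (e + 1) → ℝ) → ℝ := fun ξ =>
    ModelParam.mean (prof ξ, β, 0) with hμ
  have hadm := fun ξ => ModelParam.Valid.admissible (s := s) (γ := γ) (L := L) (B := B) (C := 0)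
    (θ := (prof ξ, β, 0)) ⟨hprofmem ξ, hβ1, fun i => by simp⟩
  have hclass : ∀ ξ, μ ξ ∈ multipleIndexClass (e + 1) (q + 1) s γ L B := by
    refine fun ξ => ⟨prof ξ, β, fun i => ⟨hprofmem ξ i, ?_⟩, hβ1, hβinj, rfl⟩
    refine Fin.cases ?_ (fun i => ?_) i
    · simpa [hprof] using bumpSum_cubeWeight_nonconst hone hzero ha0 hm1 ξ
    · simpa [hprof] using bumpSum_cubeWeight_nonconst hone hzero ha0 hm1 fun _ => false
  have hdiff : ∀ ξ (j : Fin m) x, (μ ξ x - μ (flip j ξ) x) ^ 2 = b * ψ (m * x 0 - j) ^ 2 := by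
    intro ξ j x
    have : μ ξ x - μ (flip j ξ) x = g ξ (x 0) - g (flip j ξ) (x 0) := by
      simp only [hμ, ModelParam.mean, Fin.sum_univ_succ (n := q), hβ0, hprof, Fin.cons_zero,
        Fin.cons_succ]
      ring
    rw [this, hb]
    exact bumpSum_flip_sub_sq ψ α a ξ j (x 0)
  have hslab : ∀ (j : Fin m) (u v : ℝ), 0 ≤ u → v ≤ 1 →
      (covariateLaw fun _ : Fin (e + 1) → ℝ => 1) {x | m * x 0 - j ∈ Icc u v} =
        ENNReal.ofReal ((v - u) / m) := by
    intro j u v hu hv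
    have hj : ((j : ℕ) : ℝ) + 1 ≤ m := by exact_mod_cast j.2
    have e1 : {x : Fin (e + 1) → ℝ | m * x 0 - j ∈ Icc u v} =
        {x | x 0 ∈ Icc ((u + j) / m) ((v + j) / m)} := by
      ext x
      simp only [mem_ofPred_eq, mem_Icc, div_le_iff₀ hm0, le_div_iff₀ hm0]
      constructor <;> rintro ⟨h1, h2⟩ <;> constructor <;> linarith
    rw [covariateLaw_one, e1, volume_slab (by positivity) (by rw [div_le_one hm0]; linarith)]
    congr 1
    ring
  have hmeasSlab : ∀ (j : Fin m) (S : Set ℝ), MeasurableSet S →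
      MeasurableSet {x : Fin (e + 1) → ℝ | m * x 0 - j ∈ S} := fun j S hS =>
    (by fun_prop : Measurable fun x : Fin (e + 1) → ℝ => (m : ℝ) * x 0 - j) hS
  refine le_iInf₂ fun est hest => ?_
  set R := ⨆ (μ ∈ multipleIndexClass (e + 1) (q + 1) s γ L B) (σ ∈ scaleClass (e + 1) C)
    (h ∈ densityClass (e + 1) K), risk f μ σ h est with hR
  have key := hass n hn m μ (fun ξ => (hadm ξ).measurable_mean) (fun ξ => (hadm ξ).abs_mean_le)
    ?_ (fun j => {x | m * x 0 - j ∈ Ioo (0 : ℝ) 1}) (fun j => hmeasSlab j _ measurableSet_Ioo) ?_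
    (ENNReal.ofReal (b / (2 * m))) ?_ est hest R ?_
  · have h32 : ENNReal.ofReal (b / 2) ≤ 32 * R := by
      refine le_trans (le_of_eq ?_) key
      rw [← ENNReal.ofReal_natCast, ← ENNReal.ofReal_mul (by positivity)]
      congr 1
      field_simp
    have hpow : 2 ^ (-(2 * α)) * (n : ℝ) ^ (-(2 * α) / (2 * α + 1)) ≤ (m : ℝ) ^ (-(2 * α)) := by
      have e1 : (n : ℝ) ^ (-(2 * α) / (2 * α + 1)) = t ^ (-(2 * α)) := by
        rw [ht, ← Real.rpow_mul hn0.le]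
        congr 1
        ring
      rw [e1, ← Real.mul_rpow zero_le_two (by linarith)]
      exact Real.rpow_le_rpow_of_nonpos hm0 hmt (by linarith)
    have hfin : ENNReal.ofReal
        (a ^ 2 * 2 ^ (-(2 * α)) / 64 * (n : ℝ) ^ (-(2 * α) / (2 * α + 1))) * 32 ≤ 32 * R := by
      refine le_trans ?_ h32
      rw [← ENNReal.ofReal_ofNat, ← ENNReal.ofReal_mul (by positivity)]
      refine ENNReal.ofReal_le_ofReal ?_
      rw [hb']
      have := mul_le_mul_of_nonneg_left hpow (sq_nonneg a)
      linarith
    rw [mul_comm] at hfin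
    rwa [ENNReal.mul_le_mul_iff_right (by norm_num) (by norm_num)] at hfin
  · intro ξ j
    calc _ ≤ ∫⁻ x, {x : Fin (e + 1) → ℝ | m * x 0 - j ∈ Icc (0 : ℝ) 1}.indicator
          (fun _ => ENNReal.ofReal b) x ∂(covariateLaw fun _ => 1) := by
          refine lintegral_mono fun x => ?_
          simp only [hdiff]
          by_cases hx : m * x 0 - j ∈ Icc (0 : ℝ) 1
          · rw [indicator_of_mem (by exact hx)]
            refine ENNReal.ofReal_le_ofReal (mul_le_of_le_one_right hb0 ?_)
            exact pow_le_one₀ (h01 _).1 (h01 _).2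
          · rw [hzero _ fun h => hx (Ioo_subset_Icc_self h)]
            simp
      _ = ENNReal.ofReal b * ENNReal.ofReal ((1 - 0) / m) := by
          rw [lintegral_indicator_const (hmeasSlab j _ measurableSet_Icc),
            hslab j 0 1 le_rfl le_rfl]
      _ ≤ _ := by
          rw [← ENNReal.ofReal_mul hb0]
          refine ENNReal.ofReal_le_ofReal ?_
          -- Rounding `m` upwards is what makes a single flip undetectable: its squared size is at
          -- most `a² m ^ (-2α) / m ≤ a² / n`.
          have hmn : (n : ℝ) ≤ (m : ℝ) ^ (2 * α) * m := by
            rw [← Real.rpow_add_one hm0.ne']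
            calc (n : ℝ) = t ^ (2 * α + 1) := by
                  rw [ht, ← Real.rpow_mul hn0.le, one_div_mul_cancel (by positivity),
                    Real.rpow_one]
              _ ≤ _ := by gcongr
          rw [hb', sub_zero, Real.rpow_neg hm0.le]
          have hmα : 0 < (m : ℝ) ^ (2 * α) := by positivity
          rw [mul_one_div, le_div_iff₀ (by positivity), div_mul_eq_mul_div, div_le_one hm0,
            mul_assoc, mul_comm _ (A * n), ← mul_assoc, ← div_eq_mul_inv, div_le_iff₀ hmα]
          nlinarith
  · intro i j hij
    rw [Function.onFun, Set.disjoint_left]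
    intro x hxi hxj
    apply hij
    ext
    have h3 : ((i : ℕ) : ℝ) < j + 1 := by linarith [hxi.1, hxj.2]
    have h4 : ((j : ℕ) : ℝ) < i + 1 := by linarith [hxi.2, hxj.1]
    have h3' : (i : ℕ) < j + 1 := by exact_mod_cast h3
    have h4' : (j : ℕ) < i + 1 := by exact_mod_cast h4
    omega
  · intro ξ j
    calc ENNReal.ofReal (b / (2 * m)) =
        ENNReal.ofReal b * ENNReal.ofReal ((3 / 4 - 1 / 4) / m) := by
          rw [← ENNReal.ofReal_mul hb0]
          congr 1
          field_simp
          ring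
      -- On the middle half of its strip the bump equals one, which gives the separation `b / (2m)`.
      _ = ∫⁻ x in {x : Fin (e + 1) → ℝ | m * x 0 - j ∈ Icc (1 / 4 : ℝ) (3 / 4)},
          ENNReal.ofReal b ∂(covariateLaw fun _ => 1) := by
          rw [setLIntegral_const, hslab j _ _ (by norm_num) (by norm_num)]
      _ ≤ ∫⁻ x in {x : Fin (e + 1) → ℝ | m * x 0 - j ∈ Icc (1 / 4 : ℝ) (3 / 4)},
          ENNReal.ofReal ((μ ξ x - μ (flip j ξ) x) ^ 2) ∂(covariateLaw fun _ => 1) := by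
          refine setLIntegral_mono' (hmeasSlab j _ measurableSet_Icc) fun x hx => ?_
          rw [hdiff, hone _ hx, one_pow, mul_one]
      _ ≤ _ := by
          refine lintegral_mono_set fun x hx => ?_
          have hx' : m * x 0 - j ∈ Icc (1 / 4 : ℝ) (3 / 4) := hx
          exact ⟨by linarith [hx'.1], by linarith [hx'.2]⟩
  · intro ξ
    exact le_iSup₂_of_le (μ ξ) (hclass ξ) (le_iSup₂_of_le (fun _ => 1) (one_mem_scaleClass hC)
      (le_iSup₂_of_le (fun _ => 1) (one_mem_densityClass hK) le_rfl))

end LocationScale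

end

/-! ### The two-sided rate -/

theorem corollary4
    (d p : ℕ) (hd : 1 ≤ d) (hp : 1 ≤ p) (hdp : d = 1 → p ≤ 2)
    (s : ℕ) (γ : ℝ) (hγ₀ : 0 < γ) (hγ₁ : γ ≤ 1) (α : ℝ) (hα : α = s + γ)
    (L : ℝ) (hL : 0 < L) (B : ℕ → ℝ) (hB : ∀ k ≤ s, 0 < B k)
    (K : ℝ) (hK : 1 < K) (C : ℝ) (hC : 0 < C)
    (f₀ : ℝ → ℝ) (hf₀ : LocationScale.IsStandardErrorDensity f₀)
    (η₀ σ₀ : ℝ) (hσ₀ : 0 < σ₀) :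
    ∃ c₁ c₂ : ℝ, 0 < c₁ ∧ 0 < c₂ ∧ ∀ n : ℕ, 1 ≤ n →
      ENNReal.ofReal (c₁ * (n : ℝ) ^ (-(2 * α) / (2 * α + 1))) ≤
          LocationScale.minimaxRisk n (LocationScale.locScale f₀ η₀ σ₀)
            (LocationScale.multipleIndexClass d p s γ L B)
            (LocationScale.scaleClass d C) (LocationScale.densityClass d K) ∧
        LocationScale.minimaxRisk n (LocationScale.locScale f₀ η₀ σ₀)
            (LocationScale.multipleIndexClass d p s γ L B)
            (LocationScale.scaleClass d C) (LocationScale.densityClass d K) ≤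
          ENNReal.ofReal (c₂ * (n : ℝ) ^ (-(2 * α) / (2 * α + 1))) := by
  subst hα
  -- The fixed shift and scale of the errors are absorbed into the regular density, so both bounds
  -- apply to it directly.
  have hf := hf₀.regularDensity.locScale η₀ hσ₀
  obtain ⟨c₁, hc₁, h₁⟩ := LocationScale.le_minimaxRisk hf hd hp hdp hγ₀ hγ₁ hL hB hK hC.le
  obtain ⟨c₂, hc₂, h₂⟩ := LocationScale.minimaxRisk_le (p := p) hf hd hγ₀ hγ₁ hL hB hK hC.le
  exact ⟨c₁, c₂, hc₁, hc₂, fun n hn => ⟨h₁ n hn, h₂ n hn⟩⟩
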